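/- Let $f(x)=c^\top x+x^\top \mathbf G x+\mathbf T[x,x,x]+\frac1{24}\|\mathbf A x\|_4^4$ on $\mathbb R^d$ be convex, where $c\in\mathbb R^d$, $\mathbf G\in\mathbb R^{d\times d}$, $\mathbf T\in\mathbb R^{d\times d\times d}$, $\mathbf A\in\mathbb R^{n\times d}$ and $\mathbf B:=\mathbf A^\top\mathbf A\succ0$. Put $\|v\|_{\mathbf B}^2=v^\top\mathbf Bv$ and $\|g\|_{\mathbf B^{-1}}^2=g^\top\mathbf B^{-1}g$. Then $f$ has a minimizer $x^*$. For a starting point $x_0$ let $\mathcal F=\max\{f(x):\|x-x_0\|_{\mathbf B}\le2\|x_0-x^*\|_{\mathbf B}\}$, $\mathcal L=\{x:f(x)\le\mathcal F\}$, $\mathcal P(x_0)=\max_{x,y\in\mathcal L}\|x-y\|_{\mathbf B}^2$, $\mathcal G(x_0)=\max_{x\in\mathcal L}\|\nabla f(x)\|_{\mathbf B^{-1}}^2$ and $\mathcal Z=\max\{1,\mathcal P(x_0),\mathcal G(x_0)\}$. The method $\mathsf{FastQuartic}$ has parameters $\rho^-,\tilde\varepsilon>0$ and $N,K,M,J\in\mathbb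 N$. * $\mathsf{ApproxAuxMin}(y)$ approximately minimizes $\Gamma(h)=\langle\nabla f(y),h\rangle+\frac12h^\top\nabla^2f(y)h+\frac16\nabla^3f(y)[h]^3+\frac14\|h\|_{\mathbf B}^4$ by $K$ steps $h_{t+1}=\arg\min_h\{\langle\nabla\Gamma(h_t),h\rangle+(1+\frac1{\sqrt2})(\varphi(h)-\varphi(h_t)-\langle\nabla\varphi(h_t),h-h_t\rangle)\}$ from $h_0=0$, with $\varphi(h)=\frac12h^\top\nabla^2f(y)h+\frac14\|h\|_{\mathbf B}^4$, and returns $y+h_K$. Each step amounts to solving $\nabla\varphi(h)=p$ for a given vector $p$. This is done approximately, by $J$ bisection steps for the scalar equation $\lambda=\|(\nabla^2f(y)+\lambda\mathbf B)^{-1}p\|_{\mathbf B}^2$ on $[0,(p^\top\mathbf B^{-1}p)^{1/3}]$; with $\lambda$ the upper end of the final bracket, $h=(\nabla^2f(y)+\lambda\mathbf B)^{-1}p$. * A run from $x_0$ starts with $A_0=0$, $\psi_0(x)=\frac12\|x-x_0\|_{\mathbf B}^2$ and has iterations $k=0,\dots,N$. Let $v_k=\arg\min\psi_k$, and for $\rho>0$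 let $a(\rho)=\frac{1+\sqrt{1+4A_k\rho}}{2\rho}$, $\tau=\frac{a(\rho)}{A_k+a(\rho)}$, $y(\rho)=(1-\tau)x_k+\tau v_k$, $x(\rho)=\mathsf{ApproxAuxMin}(y(\rho))$, $\hat\zeta(\rho)=\|x(\rho)-y(\rho)\|_{\mathbf B}^2$. If $\rho^->(1+\tilde\varepsilon_{fs})\hat\zeta(\rho^-)$ or $\rho^->\hat\zeta(\rho^-)-(6\mathcal P^{1/2}+5)\tilde\varepsilon^{1/4}$, where $\tilde\varepsilon_{fs}=\min\{\frac{3\mathcal P\rho^-}{32\mathcal G},\frac12\}$, return $x(\rho^-)$. Otherwise run at most $M$ steps of binary search on $[\rho^-,\mathcal P]$ for $\rho=\hat\zeta(\rho)$: at the midpoint $\hat\rho$ replace the upper end if $\hat\rho>\hat\zeta(\hat\rho)+\tilde\delta$, replace the lower end if $\hat\rho<\hat\zeta(\hat\rho)-\tilde\delta$, and stop otherwise, with $\tilde\delta=6\tilde\varepsilon^{1/4}\mathcal P^{1/2}+(12\tilde\varepsilon)^{1/2}$. With $\hat\rho$ the last midpoint, set $x_{k+1}=x(\hat\rho)$, $a_{k+1}=a(\hat\rho)$,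 $A_{k+1}=A_k+a_{k+1}$, $\psi_{k+1}(x)=\psi_k(x)+a_{k+1}(f(x_{k+1})+\langle\nabla f(x_{k+1}),x-x_{k+1}\rangle)$. The run returns $x_{N+1}$ unless it returned earlier. * The run is repeated $S$ times, each time from the previous output, with $\mathcal P,\mathcal G$ taken at the current starting point. Cost is measured in elementary real operations, derivative-oracle calls (evaluations of $\nabla f(x)$, $\nabla^2f(y)h$ or $\frac12\nabla^3f(y)[h]^2$ from the sparse coefficients, whose arithmetic is also counted among the operations), and solutions of $d\times d$ linear systems (with matrix $\mathbf B$ or $\nabla^2f(y)+\lambda\mathbf B$; forming the system is part of solving it). Let $\mathrm{nnz}=\mathrm{nnz}(c)+\mathrm{nnz}(\mathbf G)+\mathrm{nnz}(\mathbf T)+\mathrm{nnz}(\mathbf A)$. **Theorem.** There are absolute constants $C,p$ such that, for all such $f$: $\nabla f(x)$ is computed with at most $C\,\mathrm{nnz}$ operations; and for every $x_0$ and every $\varepsilon>0$ there are an initialization $\rho^-\in(0,\frac12)$ with $2\mathcal P(x_0)\rho^-\le\varepsilon$, $\tilde\varepsilon\in(0,\frac12)$, $N,K,M,J$, and a number $S$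 of runs, for which $\mathsf{FastQuartic}$ started at $x_0$ outputs a point $x$ with $$f(x)-f(x^*)\le\varepsilon,$$ using at most $E:=C\,n^{1/5}\log^p\!\big(\mathcal Z/\min\{\varepsilon,\tfrac12\}\big)$ derivative-oracle calls, at most $E$ linear-system solves, and at most $E\cdot\mathrm{nnz}$ elementary operations. Thus, if a linear-system solve takes time $\mathrm{LSS}$, the total time is at most $E\cdot(\mathrm{nnz}+\mathrm{LSS})$. -/

import Mathlib

open scoped Matrix

/-! ### Cost model: exact real arithmetic, with a tally carried along every computation -/

/-- Resources used by a computation. -/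
structure Cost where
  /-- elementary real operations (arithmetic, roots, comparisons) -/
  ops : ℕ
  /-- derivative-oracle calls: evaluations of `∇f(x)`, `∇²f(x)h` or `∇³f(x)[h,h]` -/
  oracle : ℕ
  /-- `d × d` linear systems solved -/
  solves : ℕ

instance : Zero Cost := ⟨⟨0, 0, 0⟩⟩

instance : Add Cost :=
  ⟨fun a b => ⟨a.ops + b.ops, a.oracle + b.oracle, a.solves + b.solves⟩⟩

/-- A value together with the resources spent on computing it. -/
structure Timed (α : Type) where
  val : α
  cost : Cost

instance : Monad Timed where
  pure a := ⟨a, 0⟩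
  bind m k := ⟨(k m.val).val, m.cost + (k m.val).cost⟩

/-- The value `a`, obtained with `k` elementary operations. -/
def Timed.op {α : Type} (k : ℕ) (a : α) : Timed α := ⟨a, ⟨k, 0, 0⟩⟩

/-- Register one derivative-oracle call (its arithmetic is charged separately). -/
def Timed.oracleCall : Timed Unit := ⟨(), ⟨0, 1, 0⟩⟩

/-- Solve the linear system `M z = b`. Below, `M` is positive definite unless `b = 0`, and then
the value is the solution `0`. -/
noncomputable def Timed.solve {d : ℕ} (M : Matrix (Fin d) (Fin d) ℝ) (b : Fin d → ℝ) :
    Timed (Fin d → ℝ) := ⟨M⁻¹ *ᵥ b, ⟨0, 0, 1⟩⟩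

/-- Scalar product. -/
def Timed.dot {d : ℕ} (x y : Fin d → ℝ) : Timed ℝ := .op (2 * d) (x ⬝ᵥ y)

/-- Add `t` to the `i`-th cell of an array. -/
def addAt {m : ℕ} (g : Fin m → ℝ) (i : Fin m) (t : ℝ) : Fin m → ℝ :=
  Function.update g i (g i + t)

/-! ### Derivatives in coordinates -/

/-- The gradient of `f` at `x`, as a vector of partial derivatives. -/
noncomputable def gradVec {d : ℕ} (f : (Fin d → ℝ) → ℝ) (x : Fin d → ℝ) : Fin d → ℝ :=
  fun i => fderiv ℝ f x (Pi.single i 1)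

/-- The Hessian matrix of `f` at `x`. -/
noncomputable def hessMat {d : ℕ} (f : (Fin d → ℝ) → ℝ) (x : Fin d → ℝ) :
    Matrix (Fin d) (Fin d) ℝ :=
  Matrix.of fun i j => fderiv ℝ (fun z => gradVec f z i) x (Pi.single j 1)

/-! ### Structured quartics -/

/-- Coefficients of `f(x) = cᵀx + xᵀGx + T[x,x,x] + (1/24)‖Ax‖₄⁴`. -/
structure Quartic (d n : ℕ) where
  c : Fin d → ℝ
  G : Matrix (Fin d) (Fin d) ℝ
  T : Fin d → Fin d → Fin d → ℝ
  A : Matrix (Fin n) (Fin d) ℝ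

namespace Quartic

/-- The objective function. -/
noncomputable def f {d n : ℕ} (q : Quartic d n) (x : Fin d → ℝ) : ℝ :=
  q.c ⬝ᵥ x + x ⬝ᵥ (q.G *ᵥ x) + (∑ i, ∑ j, ∑ k, q.T i j k * x i * x j * x k)
    + 1 / 24 * ∑ r, |(q.A *ᵥ x) r| ^ 4

/-- `B = AᵀA`. -/
def B {d n : ℕ} (q : Quartic d n) : Matrix (Fin d) (Fin d) ℝ := q.Aᵀ * q.A

/-- `‖v‖_B²`. -/
def normSqB {d n : ℕ} (q : Quartic d n) (v : Fin d → ℝ) : ℝ := v ⬝ᵥ (q.B *ᵥ v)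

/-- `‖g‖_{B⁻¹}²`. -/
noncomputable def normSqBInv {d n : ℕ} (q : Quartic d n) (g : Fin d → ℝ) : ℝ :=
  g ⬝ᵥ (q.B⁻¹ *ᵥ g)

/-! #### Problem-dependent parameters

`xs` is the minimizer of `f`, `x₀` the starting point. -/

/-- The `B`-ball around `x₀` of radius `2‖x₀ - xs‖_B`. -/
def ballK {d n : ℕ} (q : Quartic d n) (xs x₀ : Fin d → ℝ) : Set (Fin d → ℝ) :=
  {x | q.normSqB (x - x₀) ≤ 4 * q.normSqB (x₀ - xs)}

/-- The maximum of `f` over that ball. -/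
noncomputable def maxF {d n : ℕ} (q : Quartic d n) (xs x₀ : Fin d → ℝ) : ℝ :=
  sSup (q.f '' q.ballK xs x₀)

/-- The corresponding sublevel set of `f`. -/
def levelL {d n : ℕ} (q : Quartic d n) (xs x₀ : Fin d → ℝ) : Set (Fin d → ℝ) :=
  {x | q.f x ≤ q.maxF xs x₀}

/-- `𝒫`: the squared `B`-diameter of the sublevel set. -/
noncomputable def paramP {d n : ℕ} (q : Quartic d n) (xs x₀ : Fin d → ℝ) : ℝ :=
  sSup {r | ∃ x ∈ q.levelL xs x₀, ∃ y ∈ q.levelL xs x₀, r = q.normSqB (x - y)}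

/-- `𝒢`: the maximal squared dual norm of the gradient over the sublevel set. -/
noncomputable def paramG {d n : ℕ} (q : Quartic d n) (xs x₀ : Fin d → ℝ) : ℝ :=
  sSup {r | ∃ x ∈ q.levelL xs x₀, r = q.normSqBInv (gradVec q.f x)}

/-- `𝒵 = max {1, 𝒫, 𝒢}`; the `1` is the Lipschitz constant `L₃` of `∇³f` with respect to
`‖·‖_B`. -/
noncomputable def paramZ {d n : ℕ} (q : Quartic d n) (xs x₀ : Fin d → ℝ) : ℝ :=
  max 1 (max (q.paramP xs x₀) (q.paramG xs x₀))

/-! #### Sparse evaluation of the derivatives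

The coefficients are stored as lists of their nonzero entries; fresh arrays hold zeros. -/

noncomputable def nzc {d n : ℕ} (q : Quartic d n) : List (Fin d) :=
  (Finset.univ.filter fun i => q.c i ≠ 0).toList

noncomputable def nzG {d n : ℕ} (q : Quartic d n) : List (Fin d × Fin d) :=
  (Finset.univ.filter fun e : Fin d × Fin d => q.G e.1 e.2 ≠ 0).toList

noncomputable def nzT {d n : ℕ} (q : Quartic d n) : List (Fin d × Fin d × Fin d) :=
  (Finset.univ.filter fun e : Fin d × Fin d × Fin d => q.T e.1 e.2.1 e.2.2 ≠ 0).toList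

noncomputable def nzA {d n : ℕ} (q : Quartic d n) : List (Fin n × Fin d) :=
  (Finset.univ.filter fun e : Fin n × Fin d => q.A e.1 e.2 ≠ 0).toList

/-- `nnz(c) + nnz(G) + nnz(T) + nnz(A)`. -/
noncomputable def nnz {d n : ℕ} (q : Quartic d n) : ℕ :=
  q.nzc.length + q.nzG.length + q.nzT.length + q.nzA.length

/-- `A x`. -/
noncomputable def mulA {d n : ℕ} (q : Quartic d n) (x : Fin d → ℝ) : Timed (Fin n → ℝ) :=
  q.nzA.foldlM (fun u e => Timed.op 2 (addAt u e.1 (q.A e.1 e.2 * x e.2))) 0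

/-- `B x = Aᵀ(A x)`. -/
noncomputable def mulB {d n : ℕ} (q : Quartic d n) (x : Fin d → ℝ) : Timed (Fin d → ℝ) := do
  let u ← q.mulA x
  q.nzA.foldlM (fun g e => Timed.op 2 (addAt g e.2 (q.A e.1 e.2 * u e.1))) 0

/-- `∇f(x)`. -/
noncomputable def gradient {d n : ℕ} (q : Quartic d n) (x : Fin d → ℝ) :
    Timed (Fin d → ℝ) := do
  Timed.oracleCall
  let g ← q.nzc.foldlM (fun g i => Timed.op 1 (addAt g i (q.c i))) 0
  let g ← q.nzG.foldlM (fun g e => Timed.op 4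
    (addAt (addAt g e.1 (q.G e.1 e.2 * x e.2)) e.2 (q.G e.1 e.2 * x e.1))) g
  let g ← q.nzT.foldlM (fun g e =>
    let (i, j, k) := e
    Timed.op 9 (addAt (addAt (addAt g i (q.T i j k * x j * x k))
      j (q.T i j k * x i * x k)) k (q.T i j k * x i * x j))) g
  let u ← q.mulA x
  q.nzA.foldlM (fun g e => Timed.op 5
    (addAt g e.2 (q.A e.1 e.2 * (u e.1 * u e.1 * u e.1 / 6)))) g

/-- `∇²f(y) h`. -/
noncomputable def hessVec {d n : ℕ} (q : Quartic d n) (y h : Fin d → ℝ) :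
    Timed (Fin d → ℝ) := do
  Timed.oracleCall
  let g ← q.nzG.foldlM (fun g e => Timed.op 4
    (addAt (addAt g e.1 (q.G e.1 e.2 * h e.2)) e.2 (q.G e.1 e.2 * h e.1))) 0
  let g ← q.nzT.foldlM (fun g e =>
    let (i, j, k) := e
    Timed.op 15 (addAt (addAt (addAt g i (q.T i j k * (y j * h k + h j * y k)))
      j (q.T i j k * (y i * h k + h i * y k))) k (q.T i j k * (y i * h j + h i * y j)))) g
  let u ← q.mulA y
  let w ← q.mulA h
  q.nzA.foldlM (fun g e => Timed.op 5
    (addAt g e.2 (q.A e.1 e.2 * (u e.1 * u e.1 * w e.1 / 2)))) g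

/-- `(1/2) ∇³f(y)[h,h]`. -/
noncomputable def thirdVec {d n : ℕ} (q : Quartic d n) (y h : Fin d → ℝ) :
    Timed (Fin d → ℝ) := do
  Timed.oracleCall
  let g ← q.nzT.foldlM (fun g e =>
    let (i, j, k) := e
    Timed.op 9 (addAt (addAt (addAt g i (q.T i j k * h j * h k))
      j (q.T i j k * h i * h k)) k (q.T i j k * h i * h j))) 0
  let u ← q.mulA y
  let w ← q.mulA h
  q.nzA.foldlM (fun g e => Timed.op 5
    (addAt g e.2 (q.A e.1 e.2 * (u e.1 * w e.1 * w e.1 / 2)))) g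

/-- `‖v‖_B²`. -/
noncomputable def evalNormSqB {d n : ℕ} (q : Quartic d n) (v : Fin d → ℝ) : Timed ℝ := do
  let b ← q.mulB v
  Timed.dot v b

/-! #### ApproxAuxMin

It minimizes, over `h`,
`Γ(h) = ⟨∇f(y), h⟩ + (1/2) hᵀ∇²f(y)h + (1/6)∇³f(y)[h,h,h] + (1/4)‖h‖_B⁴`
by Bregman gradient steps for `φ(h) = (1/2) hᵀ∇²f(y)h + (1/4)‖h‖_B⁴`:
`h_{t+1} = argmin_h ⟨∇Γ(h_t), h⟩ + (1 + 1/√2) (φ(h) - φ(h_t) - ⟨∇φ(h_t), h - h_t⟩)`,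
that is, `∇φ(h_{t+1}) = ∇φ(h_t) - ∇Γ(h_t) / (1 + 1/√2)`. -/

/-- `J` bisection steps for the `l` with `l = ‖(∇²f(y) + l B)⁻¹p‖_B²`, which lies in `[lo, hi]`;
the upper end of the last bracket is returned. -/
noncomputable def bisect {d n : ℕ} (q : Quartic d n) (y p : Fin d → ℝ) :
    (J : ℕ) → (lo hi : ℝ) → Timed ℝ
  | 0, _, hi => pure hi
  | J + 1, lo, hi => do
      let l ← Timed.op 2 ((lo + hi) / 2)
      let h ← Timed.solve (hessMat q.f y + l • q.B) p
      let r ← q.evalNormSqB h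
      Timed.op 1 ()
      if r ≤ l then q.bisect y p J lo l else q.bisect y p J l hi

/-- Approximate solution `h` of `∇φ(h) = ∇²f(y)h + ‖h‖_B² B h = p`. The exact solution is
`(∇²f(y) + l B)⁻¹p` for the root `l` of the scalar equation above, and
`0 ≤ l ≤ (pᵀB⁻¹p)^{1/3}`. -/
noncomputable def innerSolve {d n : ℕ} (q : Quartic d n) (J : ℕ) (y p : Fin d → ℝ) :
    Timed (Fin d → ℝ) := do
  let z ← Timed.solve q.B p
  let s ← Timed.dot p z
  let hi ← Timed.op 2 (s ^ ((1 : ℝ) / 3))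
  let l ← q.bisect y p J 0 hi
  Timed.solve (hessMat q.f y + l • q.B) p

/-- `K` Bregman gradient steps from `h`; here `g = ∇f(y)`. -/
noncomputable def auxLoop {d n : ℕ} (q : Quartic d n) (J : ℕ) (y g : Fin d → ℝ) :
    (K : ℕ) → (h : Fin d → ℝ) → Timed (Fin d → ℝ)
  | 0, h => pure h
  | K + 1, h => do
      let Hh ← q.hessVec y h
      let th ← q.thirdVec y h
      let Bh ← q.mulB h
      let r ← Timed.dot h Bh
      let gphi ← Timed.op (2 * d) (Hh + r • Bh)
      let gGam ← Timed.op (2 * d) (g + th + gphi)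
      let p ← Timed.op (2 * d + 4) (gphi - (1 + 1 / √2)⁻¹ • gGam)
      let h' ← q.innerSolve J y p
      q.auxLoop J y g K h'

/-- `ApproxAuxMin`: an approximate minimizer `y + h_K` of the fourth-order model around `y`. -/
noncomputable def approxAuxMin {d n : ℕ} (q : Quartic d n) (K J : ℕ) (y : Fin d → ℝ) :
    Timed (Fin d → ℝ) := do
  let g ← q.gradient y
  let h ← q.auxLoop J y g K 0
  Timed.op d (y + h)

end Quartic

/-! ### RhoSearch and FastQuartic (written for `L₃ = 1`, the smoothness constant of the class) -/

/-- The initialization of the method. -/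
structure Params where
  /-- `ρ_init⁻` -/
  rho : ℝ
  /-- target accuracy of `ApproxAuxMin` -/
  epsAam : ℝ
  /-- `FastQuartic` iterations (`k = 0, …, N`) -/
  N : ℕ
  /-- iterations of `ApproxAuxMin` -/
  K : ℕ
  /-- iterations of `RhoSearch` -/
  M : ℕ
  /-- bisection steps for each subproblem of `ApproxAuxMin` -/
  J : ℕ

namespace Quartic

/-- The step `a > 0` with `a² = (A + a) / ρ`. -/
noncomputable def stepA (Ak rho : ℝ) : ℝ := (1 + √(1 + 4 * Ak * rho)) / (2 * rho)

/-- `(1 - τ) x + τ v` with `τ = a / (A + a)`. -/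
noncomputable def mix {d : ℕ} (x v : Fin d → ℝ) (Ak a : ℝ) : Fin d → ℝ :=
  (1 - a / (Ak + a)) • x + (a / (Ak + a)) • v

/-- `RhoSearch`: binary search in `[lo, hi]` for `ρ` close to `‖x(ρ) - y(ρ)‖_B²`; `P` is `𝒫`, and
`last` holds the latest `x` and `a`. It returns `(ρ, x, a)`. -/
noncomputable def rhoSearch {d n : ℕ} (q : Quartic d n) (par : Params) (P : ℝ)
    (xk vk : Fin d → ℝ) (Ak : ℝ) :
    (M : ℕ) → (lo hi : ℝ) → (last : (Fin d → ℝ) × ℝ) → Timed (ℝ × (Fin d → ℝ) × ℝ)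
  | 0, lo, _, last => pure (lo, last)
  | M + 1, lo, hi, _ => do
      let delta ← Timed.op 8
        (6 * par.epsAam ^ ((1 : ℝ) / 4) * √P + √(12 * par.epsAam))
      let rho ← Timed.op 2 ((lo + hi) / 2)
      let a ← Timed.op 7 (stepA Ak rho)
      let y ← Timed.op (3 * d + 3) (mix xk vk Ak a)
      let x ← q.approxAuxMin par.K par.J y
      let w ← Timed.op d (x - y)
      let zeta ← q.evalNormSqB w
      Timed.op 4 ()
      if rho > zeta + delta then q.rhoSearch par P xk vk Ak M lo rho (x, a)
      else if rho < zeta - delta then q.rhoSearch par P xk vk Ak M rho hi (x, a)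
      else pure (rho, x, a)

/-- The main loop of `FastQuartic`, with `m` iterations left, current iterate `x`, weight
`Ak = A_k` and `s = ∑_{i ≤ k} a_i ∇f(x_i)`. Since
`ψ_k(z) = (1/2)‖z - x₀‖_B² + ∑_{i ≤ k} a_i (f(x_i) + ⟨∇f(x_i), z - x_i⟩)`, its minimizer is
`v_k = x₀ - B⁻¹ s`. -/
noncomputable def fastLoop {d n : ℕ} (q : Quartic d n) (par : Params) (P Gc : ℝ)
    (x₀ : Fin d → ℝ) :
    (m : ℕ) → (x : Fin d → ℝ) → (Ak : ℝ) → (s : Fin d → ℝ) → Timed (Fin d → ℝ)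
  | 0, x, _, _ => pure x
  | m + 1, x, Ak, s => do
      let b ← Timed.solve q.B s
      let v ← Timed.op d (x₀ - b)
      let a ← Timed.op 7 (stepA Ak par.rho)
      let y ← Timed.op (3 * d + 3) (mix x v Ak a)
      let xm ← q.approxAuxMin par.K par.J y
      let w ← Timed.op d (xm - y)
      let r ← q.evalNormSqB w
      let epsFs ← Timed.op 6 (min (3 * P * par.rho / (32 * Gc)) (1 / 2))
      let thr ← Timed.op 5 ((6 * √P + 5) * par.epsAam ^ ((1 : ℝ) / 4))
      Timed.op 5 ()
      if par.rho > (1 + epsFs) * r then pure xm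
      else if par.rho > r - thr then pure xm
      else do
        let (_, x', a') ← q.rhoSearch par P x v Ak par.M par.rho P (x, 0)
        let g ← q.gradient x'
        let A' ← Timed.op 1 (Ak + a')
        let s' ← Timed.op (2 * d) (s + a' • g)
        q.fastLoop par P Gc x₀ m x' A' s'

/-- One run of `FastQuartic` from `x₀`, with `P = 𝒫` (the initial upper bound on `ρ`) and
`Gc = 𝒢`. -/
noncomputable def fastQuarticRun {d n : ℕ} (q : Quartic d n) (par : Params) (P Gc : ℝ)
    (x₀ : Fin d → ℝ) : Timed (Fin d → ℝ) :=
  q.fastLoop par P Gc x₀ (par.N + 1) x₀ 0 0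

/-- `FastQuartic` run `S` times, each run starting at the output of the previous one; `P` and `Gc`
give `𝒫` and `𝒢` for each starting point. -/
noncomputable def fastQuartic {d n : ℕ} (q : Quartic d n) (par : Params)
    (P Gc : (Fin d → ℝ) → ℝ) : (S : ℕ) → (x₀ : Fin d → ℝ) → Timed (Fin d → ℝ)
  | 0, x₀ => pure x₀
  | S + 1, x₀ => do
      let x ← q.fastQuarticRun par (P x₀) (Gc x₀) x₀
      q.fastQuartic par P Gc S x

end Quartic

/-! The fourth derivative of f is the constant form `af`, which Cauchy–Schwarz bounds by a product
of four B-norms. Along a line y + s z the Hessian is quadratic in s, and convexity keeps it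
nonnegative for every s (`d2_shift_nonneg`). Different choices of s give what is needed about f:
control of the third derivative by the Hessian (`abs_d3_le`), quartic growth (`f_add_ge`), and a
bound of the Hessian by the growth of f (`d2_le_growth`).

Inner solver. By `abs_d3_le` the model Γ is smooth and strongly convex relative to φ with constants
1 ± 1/√2 (`abs_model_sub_le`), so Bregman steps contract the distance to its minimizer by 5/6, up to
the bisection error (`breg_step`). Logarithmically many steps give a near-stationary point of Γ.

One run. The gradient of Γ at h is ∇f(y+h) + ‖h‖²Bh up to an error ‖h‖³/6 (`dmodel_eq`). Once ρ is
close to ‖h‖², the trial point is therefore an inexact proximal step with relative error 1/2, as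
Monteiro–Svaiter acceleration requires (`accelerated_step`). The binary search finds such a ρ
because the step length has an explicit modulus of continuity in ρ (`RunSetting.zeta_cont`). If the
lower end is already too large, its trial point is ε-accurate (`RunSetting.early_return`). The
energy dissipated by the steps is at most D²/2, where D is the initial distance; this forces A ≥
N⁵/(384 D²) for N iterations (`fourth_root_growth`), hence a gap of at most 192 D⁴/N⁵.

Restarts. Comparing the 2-norm and the 4-norm on ℝⁿ gives ‖x − x*‖⁴ ≤ 72 n (f(x) − f(x*)), the only
source of n. So about 20 n^(1/5) iterations divide the distance by three (`accurate_or_contract`).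
The new level set then lies in the old one (`levelL_subset`), so 𝒫 and 𝒢 do not grow and fixed
parameters serve all runs. All tolerances are fixed powers of θ = 𝒵/min{ε,1/2}; runs, search steps,
Bregman steps and bisection steps each number O(log θ), which gives n^(1/5) log⁴ θ. -/

namespace Quartic

variable {d n : ℕ} (q : Quartic d n)

/-! ### Multilinear forms of a structured quartic -/

/-- The map `x ↦ A x` into Euclidean space; its norm is `‖x‖_B`. -/
noncomputable def emb : (Fin d → ℝ) →ₗ[ℝ] EuclideanSpace ℝ (Fin n) :=
  (WithLp.linearEquiv 2 ℝ (Fin n → ℝ)).symm.toLinearMap ∘ₗ q.A.mulVecLin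

theorem emb_apply (x : Fin d → ℝ) (r : Fin n) : q.emb x r = (q.A *ᵥ x) r := rfl

/-- The linear part. -/
noncomputable def cf (u : Fin d → ℝ) : ℝ := ∑ i, q.c i * u i

/-- The bilinear form of `G`. -/
noncomputable def gf (a b : Fin d → ℝ) : ℝ :=
  ∑ e : Fin d × Fin d, q.G e.1 e.2 * a e.1 * b e.2

/-- The trilinear form of `T`. -/
noncomputable def tf (a b c : Fin d → ℝ) : ℝ :=
  ∑ e : Fin d × Fin d × Fin d, q.T e.1 e.2.1 e.2.2 * a e.1 * b e.2.1 * c e.2.2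

/-- The symmetric quadrilinear form `∑ (Aa)(Ab)(Ac)(Ae)`. -/
noncomputable def af (a b c e : Fin d → ℝ) : ℝ :=
  ∑ r, q.emb a r * q.emb b r * q.emb c r * q.emb e r

theorem cf_add (u v) : q.cf (u + v) = q.cf u + q.cf v := by
  simp only [cf, ← Finset.sum_add_distrib]
  exact Finset.sum_congr rfl fun i _ => by simp only [Pi.add_apply]; ring

theorem cf_smul (t : ℝ) (u) : q.cf (t • u) = t * q.cf u := by
  simp only [cf, Finset.mul_sum]
  exact Finset.sum_congr rfl fun i _ => by simp only [Pi.smul_apply, smul_eq_mul]; ring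

theorem gf_add_left (u v w) : q.gf (u + v) w = q.gf u w + q.gf v w := by
  simp only [gf, ← Finset.sum_add_distrib]
  exact Finset.sum_congr rfl fun i _ => by simp only [Pi.add_apply]; ring

theorem gf_add_right (u v w) : q.gf w (u + v) = q.gf w u + q.gf w v := by
  simp only [gf, ← Finset.sum_add_distrib]
  exact Finset.sum_congr rfl fun i _ => by simp only [Pi.add_apply]; ring

theorem gf_smul_left (t : ℝ) (u v) : q.gf (t • u) v = t * q.gf u v := by
  simp only [gf, Finset.mul_sum]
  exact Finset.sum_congr rfl fun i _ => by simp only [Pi.smul_apply, smul_eq_mul]; ring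

theorem gf_smul_right (t : ℝ) (u v) : q.gf u (t • v) = t * q.gf u v := by
  simp only [gf, Finset.mul_sum]
  exact Finset.sum_congr rfl fun i _ => by simp only [Pi.smul_apply, smul_eq_mul]; ring

theorem tf_add₁ (u v a b) : q.tf (u + v) a b = q.tf u a b + q.tf v a b := by
  simp only [tf, ← Finset.sum_add_distrib]
  exact Finset.sum_congr rfl fun i _ => by simp only [Pi.add_apply]; ring

theorem tf_add₂ (u v a b) : q.tf a (u + v) b = q.tf a u b + q.tf a v b := by
  simp only [tf, ← Finset.sum_add_distrib]
  exact Finset.sum_congr rfl fun i _ => by simp only [Pi.add_apply]; ring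

theorem tf_add₃ (u v a b) : q.tf a b (u + v) = q.tf a b u + q.tf a b v := by
  simp only [tf, ← Finset.sum_add_distrib]
  exact Finset.sum_congr rfl fun i _ => by simp only [Pi.add_apply]; ring

theorem tf_smul₁ (t : ℝ) (u a b) : q.tf (t • u) a b = t * q.tf u a b := by
  simp only [tf, Finset.mul_sum]
  exact Finset.sum_congr rfl fun i _ => by simp only [Pi.smul_apply, smul_eq_mul]; ring

theorem tf_smul₂ (t : ℝ) (u a b) : q.tf a (t • u) b = t * q.tf a u b := by
  simp only [tf, Finset.mul_sum]
  exact Finset.sum_congr rfl fun i _ => by simp only [Pi.smul_apply, smul_eq_mul]; ring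

theorem tf_smul₃ (t : ℝ) (u a b) : q.tf a b (t • u) = t * q.tf a b u := by
  simp only [tf, Finset.mul_sum]
  exact Finset.sum_congr rfl fun i _ => by simp only [Pi.smul_apply, smul_eq_mul]; ring

theorem af_add₄ (u v a b c) : q.af a b c (u + v) = q.af a b c u + q.af a b c v := by
  simp only [af, ← Finset.sum_add_distrib]
  exact Finset.sum_congr rfl fun i _ => by simp only [map_add, PiLp.add_apply]; ring

theorem af_smul₄ (t : ℝ) (u a b c) : q.af a b c (t • u) = t * q.af a b c u := by
  simp only [af, Finset.mul_sum]
  exact Finset.sum_congr rfl fun i _ => by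
    simp only [map_smul, PiLp.smul_apply, smul_eq_mul]; ring

theorem af_swap (a b c e) : q.af a b c e = q.af b a c e := by
  simp only [af]
  exact Finset.sum_congr rfl fun i _ => by ring

theorem af_swap₃₄ (a b c e) : q.af a b c e = q.af a b e c := by
  simp only [af]
  exact Finset.sum_congr rfl fun i _ => by ring

theorem af_swap₂₃ (a b c e) : q.af a b c e = q.af a c b e := by
  simp only [af]
  exact Finset.sum_congr rfl fun i _ => by ring

theorem af_add₃ (u v a b c) : q.af a b (u + v) c = q.af a b u c + q.af a b v c := by
  rw [af_swap₃₄, af_add₄, af_swap₃₄, af_swap₃₄ _ _ _ c v]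

theorem af_smul₃ (t : ℝ) (u a b c) : q.af a b (t • u) c = t * q.af a b u c := by
  rw [af_swap₃₄, af_smul₄, af_swap₃₄]

theorem af_add₂ (u v a b c) : q.af a (u + v) b c = q.af a u b c + q.af a v b c := by
  rw [af_swap₂₃, af_add₃, af_swap₂₃, af_swap₂₃ _ _ _ v]

theorem af_smul₂ (t : ℝ) (u a b c) : q.af a (t • u) b c = t * q.af a u b c := by
  rw [af_swap₂₃, af_smul₃, af_swap₂₃]

theorem af_add₁ (u v a b c) : q.af (u + v) a b c = q.af u a b c + q.af v a b c := by
  rw [af_swap, af_add₂, af_swap, af_swap _ a v]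

theorem af_smul₁ (t : ℝ) (u a b c) : q.af (t • u) a b c = t * q.af u a b c := by
  rw [af_swap, af_smul₂, af_swap]

/-- First derivative of `f`. -/
noncomputable def d1 (y : Fin d → ℝ) : (Fin d → ℝ) →ₗ[ℝ] ℝ where
  toFun u := q.cf u + (q.gf y u + q.gf u y) + (q.tf u y y + q.tf y u y + q.tf y y u)
    + 1 / 6 * q.af y y y u
  map_add' u v := by
    simp only [cf_add, gf_add_left, gf_add_right, tf_add₁, tf_add₂, tf_add₃, af_add₄]; ring
  map_smul' t u := by
    simp only [cf_smul, gf_smul_left, gf_smul_right, tf_smul₁, tf_smul₂, tf_smul₃, af_smul₄,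
      RingHom.id_apply, smul_eq_mul]; ring

/-- Second derivative of `f`. -/
noncomputable def d2 (y : Fin d → ℝ) : (Fin d → ℝ) →ₗ[ℝ] (Fin d → ℝ) →ₗ[ℝ] ℝ :=
  LinearMap.mk₂ ℝ (fun u v => (q.gf u v + q.gf v u)
    + (q.tf u v y + q.tf v u y + q.tf u y v + q.tf v y u + q.tf y u v + q.tf y v u)
    + 1 / 2 * q.af y y u v)
    (fun u u' v => by
      simp only [gf_add_left, gf_add_right, tf_add₁, tf_add₂, tf_add₃, af_add₃]; ring)
    (fun t u v => by
      simp only [gf_smul_left, gf_smul_right, tf_smul₁, tf_smul₂, tf_smul₃, af_smul₃,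
        smul_eq_mul]; ring)
    (fun u v v' => by
      simp only [gf_add_left, gf_add_right, tf_add₁, tf_add₂, tf_add₃, af_add₄]; ring)
    (fun t u v => by
      simp only [gf_smul_left, gf_smul_right, tf_smul₁, tf_smul₂, tf_smul₃, af_smul₄,
        smul_eq_mul]; ring)

/-- Third derivative of `f`. -/
noncomputable def d3 (y u : Fin d → ℝ) : (Fin d → ℝ) →ₗ[ℝ] (Fin d → ℝ) →ₗ[ℝ] ℝ :=
  LinearMap.mk₂ ℝ (fun v w => (q.tf u v w + q.tf u w v + q.tf v u w + q.tf v w u + q.tf w u v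
      + q.tf w v u) + q.af y u v w)
    (fun _ _ _ => by simp only [tf_add₁, tf_add₂, tf_add₃, af_add₃]; ring)
    (fun _ _ _ => by simp only [tf_smul₁, tf_smul₂, tf_smul₃, af_smul₃, smul_eq_mul]; ring)
    (fun _ _ _ => by simp only [tf_add₁, tf_add₂, tf_add₃, af_add₄]; ring)
    (fun _ _ _ => by simp only [tf_smul₁, tf_smul₂, tf_smul₃, af_smul₄, smul_eq_mul]; ring)

theorem d1_apply (y u) : q.d1 y u = q.cf u + (q.gf y u + q.gf u y)
    + (q.tf u y y + q.tf y u y + q.tf y y u) + 1 / 6 * q.af y y y u := rfl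

theorem d2_apply (y u v) : q.d2 y u v = (q.gf u v + q.gf v u)
    + (q.tf u v y + q.tf v u y + q.tf u y v + q.tf v y u + q.tf y u v + q.tf y v u)
    + 1 / 2 * q.af y y u v := rfl

theorem d3_apply (y u v w) : q.d3 y u v w = (q.tf u v w + q.tf u w v + q.tf v u w
    + q.tf v w u + q.tf w u v + q.tf w v u) + q.af y u v w := rfl

theorem d2_symm (y u v) : q.d2 y u v = q.d2 y v u := by
  rw [d2_apply, d2_apply, af_swap₃₄]; ring

theorem d3_swap₁₂ (y u v w) : q.d3 y u v w = q.d3 y v u w := by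
  rw [d3_apply, d3_apply, af_swap₂₃]; ring

theorem d3_swap₂₃ (y u v w) : q.d3 y u v w = q.d3 y u w v := by
  rw [d3_apply, d3_apply, af_swap₃₄]; ring

theorem f_eq (x) : q.f x = q.cf x + q.gf x x + q.tf x x x + 1 / 24 * q.af x x x x := by
  simp only [f, cf, gf, tf, af, Fintype.sum_prod_type, dotProduct, Matrix.mulVec, Finset.mul_sum]
  congr 1
  · congr 1
    congr 1
    exact Finset.sum_congr rfl fun i _ => Finset.sum_congr rfl fun j _ => by ring
  · refine Finset.sum_congr rfl fun r _ => ?_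
    have h : ∀ t : ℝ, |t| ^ 4 = t * t * t * t := fun t => by
      rw [show |t| ^ 4 = (|t| ^ 2) ^ 2 by ring, sq_abs]; ring
    rw [h]; rfl

/-- The Taylor expansion is exact because f has degree four. It also identifies `d1` and `d2` with
the analytic derivatives further on. -/
theorem f_add (y h) : q.f (y + h) = q.f y + q.d1 y h + 1 / 2 * q.d2 y h h
    + 1 / 6 * q.d3 y h h h + 1 / 24 * q.af h h h h := by
  have key : q.af (y + h) (y + h) (y + h) (y + h) = q.af y y y y + 4 * q.af y y y h
      + 6 * q.af y y h h + 4 * q.af y h h h + q.af h h h h := by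
    simp only [af, Finset.mul_sum, ← Finset.sum_add_distrib]
    exact Finset.sum_congr rfl fun i _ => by simp only [map_add, PiLp.add_apply]; ring
  rw [f_eq, f_eq, key, d1_apply, d2_apply, d3_apply]
  simp only [cf_add, gf_add_left, gf_add_right, tf_add₁, tf_add₂, tf_add₃]
  ring

theorem d1_add (y h u) : q.d1 (y + h) u = q.d1 y u + q.d2 y h u
    + 1 / 2 * q.d3 y h h u + 1 / 6 * q.af h h h u := by
  have key : q.af (y + h) (y + h) (y + h) u = q.af y y y u + 3 * q.af y y h u
      + 3 * q.af y h h u + q.af h h h u := by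
    simp only [af, Finset.mul_sum, ← Finset.sum_add_distrib]
    exact Finset.sum_congr rfl fun i _ => by simp only [map_add, PiLp.add_apply]; ring
  rw [d1_apply, d1_apply, key, d2_apply, d3_apply]
  simp only [gf_add_left, gf_add_right, tf_add₁, tf_add₂, tf_add₃]
  ring

theorem d2_add (y h u v) : q.d2 (y + h) u v = q.d2 y u v + q.d3 y h u v
    + 1 / 2 * q.af h h u v := by
  have key : q.af (y + h) (y + h) u v = q.af y y u v + 2 * q.af y h u v + q.af h h u v := by
    simp only [af, Finset.mul_sum, ← Finset.sum_add_distrib]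
    exact Finset.sum_congr rfl fun i _ => by simp only [map_add, PiLp.add_apply]; ring
  rw [d2_apply, d2_apply, key, d3_apply]
  simp only [tf_add₁, tf_add₂, tf_add₃]
  ring

theorem d3_smul_left (y : Fin d → ℝ) (t : ℝ) (u v w) :
    q.d3 y (t • u) v w = t * q.d3 y u v w := by
  rw [d3_swap₁₂, map_smul, LinearMap.smul_apply, smul_eq_mul, d3_swap₁₂]

theorem d3_add_left (y : Fin d → ℝ) (u u' v w) :
    q.d3 y (u + u') v w = q.d3 y u v w + q.d3 y u' v w := by
  rw [d3_swap₁₂, map_add, LinearMap.add_apply, d3_swap₁₂, q.d3_swap₁₂ _ v]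

/-! ### Derivatives in coordinates -/

theorem continuous_emb : Continuous q.emb := LinearMap.continuous_of_finiteDimensional _

theorem differentiable_f : Differentiable ℝ q.f := by
  have : q.f = fun x => q.cf x + q.gf x x + q.tf x x x + 1 / 24 * q.af x x x x :=
    funext q.f_eq
  rw [this]
  simp only [cf, gf, tf, af, emb_apply, Matrix.mulVec, dotProduct]
  fun_prop

theorem differentiable_d1 (u) : Differentiable ℝ fun z => q.d1 z u := by
  simp only [d1_apply, cf, gf, tf, af, emb_apply, Matrix.mulVec, dotProduct]
  fun_prop

theorem fderiv_f (x u) : fderiv ℝ q.f x u = q.d1 x u := by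
  have h1 : HasLineDerivAt ℝ q.f (fderiv ℝ q.f x u) x u :=
    (q.differentiable_f x).hasFDerivAt.hasLineDerivAt u
  -- Differentiability is known, so the derivative can be read off from the polynomial t ↦ f(x + t
  -- u).
  have h2 : HasLineDerivAt ℝ q.f (q.d1 x u) x u := by
    have h3 : (fun t : ℝ => q.f (x + t • u)) = fun t => q.f x + t * q.d1 x u
        + t ^ 2 * (1 / 2 * q.d2 x u u) + t ^ 3 * (1 / 6 * q.d3 x u u u)
        + t ^ 4 * (1 / 24 * q.af u u u u) := by
      funext t
      rw [f_add]
      simp only [map_smul, LinearMap.smul_apply, smul_eq_mul, d3_smul_left, af_smul₁, af_smul₂,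
        af_smul₃, af_smul₄]
      ring
    rw [HasLineDerivAt, h3]
    have h4 := (((((hasDerivAt_id (0 : ℝ)).mul_const (q.d1 x u)).const_add (q.f x)).add
      ((hasDerivAt_pow 2 (0 : ℝ)).mul_const (1 / 2 * q.d2 x u u))).add
      ((hasDerivAt_pow 3 (0 : ℝ)).mul_const (1 / 6 * q.d3 x u u u))).add
      ((hasDerivAt_pow 4 (0 : ℝ)).mul_const (1 / 24 * q.af u u u u))
    exact h4.congr_deriv (by simp)
  exact h1.unique h2

theorem fderiv_d1 (x u v) : fderiv ℝ (fun z => q.d1 z u) x v = q.d2 x v u := by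
  have h1 : HasLineDerivAt ℝ (fun z => q.d1 z u) (fderiv ℝ (fun z => q.d1 z u) x v) x v :=
    (q.differentiable_d1 u x).hasFDerivAt.hasLineDerivAt v
  have h2 : HasLineDerivAt ℝ (fun z => q.d1 z u) (q.d2 x v u) x v := by
    have h3 : (fun t : ℝ => q.d1 (x + t • v) u) = fun t => q.d1 x u + t * q.d2 x v u
        + t ^ 2 * (1 / 2 * q.d3 x v v u) + t ^ 3 * (1 / 6 * q.af v v v u) := by
      funext t
      rw [d1_add]
      simp only [map_smul, LinearMap.smul_apply, smul_eq_mul, d3_smul_left, af_smul₁, af_smul₂,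
        af_smul₃]
      ring
    rw [HasLineDerivAt, h3]
    have h4 := ((((hasDerivAt_id (0 : ℝ)).mul_const (q.d2 x v u)).const_add (q.d1 x u)).add
      ((hasDerivAt_pow 2 (0 : ℝ)).mul_const (1 / 2 * q.d3 x v v u))).add
      ((hasDerivAt_pow 3 (0 : ℝ)).mul_const (1 / 6 * q.af v v v u))
    exact h4.congr_deriv (by simp)
  exact h1.unique h2

theorem _root_.LinearMap.dotProduct_single_eq {d : ℕ} (l : (Fin d → ℝ) →ₗ[ℝ] ℝ)
    (u : Fin d → ℝ) : (fun i => l (Pi.single i 1)) ⬝ᵥ u = l u := by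
  rw [l.pi_apply_eq_sum_univ u, dotProduct]
  exact Finset.sum_congr rfl fun i _ => by
    rw [smul_eq_mul, mul_comm]
    congr 2
    funext j
    simp [Pi.single_apply, eq_comm]

theorem gradVec_dot (x u) : gradVec q.f x ⬝ᵥ u = q.d1 x u := by
  rw [← LinearMap.dotProduct_single_eq (q.d1 x) u]
  congr 1
  funext i
  exact q.fderiv_f x _

theorem dot_hessMat (x u v) : u ⬝ᵥ (hessMat q.f x *ᵥ v) = q.d2 x u v := by
  have h1 : ∀ i j, hessMat q.f x i j = q.d2 x (Pi.single i 1) (Pi.single j 1) := by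
    intro i j
    have h2 : (fun z => gradVec q.f z i) = fun z => q.d1 z (Pi.single i 1) := by
      funext z; exact q.fderiv_f z _
    rw [hessMat, Matrix.of_apply, h2, fderiv_d1, d2_symm]
  have h3 : hessMat q.f x *ᵥ v = fun i => (q.d2 x (Pi.single i 1)) v := by
    funext i
    rw [← LinearMap.dotProduct_single_eq (q.d2 x (Pi.single i 1)) v]
    simp only [Matrix.mulVec]
    congr 1
    funext j
    exact h1 i j
  rw [h3, dotProduct_comm, ← LinearMap.flip_apply,
    ← LinearMap.dotProduct_single_eq ((q.d2 x).flip v) u]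
  rfl

/-! ### `B`-norms -/

theorem inner_emb (x y) : inner ℝ (q.emb x) (q.emb y) = x ⬝ᵥ (q.B *ᵥ y) := by
  rw [B, ← Matrix.mulVec_mulVec, Matrix.dotProduct_mulVec, Matrix.vecMul_transpose]
  rw [PiLp.inner_apply, dotProduct]
  exact Finset.sum_congr rfl fun i _ => by simp [emb_apply, mul_comm]

theorem normSqB_eq (x) : q.normSqB x = ‖q.emb x‖ ^ 2 := by
  rw [normSqB, ← inner_emb, real_inner_self_eq_norm_sq]

theorem B_dot (x y) : (q.B *ᵥ x) ⬝ᵥ y = inner ℝ (q.emb x) (q.emb y) := by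
  rw [real_inner_comm, inner_emb, dotProduct_comm]

end Quartic

/-! ### Values and costs of the elementary computations -/

@[simp] theorem Cost.add_ops (a b : Cost) : (a + b).ops = a.ops + b.ops := rfl

theorem Cost.ext' {a b : Cost} (h1 : a.ops = b.ops) (h2 : a.oracle = b.oracle)
    (h3 : a.solves = b.solves) : a = b := by
  cases a; cases b; simp_all

namespace Timed

variable {α β : Type}

@[simp] theorem bind_val (m : Timed α) (k : α → Timed β) : (m >>= k).val = (k m.val).val := rfl
@[simp] theorem bind_cost (m : Timed α) (k : α → Timed β) :
    (m >>= k).cost = m.cost + (k m.val).cost := rfl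
@[simp] theorem op_val (k : ℕ) (a : α) : (op k a).val = a := rfl
@[simp] theorem op_cost (k : ℕ) (a : α) : (op k a).cost = ⟨k, 0, 0⟩ := rfl
@[simp] theorem oracleCall_cost : oracleCall.cost = ⟨0, 1, 0⟩ := rfl
@[simp] theorem dot_val {d : ℕ} (x y : Fin d → ℝ) : (dot x y).val = x ⬝ᵥ y := rfl
@[simp] theorem dot_cost {d : ℕ} (x y : Fin d → ℝ) : (dot x y).cost = ⟨2 * d, 0, 0⟩ := rfl
@[simp] theorem solve_val {d : ℕ} (M : Matrix (Fin d) (Fin d) ℝ) (b) :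
    (solve M b).val = M⁻¹ *ᵥ b := rfl

theorem foldlM_op_val (l : List α) (k : ℕ) (F : β → α → β) (g : β) :
    (l.foldlM (fun g e => op k (F g e)) g).val = l.foldl F g := by
  induction l generalizing g with
  | nil => rfl
  | cons a l ih => rw [List.foldlM_cons, bind_val, op_val, ih]; rfl

theorem foldlM_op_cost (l : List α) (k : ℕ) (F : β → α → β) (g : β) :
    (l.foldlM (fun g e => op k (F g e)) g).cost = ⟨k * l.length, 0, 0⟩ := by
  induction l generalizing g with
  | nil => rfl
  | cons a l ih =>
    rw [List.foldlM_cons, bind_cost, op_val, ih, op_cost]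
    refine Cost.ext' ?_ rfl rfl
    simp only [Cost.add_ops, List.length_cons]; ring

end Timed

theorem addAt_dot {m : ℕ} (g : Fin m → ℝ) (i : Fin m) (t : ℝ) (u : Fin m → ℝ) :
    addAt g i t ⬝ᵥ u = g ⬝ᵥ u + t * u i := by
  have : addAt g i t = g + Pi.single i t := by
    funext j
    by_cases h : j = i
    · subst h; simp [addAt]
    · simp [addAt, h]
  rw [this, add_dotProduct, single_dotProduct]

/-- Testing against a fixed vector turns an accumulation loop into a sum of scalars, so the sparse
evaluations reduce to identities between finite sums. -/
theorem List.foldl_dot {α : Type} {m : ℕ} (l : List α) (F : (Fin m → ℝ) → α → Fin m → ℝ)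
    (u : Fin m → ℝ) (s : α → ℝ) (h : ∀ g e, F g e ⬝ᵥ u = g ⬝ᵥ u + s e) (g : Fin m → ℝ) :
    l.foldl F g ⬝ᵥ u = g ⬝ᵥ u + (l.map s).sum := by
  induction l generalizing g with
  | nil => simp
  | cons a l ih => rw [List.foldl_cons, ih, h, List.map_cons, List.sum_cons]; ring

theorem Finset.sum_map_toList_filter {α : Type} [Fintype α] (P : α → Prop) [DecidablePred P]
    (s : α → ℝ) (h : ∀ e, ¬ P e → s e = 0) :
    (((Finset.univ.filter P).toList).map s).sum = ∑ e, s e := by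
  rw [Finset.sum_map_toList, Finset.sum_filter_of_ne]
  intro e _ he
  by_contra hP
  exact he (h e hP)

namespace Quartic

variable {d n : ℕ} (q : Quartic d n)

/-! ### Correctness and cost of the sparse evaluations -/

theorem sum_nzc (s : Fin d → ℝ) : (q.nzc.map fun i => q.c i * s i).sum = ∑ i, q.c i * s i :=
  Finset.sum_map_toList_filter _ _ fun e he => by simp [not_not.1 he]

theorem sum_nzG (s : Fin d × Fin d → ℝ) : (q.nzG.map fun e => q.G e.1 e.2 * s e).sum
    = ∑ e : Fin d × Fin d, q.G e.1 e.2 * s e :=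
  Finset.sum_map_toList_filter _ _ fun e he => by simp [not_not.1 he]

theorem sum_nzT (s : Fin d × Fin d × Fin d → ℝ) :
    (q.nzT.map fun e => q.T e.1 e.2.1 e.2.2 * s e).sum
    = ∑ e : Fin d × Fin d × Fin d, q.T e.1 e.2.1 e.2.2 * s e :=
  Finset.sum_map_toList_filter _ _ fun e he => by simp [not_not.1 he]

theorem sum_nzA (s : Fin n × Fin d → ℝ) : (q.nzA.map fun e => q.A e.1 e.2 * s e).sum
    = ∑ e : Fin n × Fin d, q.A e.1 e.2 * s e :=
  Finset.sum_map_toList_filter _ _ fun e he => by simp [not_not.1 he]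

theorem sum_A (u : Fin n → ℝ) (x : Fin d → ℝ) :
    ∑ e : Fin n × Fin d, q.A e.1 e.2 * (x e.2 * u e.1) = ∑ r, u r * q.emb x r := by
  rw [Fintype.sum_prod_type]
  refine Finset.sum_congr rfl fun r _ => ?_
  rw [emb_apply, Matrix.mulVec, dotProduct, Finset.mul_sum]
  exact Finset.sum_congr rfl fun j _ => by ring

theorem mulA_val (x : Fin d → ℝ) : (q.mulA x).val = q.A *ᵥ x := by
  refine dotProduct_eq _ _ fun u => ?_
  rw [mulA, Timed.foldlM_op_val, List.foldl_dot _ _ u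
    (fun e => q.A e.1 e.2 * (x e.2 * u e.1)) (fun g e => by rw [addAt_dot]; ring),
    sum_nzA, sum_A, zero_dotProduct, zero_add, dotProduct_comm]
  rfl

theorem mulA_cost (x : Fin d → ℝ) : (q.mulA x).cost = ⟨2 * q.nzA.length, 0, 0⟩ := by
  rw [mulA, Timed.foldlM_op_cost]

theorem mulB_val (x : Fin d → ℝ) : (q.mulB x).val = q.B *ᵥ x := by
  refine dotProduct_eq _ _ fun u => ?_
  rw [mulB, Timed.bind_val, mulA_val, Timed.foldlM_op_val, List.foldl_dot _ _ u
    (fun e => q.A e.1 e.2 * (u e.2 * q.emb x e.1)) (fun g e => by rw [addAt_dot, emb_apply]; ring),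
    sum_nzA, sum_A, zero_dotProduct, zero_add, B_dot, PiLp.inner_apply]
  exact Finset.sum_congr rfl fun i _ => by simp [mul_comm]

theorem mulB_cost (x : Fin d → ℝ) : (q.mulB x).cost = ⟨4 * q.nzA.length, 0, 0⟩ := by
  rw [mulB, Timed.bind_cost, mulA_cost, Timed.foldlM_op_cost]
  refine Cost.ext' ?_ rfl rfl
  simp only [Cost.add_ops]; ring

theorem gradient_val_dot (x u : Fin d → ℝ) : (q.gradient x).val ⬝ᵥ u = q.d1 x u := by
  simp only [gradient, Timed.bind_val, Timed.foldlM_op_val, mulA_val]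
  rw [List.foldl_dot _ _ u
      (fun e => q.A e.1 e.2 * (u e.2 * (q.emb x e.1 * q.emb x e.1 * q.emb x e.1 / 6)))
      (fun g e => by rw [addAt_dot]; simp only [emb_apply]; ring),
    List.foldl_dot _ _ u (fun e => q.T e.1 e.2.1 e.2.2 * (x e.2.1 * x e.2.2 * u e.1
      + x e.1 * x e.2.2 * u e.2.1 + x e.1 * x e.2.1 * u e.2.2))
      (fun g e => by simp only [addAt_dot]; ring),
    List.foldl_dot _ _ u (fun e => q.G e.1 e.2 * (x e.2 * u e.1 + x e.1 * u e.2))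
      (fun g e => by simp only [addAt_dot]; ring),
    List.foldl_dot _ _ u (fun i => q.c i * u i) (fun g e => by simp only [addAt_dot]),
    sum_nzA, q.sum_A (fun r => q.emb x r * q.emb x r * q.emb x r / 6), sum_nzT, sum_nzG, sum_nzc,
    d1_apply, cf, gf, gf, tf, tf, tf, af, zero_dotProduct, zero_add, Finset.mul_sum]
  simp only [← Finset.sum_add_distrib]
  congr 1
  · congr 1
    · congr 1
      exact Finset.sum_congr rfl fun e _ => by ring
    · exact Finset.sum_congr rfl fun e _ => by ring
  · exact Finset.sum_congr rfl fun e _ => by ring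

theorem hessVec_val_dot (y h u : Fin d → ℝ) : (q.hessVec y h).val ⬝ᵥ u = q.d2 y h u := by
  simp only [hessVec, Timed.bind_val, Timed.foldlM_op_val, mulA_val]
  rw [List.foldl_dot _ _ u
      (fun e => q.A e.1 e.2 * (u e.2 * (q.emb y e.1 * q.emb y e.1 * q.emb h e.1 / 2)))
      (fun g e => by rw [addAt_dot]; simp only [emb_apply]; ring),
    List.foldl_dot _ _ u (fun e => q.T e.1 e.2.1 e.2.2 *
      ((y e.2.1 * h e.2.2 + h e.2.1 * y e.2.2) * u e.1
      + (y e.1 * h e.2.2 + h e.1 * y e.2.2) * u e.2.1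
      + (y e.1 * h e.2.1 + h e.1 * y e.2.1) * u e.2.2))
      (fun g e => by simp only [addAt_dot]; ring),
    List.foldl_dot _ _ u (fun e => q.G e.1 e.2 * (h e.2 * u e.1 + h e.1 * u e.2))
      (fun g e => by simp only [addAt_dot]; ring),
    sum_nzA, q.sum_A (fun r => q.emb y r * q.emb y r * q.emb h r / 2), sum_nzT, sum_nzG,
    d2_apply, gf, gf, tf, tf, tf, tf, tf, tf, af, zero_dotProduct, zero_add, Finset.mul_sum]
  simp only [← Finset.sum_add_distrib]
  congr 1
  · congr 1
    · exact Finset.sum_congr rfl fun e _ => by ring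
    · exact Finset.sum_congr rfl fun e _ => by ring
  · exact Finset.sum_congr rfl fun e _ => by ring

theorem thirdVec_val_dot (y h u : Fin d → ℝ) :
    (q.thirdVec y h).val ⬝ᵥ u = 1 / 2 * q.d3 y h h u := by
  simp only [thirdVec, Timed.bind_val, Timed.foldlM_op_val, mulA_val]
  rw [List.foldl_dot _ _ u
      (fun e => q.A e.1 e.2 * (u e.2 * (q.emb y e.1 * q.emb h e.1 * q.emb h e.1 / 2)))
      (fun g e => by rw [addAt_dot]; simp only [emb_apply]; ring),
    List.foldl_dot _ _ u (fun e => q.T e.1 e.2.1 e.2.2 *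
      (h e.2.1 * h e.2.2 * u e.1 + h e.1 * h e.2.2 * u e.2.1 + h e.1 * h e.2.1 * u e.2.2))
      (fun g e => by simp only [addAt_dot]; ring),
    sum_nzA, q.sum_A (fun r => q.emb y r * q.emb h r * q.emb h r / 2), sum_nzT,
    d3_apply, tf, tf, tf, af, zero_dotProduct, zero_add, mul_add]
  simp only [← Finset.sum_add_distrib, Finset.mul_sum]
  congr 1
  · exact Finset.sum_congr rfl fun e _ => by ring
  · exact Finset.sum_congr rfl fun e _ => by ring

theorem gradient_val (x : Fin d → ℝ) : (q.gradient x).val = gradVec q.f x :=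
  dotProduct_eq _ _ fun u => by rw [gradient_val_dot, gradVec_dot]

theorem gradient_cost (x : Fin d → ℝ) : (q.gradient x).cost =
    ⟨q.nzc.length + 4 * q.nzG.length + 9 * q.nzT.length + 7 * q.nzA.length, 1, 0⟩ := by
  simp only [gradient, Timed.bind_cost, Timed.foldlM_op_cost, mulA_cost, Timed.oracleCall_cost]
  refine Cost.ext' ?_ rfl rfl
  simp only [Cost.add_ops]; ring

theorem hessVec_cost (y h : Fin d → ℝ) : (q.hessVec y h).cost =
    ⟨4 * q.nzG.length + 15 * q.nzT.length + 9 * q.nzA.length, 1, 0⟩ := by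
  simp only [hessVec, Timed.bind_cost, Timed.foldlM_op_cost, mulA_cost, Timed.oracleCall_cost]
  refine Cost.ext' ?_ rfl rfl
  simp only [Cost.add_ops]; ring

theorem thirdVec_cost (y h : Fin d → ℝ) : (q.thirdVec y h).cost =
    ⟨9 * q.nzT.length + 9 * q.nzA.length, 1, 0⟩ := by
  simp only [thirdVec, Timed.bind_cost, Timed.foldlM_op_cost, mulA_cost, Timed.oracleCall_cost]
  refine Cost.ext' ?_ rfl rfl
  simp only [Cost.add_ops]; ring

theorem evalNormSqB_val (v : Fin d → ℝ) : (q.evalNormSqB v).val = ‖q.emb v‖ ^ 2 := by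
  simp only [evalNormSqB, Timed.bind_val, mulB_val, Timed.dot_val]
  rw [← inner_emb, real_inner_self_eq_norm_sq]

theorem evalNormSqB_cost (v : Fin d → ℝ) :
    (q.evalNormSqB v).cost = ⟨4 * q.nzA.length + 2 * d, 0, 0⟩ := by
  simp only [evalNormSqB, Timed.bind_cost, mulB_cost, Timed.dot_cost]
  exact Cost.ext' (by simp) rfl rfl

end Quartic

namespace Quartic

variable {d n : ℕ} {q : Quartic d n}

/-! ### Bounds on the quadrilinear form -/

theorem sum_mul_sq_le (x y : EuclideanSpace ℝ (Fin n)) :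
    ∑ r, (x r * y r) ^ 2 ≤ (‖x‖ * ‖y‖) ^ 2 := by
  rw [mul_pow, EuclideanSpace.norm_sq_eq y, Finset.mul_sum]
  refine Finset.sum_le_sum fun r _ => ?_
  rw [mul_pow, Real.norm_eq_abs, sq_abs]
  refine mul_le_mul_of_nonneg_right ?_ (sq_nonneg _)
  rw [EuclideanSpace.norm_sq_eq x]
  have := Finset.single_le_sum (f := fun r => ‖x r‖ ^ 2) (fun i _ => sq_nonneg _)
    (Finset.mem_univ r)
  simpa [Real.norm_eq_abs, sq_abs] using this

/-- Cauchy–Schwarz on the pointwise products (Aa)(Ab) and (Ac)(Ae), whose Euclidean norms are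
submultiplicative. This is why the Lipschitz constant of the third derivative is 1. -/
theorem abs_af_le (a b c e : Fin d → ℝ) :
    |q.af a b c e| ≤ ‖q.emb a‖ * ‖q.emb b‖ * ‖q.emb c‖ * ‖q.emb e‖ := by
  refine abs_le_of_sq_le_sq ?_ (by positivity)
  have h1 : q.af a b c e = ∑ r, (q.emb a r * q.emb b r) * (q.emb c r * q.emb e r) :=
    Finset.sum_congr rfl fun r _ => by ring
  rw [h1]
  refine (Finset.sum_mul_sq_le_sq_mul_sq _ _ _).trans ?_
  refine (mul_le_mul (sum_mul_sq_le (q.emb a) (q.emb b)) (sum_mul_sq_le (q.emb c) (q.emb e))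
    (by positivity) (by positivity)).trans (le_of_eq (by ring))

theorem af_self_nonneg (a b : Fin d → ℝ) : 0 ≤ q.af a a b b :=
  Finset.sum_nonneg fun r _ => by
    have : q.emb a r * q.emb a r * q.emb b r * q.emb b r = (q.emb a r * q.emb b r) ^ 2 := by ring
    rw [this]; positivity

theorem af_self_le (a b : Fin d → ℝ) : q.af a a b b ≤ ‖q.emb a‖ ^ 2 * ‖q.emb b‖ ^ 2 :=
  (le_abs_self _).trans ((abs_af_le a a b b).trans (le_of_eq (by ring)))

/-- Comparison of the 2-norm and the 4-norm on ℝⁿ; the factor n ends up as n^(1/5) in the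
complexity. -/
theorem norm_pow_four_le (h : Fin d → ℝ) : ‖q.emb h‖ ^ 4 ≤ n * q.af h h h h := by
  have h1 : q.af h h h h = ∑ r, ((q.emb h r) ^ 2) ^ 2 :=
    Finset.sum_congr rfl fun r _ => by ring
  have h2 : ‖q.emb h‖ ^ 4 = (∑ r, (q.emb h r) ^ 2) ^ 2 := by
    rw [show ‖q.emb h‖ ^ 4 = (‖q.emb h‖ ^ 2) ^ 2 by ring, EuclideanSpace.norm_sq_eq]
    simp only [Real.norm_eq_abs, sq_abs]
  rw [h1, h2]
  simpa using sq_sum_le_card_mul_sum_sq (s := Finset.univ) (f := fun r => (q.emb h r) ^ 2)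

theorem emb_injective (hB : (q.Aᵀ * q.A).PosDef) : Function.Injective q.emb := by
  rw [injective_iff_map_eq_zero]
  intro x hx
  by_contra h
  have h1 := hB.dotProduct_mulVec_pos h
  have h2 := q.inner_emb x x
  rw [hx, inner_zero_left] at h2
  simp only [star_trivial] at h1
  exact absurd h2 (ne_of_lt h1)

theorem norm_emb_eq_zero (hB : (q.Aᵀ * q.A).PosDef) {x : Fin d → ℝ} (h : ‖q.emb x‖ = 0) :
    x = 0 :=
  emb_injective hB (by rw [map_zero]; exact norm_eq_zero.1 h)

theorem exists_norm_le (hB : (q.Aᵀ * q.A).PosDef) :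
    ∃ k : ℝ, 0 < k ∧ ∀ x : Fin d → ℝ, ‖x‖ ≤ k * ‖q.emb x‖ := by
  obtain ⟨K, K0, hK⟩ := q.emb.exists_antilipschitzWith (LinearMap.ker_eq_bot.2 (emb_injective hB))
  exact ⟨K, K0, fun x => ZeroHomClass.bound_of_antilipschitz q.emb hK x⟩

/-- A continuous function bounded below by an affine function plus a quartic has a minimizer. -/
theorem exists_min_of_growth (hB : (q.Aᵀ * q.A).PosDef) {F : (Fin d → ℝ) → ℝ}
    (hF : Continuous F) (l : (Fin d → ℝ) →ₗ[ℝ] ℝ) {a c : ℝ} (hc : 0 < c)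
    (h : ∀ x, a + l x + c * ‖q.emb x‖ ^ 4 ≤ F x) : ∃ x, ∀ z, F x ≤ F z := by
  obtain ⟨k, hk, hk'⟩ := exists_norm_le hB
  set b := ‖LinearMap.toContinuousLinearMap l‖ * k
  have hb : 0 ≤ b := by positivity
  have hl : ∀ x, -(b * ‖q.emb x‖) ≤ l x := fun x => by
    have h1 := (LinearMap.toContinuousLinearMap l).le_opNorm x
    have h2 : |l x| ≤ b * ‖q.emb x‖ := by
      calc |l x| = ‖LinearMap.toContinuousLinearMap l x‖ := by simp
        _ ≤ ‖LinearMap.toContinuousLinearMap l‖ * ‖x‖ := h1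
        _ ≤ ‖LinearMap.toContinuousLinearMap l‖ * (k * ‖q.emb x‖) := by gcongr; exact hk' x
        _ = b * ‖q.emb x‖ := by ring
    exact (abs_le.1 h2).1
  refine hF.exists_forall_le' 0 ?_
  -- For r = ‖x‖_B ≥ R, the quartic term c r⁴ is at least (b + |F 0 − a|) r, which outweighs the
  -- linear term and the offset; hence F x ≥ F 0 outside a compact set.
  set R := max 1 ((b + |F 0 - a|) / c)
  have hev := (tendsto_norm_cocompact_atTop (E := Fin d → ℝ)).eventually
    (Filter.eventually_ge_atTop (k * R))
  filter_upwards [hev] with x hx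
  have h1 : R ≤ ‖q.emb x‖ := by
    have := hx.trans (hk' x)
    exact le_of_mul_le_mul_left this hk
  have h2 : 1 ≤ ‖q.emb x‖ := (le_max_left _ _).trans h1
  have h3 : b + |F 0 - a| ≤ ‖q.emb x‖ * c := (div_le_iff₀ hc).1 ((le_max_right _ _).trans h1)
  have h4 := h x
  have h5 := hl x
  have h6 : (b + |F 0 - a|) * ‖q.emb x‖ ≤ c * ‖q.emb x‖ ^ 4 := by
    calc (b + |F 0 - a|) * ‖q.emb x‖ ≤ (‖q.emb x‖ * c) * ‖q.emb x‖ := by gcongr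
      _ = c * ‖q.emb x‖ ^ 2 := by ring
      _ ≤ c * ‖q.emb x‖ ^ 4 := by
          refine mul_le_mul_of_nonneg_left ?_ hc.le
          exact pow_le_pow_right₀ h2 (by norm_num)
  have h7 : |F 0 - a| ≤ |F 0 - a| * ‖q.emb x‖ := le_mul_of_one_le_right (abs_nonneg _) h2
  have h8 := le_abs_self (F 0 - a)
  nlinarith

/-! ### Consequences of convexity -/

/-- Midpoint convexity at y ± t w cancels the odd Taylor terms; dividing by t² and letting t tend to
0 leaves the Hessian. -/
theorem d2_nonneg (hc : ConvexOn ℝ Set.univ q.f) (y w : Fin d → ℝ) : 0 ≤ q.d2 y w w := by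
  have key : ∀ t : ℝ, 0 ≤ t ^ 2 * q.d2 y w w + t ^ 4 / 12 * q.af w w w w := by
    intro t
    have h1 := hc.2 (Set.mem_univ (y + t • w)) (Set.mem_univ (y + (-t) • w))
      (by norm_num : (0 : ℝ) ≤ 1 / 2) (by norm_num : (0 : ℝ) ≤ 1 / 2) (by norm_num)
    have h2 : (1 / 2 : ℝ) • (y + t • w) + (1 / 2 : ℝ) • (y + (-t) • w) = y := by
      module
    rw [h2, f_add, f_add] at h1
    simp only [map_smul, LinearMap.smul_apply, smul_eq_mul, d3_smul_left, af_smul₁, af_smul₂,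
      af_smul₃, af_smul₄] at h1
    nlinarith
  have hS := af_self_nonneg (q := q) w w
  refine le_of_forall_pos_le_add fun ε hε => ?_
  have h1 := key (√(ε / (q.af w w w w + 1)))
  have h2 : √(ε / (q.af w w w w + 1)) ^ 2 = ε / (q.af w w w w + 1) :=
    Real.sq_sqrt (by positivity)
  set s := ε / (q.af w w w w + 1) with hs
  have hs0 : 0 < s := by positivity
  have hsm : s * (q.af w w w w + 1) = ε := by rw [hs]; field_simp
  have h3 : √s ^ 4 = s ^ 2 := by rw [show √s ^ 4 = (√s ^ 2) ^ 2 by ring, h2]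
  rw [h2, h3] at h1
  have h4 : 0 ≤ s * (q.d2 y w w + s / 12 * q.af w w w w) := by nlinarith
  have h5 := nonneg_of_mul_nonneg_right h4 hs0
  nlinarith

theorem d2_shift_nonneg (hc : ConvexOn ℝ Set.univ q.f) (y z w : Fin d → ℝ) (s : ℝ) :
    0 ≤ q.d2 y w w + s * q.d3 y z w w + s ^ 2 / 2 * q.af z z w w := by
  have h := d2_nonneg hc (y + s • z) w
  rw [d2_add, d3_smul_left, af_smul₁, af_smul₂] at h
  linarith

/-- The shifts s = ±√2 make the coefficient s²/2 of the quartic form equal to 1. The method's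
constant 1/√2 comes from here. -/
theorem abs_d3_le (hc : ConvexOn ℝ Set.univ q.f) (y z w : Fin d → ℝ) :
    √2 * |q.d3 y z w w| ≤ q.d2 y w w + ‖q.emb z‖ ^ 2 * ‖q.emb w‖ ^ 2 := by
  have h1 := d2_shift_nonneg hc y z w (√2)
  have h2 := d2_shift_nonneg hc y z w (-√2)
  have h3 := af_self_le (q := q) z w
  have h4 : √2 ^ 2 = 2 := Real.sq_sqrt (by norm_num)
  rw [neg_sq] at h2
  rw [h4] at h1 h2
  have h5 : √2 * |q.d3 y z w w| = |√2 * q.d3 y z w w| := by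
    rw [abs_mul, abs_of_nonneg (Real.sqrt_nonneg 2)]
  rw [h5, abs_le]
  constructor <;> linarith

/-- The shift s = 1/3 matches the ratio of the Taylor coefficients 1/2 and 1/6. It uses up 1/36 of
the quartic term, and 1/24 − 1/36 = 1/72 remains. -/
theorem f_add_ge (hc : ConvexOn ℝ Set.univ q.f) (y h : Fin d → ℝ) :
    q.f y + q.d1 y h + 1 / 72 * q.af h h h h ≤ q.f (y + h) := by
  have h1 := d2_shift_nonneg hc y h h (1 / 3)
  rw [f_add]
  linarith

theorem f_add_ge_d1 (hc : ConvexOn ℝ Set.univ q.f) (y h : Fin d → ℝ) :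
    q.f y + q.d1 y h ≤ q.f (y + h) := by
  have h1 := f_add_ge hc y h
  have h2 := af_self_nonneg (q := q) h h
  linarith

/-- With s = 1/2, six times the Taylor remainder is the Hessian term plus twice the nonnegative
shifted Hessian. -/
theorem d2_le_growth (hc : ConvexOn ℝ Set.univ q.f) (y h : Fin d → ℝ) :
    q.d2 y h h ≤ 6 * (q.f (y + h) - q.f y - q.d1 y h) := by
  have h1 := d2_shift_nonneg hc y h h (1 / 2)
  rw [f_add]
  linarith

theorem continuous_f (q : Quartic d n) : Continuous q.f := q.differentiable_f.continuous

theorem d1_eq_zero_of_min {xs : Fin d → ℝ} (h : ∀ z, q.f xs ≤ q.f z) (u) : q.d1 xs u = 0 := by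
  have h1 : IsLocalMin q.f xs := Filter.Eventually.of_forall h
  rw [← fderiv_f, h1.fderiv_eq_zero]; rfl

theorem norm_pow_four_le_of_min (hc : ConvexOn ℝ Set.univ q.f) {xs : Fin d → ℝ}
    (h : ∀ z, q.f xs ≤ q.f z) (x : Fin d → ℝ) :
    ‖q.emb (x - xs)‖ ^ 4 ≤ 72 * n * (q.f x - q.f xs) := by
  have h1 := f_add_ge hc xs (x - xs)
  rw [d1_eq_zero_of_min h, add_sub_cancel] at h1
  have h2 := norm_pow_four_le (q := q) (x - xs)
  have hn : (0 : ℝ) ≤ n := Nat.cast_nonneg n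
  nlinarith

theorem n_pos_of_ne (hB : (q.Aᵀ * q.A).PosDef) {x y : Fin d → ℝ} (h : x ≠ y) : 0 < n := by
  rcases Nat.eq_zero_or_pos n with rfl | h1
  · exact absurd (emb_injective hB (Subsingleton.elim _ _)) h
  · exact h1

theorem exists_minimizer (hB : (q.Aᵀ * q.A).PosDef) (hc : ConvexOn ℝ Set.univ q.f) :
    ∃ xs, ∀ z, q.f xs ≤ q.f z := by
  refine exists_min_of_growth hB (continuous_f q) (q.d1 0) (a := q.f 0)
    -- The denominator uses n + 1 so that n = 0 needs no separate treatment.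
    (c := 1 / (72 * (n + 1))) (by positivity) fun x => ?_
  have h1 := f_add_ge hc 0 x
  rw [zero_add] at h1
  have h2 := norm_pow_four_le (q := q) x
  have h3 := af_self_nonneg (q := q) x x
  have h4 : 1 / (72 * ((n : ℝ) + 1)) * ‖q.emb x‖ ^ 4 ≤ 1 / 72 * q.af x x x x := by
    rw [div_mul_eq_mul_div, one_mul, div_le_iff₀ (by positivity)]
    nlinarith
  linarith

/-! ### Bounds on the derivatives -/

/-- The Hessian of `f` at `y` is at most `L B`. -/
def HessLe (q : Quartic d n) (y : Fin d → ℝ) (L : ℝ) : Prop :=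
  ∀ w, q.d2 y w w ≤ L * ‖q.emb w‖ ^ 2

/-- Since `abs_d3_le` bounds the third derivative by the Hessian itself, a curvature bound at one
point propagates to all others. It will be started at the minimizer. -/
theorem HessLe.shift (hc : ConvexOn ℝ Set.univ q.f) {y : Fin d → ℝ} {L : ℝ}
    (h : q.HessLe y L) (z : Fin d → ℝ) : q.HessLe (y + z) (2 * L + 2 * ‖q.emb z‖ ^ 2) := by
  intro w
  have h1 := abs_d3_le hc y z w
  have h2 := h w
  have h3 := af_self_le (q := q) z w
  have h4 : |q.d3 y z w w| ≤ √2 * |q.d3 y z w w| :=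
    le_mul_of_one_le_left (abs_nonneg _) (Real.one_le_sqrt.2 (by norm_num))
  have h5 := le_abs_self (q.d3 y z w w)
  have h6 : 0 ≤ ‖q.emb z‖ ^ 2 * ‖q.emb w‖ ^ 2 := by positivity
  rw [d2_add]
  nlinarith

/-- Polarization: the Hessian is nonnegative on b u ± a v, where a and b are the B-norms of u and v.
-/
theorem HessLe.abs_d2_le (hB : (q.Aᵀ * q.A).PosDef) (hc : ConvexOn ℝ Set.univ q.f)
    {y : Fin d → ℝ} {L : ℝ} (h : q.HessLe y L) (u v : Fin d → ℝ) :
    |q.d2 y u v| ≤ L * ‖q.emb u‖ * ‖q.emb v‖ := by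
  rcases (norm_nonneg (q.emb u)).eq_or_lt with hu | hu
  · rw [norm_emb_eq_zero hB hu.symm]; simp
  rcases (norm_nonneg (q.emb v)).eq_or_lt with hv | hv
  · rw [norm_emb_eq_zero hB hv.symm]; simp
  set a := ‖q.emb u‖
  set b := ‖q.emb v‖
  have h1 : ∀ s : ℝ, 0 ≤ b ^ 2 * q.d2 y u u + 2 * s * a * b * q.d2 y u v
      + s ^ 2 * a ^ 2 * q.d2 y v v := by
    intro s
    have := d2_nonneg hc y (b • u + (s * a) • v)
    simp only [map_add, map_smul, LinearMap.add_apply, LinearMap.smul_apply, smul_eq_mul] at this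
    rw [q.d2_symm y v u] at this
    linarith
  have h2 := h1 1
  have h3 := h1 (-1)
  have h4 := mul_le_mul_of_nonneg_left (h u) (sq_nonneg b)
  have h5 := mul_le_mul_of_nonneg_left (h v) (sq_nonneg a)
  have hab : 0 < a * b := by positivity
  have h6 : (a * b) * |q.d2 y u v| ≤ (a * b) * (L * a * b) := by
    rw [show (a * b) * |q.d2 y u v| = |(a * b) * q.d2 y u v| by rw [abs_mul, abs_of_pos hab],
      abs_le]
    constructor <;> nlinarith
  exact le_of_mul_le_mul_left h6 hab

theorem HessLe.abs_d3_le (hB : (q.Aᵀ * q.A).PosDef) (hc : ConvexOn ℝ Set.univ q.f)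
    {y : Fin d → ℝ} {L : ℝ} (h : q.HessLe y L) (u v : Fin d → ℝ) :
    |q.d3 y u v v| ≤ (L + 1) * ‖q.emb v‖ ^ 2 * ‖q.emb u‖ := by
  rcases (norm_nonneg (q.emb u)).eq_or_lt with hu | hu
  · rw [norm_emb_eq_zero hB hu.symm, d3_swap₁₂]; simp
  set a := ‖q.emb u‖
  have h1 := Quartic.abs_d3_le hc y (a⁻¹ • u) v
  rw [d3_smul_left, map_smul, norm_smul, norm_inv, norm_norm, inv_mul_cancel₀ hu.ne', abs_mul,
    abs_of_pos (inv_pos.2 hu)] at h1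
  have h2 := h v
  have h4 : a⁻¹ * |q.d3 y u v v| ≤ √2 * (a⁻¹ * |q.d3 y u v v|) :=
    le_mul_of_one_le_left (by positivity) (Real.one_le_sqrt.2 (by norm_num))
  have h5 : a⁻¹ * |q.d3 y u v v| ≤ (L + 1) * ‖q.emb v‖ ^ 2 := by linarith
  rw [inv_mul_le_iff₀ hu] at h5
  linarith

theorem HessLe.abs_d1_sub_le (hB : (q.Aᵀ * q.A).PosDef) (hc : ConvexOn ℝ Set.univ q.f)
    {y : Fin d → ℝ} {L : ℝ} (hL : q.HessLe y L) (h u : Fin d → ℝ) :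
    |q.d1 (y + h) u - q.d1 y u| ≤
      (L * ‖q.emb h‖ + (L + 1) * ‖q.emb h‖ ^ 2 + ‖q.emb h‖ ^ 3) * ‖q.emb u‖ := by
  have h1 := hL.abs_d2_le hB hc h u
  have h2 := hL.abs_d3_le hB hc u h
  have h3 := abs_af_le (q := q) h h h u
  rw [d3_swap₁₂, d3_swap₂₃] at h2
  have h4 : 0 ≤ ‖q.emb h‖ ^ 3 * ‖q.emb u‖ := by positivity
  rw [d1_add]
  rw [abs_le] at *
  constructor <;> nlinarith

/-! ### The model and its Bregman kernel -/

/-- The bilinear form of `B`, as a functional. -/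
noncomputable def ipB (q : Quartic d n) (x : Fin d → ℝ) : (Fin d → ℝ) →ₗ[ℝ] ℝ :=
  (innerₗ (EuclideanSpace ℝ (Fin n)) (q.emb x)).comp q.emb

theorem ipB_apply (x y : Fin d → ℝ) : q.ipB x y = inner ℝ (q.emb x) (q.emb y) := rfl

theorem abs_ipB_le (x y : Fin d → ℝ) : |q.ipB x y| ≤ ‖q.emb x‖ * ‖q.emb y‖ := by
  rw [ipB_apply]; exact abs_real_inner_le_norm _ _

theorem ipB_self (x : Fin d → ℝ) : q.ipB x x = ‖q.emb x‖ ^ 2 := by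
  rw [ipB_apply, real_inner_self_eq_norm_sq]

theorem ipB_symm (x y : Fin d → ℝ) : q.ipB x y = q.ipB y x := by
  rw [ipB_apply, ipB_apply, real_inner_comm]

theorem ipB_add_left (x y z : Fin d → ℝ) : q.ipB (x + y) z = q.ipB x z + q.ipB y z := by
  simp only [ipB_apply, map_add, inner_add_left]

theorem ipB_smul_left (t : ℝ) (x z : Fin d → ℝ) : q.ipB (t • x) z = t * q.ipB x z := by
  simp only [ipB_apply, map_smul, real_inner_smul_left]

theorem norm_emb_add_sq (x y : Fin d → ℝ) :
    ‖q.emb (x + y)‖ ^ 2 = ‖q.emb x‖ ^ 2 + 2 * q.ipB x y + ‖q.emb y‖ ^ 2 := by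
  rw [map_add, norm_add_sq_real]; rfl

/-- The Bregman kernel `φ` at `y`. -/
noncomputable def phi (q : Quartic d n) (y h : Fin d → ℝ) : ℝ :=
  1 / 2 * q.d2 y h h + 1 / 4 * ‖q.emb h‖ ^ 4

/-- The derivative of `φ`. -/
noncomputable def dphi (q : Quartic d n) (y h : Fin d → ℝ) : (Fin d → ℝ) →ₗ[ℝ] ℝ :=
  q.d2 y h + ‖q.emb h‖ ^ 2 • q.ipB h

/-- The fourth-order model `Γ` at `y`. -/
noncomputable def model (q : Quartic d n) (y h : Fin d → ℝ) : ℝ :=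
  q.d1 y h + 1 / 6 * q.d3 y h h h + q.phi y h

/-- The derivative of `Γ`. -/
noncomputable def dmodel (q : Quartic d n) (y h : Fin d → ℝ) : (Fin d → ℝ) →ₗ[ℝ] ℝ :=
  q.d1 y + (1 / 2 : ℝ) • q.d3 y h h + q.dphi y h

/-- The Bregman distance of `φ`. -/
noncomputable def breg (q : Quartic d n) (y u v : Fin d → ℝ) : ℝ :=
  q.phi y u - q.phi y v - q.dphi y v (u - v)

theorem dphi_apply (y h u : Fin d → ℝ) :
    q.dphi y h u = q.d2 y h u + ‖q.emb h‖ ^ 2 * q.ipB h u := rfl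

theorem dmodel_apply (y h u : Fin d → ℝ) :
    q.dmodel y h u = q.d1 y u + 1 / 2 * q.d3 y h h u + q.dphi y h u := rfl

/-- The link between the model and f: a stationary point of Γ makes ∇f(y+h) + ‖h‖²Bh as small as the
quartic Taylor term. -/
theorem dmodel_eq (y h u : Fin d → ℝ) : q.dmodel y h u =
    q.d1 (y + h) u + ‖q.emb h‖ ^ 2 * q.ipB h u - 1 / 6 * q.af h h h u := by
  rw [dmodel_apply, dphi_apply, d1_add]; ring

theorem breg_add (y v w : Fin d → ℝ) : q.breg y (v + w) v = 1 / 2 * q.d2 y w w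
    + 1 / 2 * ‖q.emb v‖ ^ 2 * ‖q.emb w‖ ^ 2 + q.ipB v w ^ 2 + q.ipB v w * ‖q.emb w‖ ^ 2
    + 1 / 4 * ‖q.emb w‖ ^ 4 := by
  have h4 : ‖q.emb (v + w)‖ ^ 4 = (‖q.emb v‖ ^ 2 + 2 * q.ipB v w + ‖q.emb w‖ ^ 2) ^ 2 := by
    rw [← norm_emb_add_sq]; ring
  rw [breg, phi, phi, h4, add_sub_cancel_left, dphi_apply]
  simp only [map_add, LinearMap.add_apply]
  rw [q.d2_symm y w v]
  ring

theorem breg_add_ge (y v w : Fin d → ℝ) :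
    1 / 2 * q.d2 y w w + 1 / 12 * ‖q.emb w‖ ^ 4 ≤ q.breg y (v + w) v := by
  rw [breg_add]
  have h1 : q.ipB v w ^ 2 ≤ ‖q.emb v‖ ^ 2 * ‖q.emb w‖ ^ 2 := by
    rw [← mul_pow, ← sq_abs (q.ipB v w)]
    exact pow_le_pow_left₀ (abs_nonneg _) (abs_ipB_le v w) 2
  -- After Cauchy–Schwarz the quartic part is at least 3/2 times this square plus (1/4 − 1/6)‖w‖⁴,
  -- whence 1/12.
  nlinarith [sq_nonneg (q.ipB v w + ‖q.emb w‖ ^ 2 / 3)]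

theorem breg_ge (hc : ConvexOn ℝ Set.univ q.f) (y u v : Fin d → ℝ) :
    1 / 12 * ‖q.emb (u - v)‖ ^ 4 ≤ q.breg y u v := by
  have h1 := breg_add_ge (q := q) y v (u - v)
  rw [add_sub_cancel] at h1
  have h2 := d2_nonneg hc y (u - v)
  linarith

theorem breg_nonneg (hc : ConvexOn ℝ Set.univ q.f) (y u v : Fin d → ℝ) : 0 ≤ q.breg y u v :=
  le_trans (by positivity) (breg_ge hc y u v)

/-- `Γ` is smooth and strongly convex relative to `φ`. -/
theorem abs_model_sub_le (hc : ConvexOn ℝ Set.univ q.f) (y u v : Fin d → ℝ) :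
    √2 * |q.model y u - q.model y v - q.dmodel y v (u - v) - q.breg y u v| ≤ q.breg y u v := by
  obtain ⟨w, rfl⟩ : ∃ w, u = v + w := ⟨u - v, by simp⟩
  -- The kernel cancels, so only the second-order remainder of the cubic form is left; it is a
  -- single third derivative in direction v + w/3.
  have h1 : q.model y (v + w) - q.model y v - q.dmodel y v (v + w - v) - q.breg y (v + w) v
      = 1 / 2 * q.d3 y (v + (1 / 3 : ℝ) • w) w w := by
    rw [model, model, dmodel_apply, breg, add_sub_cancel_left, q.d3_add_left y v _ w w, d3_smul_left]
    simp only [map_add, LinearMap.add_apply, d3_add_left]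
    rw [q.d3_swap₂₃ y v w v, q.d3_swap₁₂ y w v v, q.d3_swap₂₃ y v w v, q.d3_swap₁₂ y w v w,
      q.d3_swap₂₃ y w w v, q.d3_swap₁₂ y w v w]
    ring
  have h2 := abs_d3_le hc y (v + (1 / 3 : ℝ) • w) w
  rw [norm_emb_add_sq, map_smul, map_smul, norm_smul, smul_eq_mul, Real.norm_eq_abs,
    abs_of_nonneg (by norm_num : (0 : ℝ) ≤ 1 / 3)] at h2
  rw [h1, abs_mul, abs_of_nonneg (by norm_num : (0 : ℝ) ≤ 1 / 2), breg_add]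
  nlinarith [sq_nonneg (q.ipB v w + ‖q.emb w‖ ^ 2 / 3), sq_nonneg (‖q.emb w‖ ^ 2)]

theorem sqrt_two_inv_bounds : 7 / 10 < 1 / √2 ∧ 1 / √2 < 5 / 7 ∧ √2 * (1 / √2) = 1 := by
  have h0 : 0 < √2 := by positivity
  have h4 : √2 ^ 2 = 2 := Real.sq_sqrt (by norm_num)
  refine ⟨?_, ?_, by field_simp⟩
  · rw [lt_div_iff₀ h0]; nlinarith
  · rw [div_lt_iff₀ h0]; nlinarith

theorem model_le (hc : ConvexOn ℝ Set.univ q.f) (y u v : Fin d → ℝ) :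
    q.model y u ≤ q.model y v + q.dmodel y v (u - v) + (1 + 1 / √2) * q.breg y u v := by
  have h1 := abs_model_sub_le hc y u v
  have h0 : 0 < √2 := by positivity
  have h2 : |q.model y u - q.model y v - q.dmodel y v (u - v) - q.breg y u v|
      ≤ 1 / √2 * q.breg y u v := by
    rw [div_mul_eq_mul_div, one_mul, le_div_iff₀ h0]; linarith
  have := (abs_le.1 h2).2
  linarith

theorem model_ge (hc : ConvexOn ℝ Set.univ q.f) (y u v : Fin d → ℝ) :
    q.model y v + q.dmodel y v (u - v) + (1 - 1 / √2) * q.breg y u v ≤ q.model y u := by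
  have h1 := abs_model_sub_le hc y u v
  have h0 : 0 < √2 := by positivity
  have h2 : |q.model y u - q.model y v - q.dmodel y v (u - v) - q.breg y u v|
      ≤ 1 / √2 * q.breg y u v := by
    rw [div_mul_eq_mul_div, one_mul, le_div_iff₀ h0]; linarith
  have := (abs_le.1 h2).1
  linarith

/-- Relative strong convexity in both directions, added up. Since 1 − 1/√2 > 2/7, the constant is 2
· (2/7) · (1/12) = 1/21. -/
theorem dmodel_monotone (hc : ConvexOn ℝ Set.univ q.f) (y u v : Fin d → ℝ) :
    ‖q.emb (u - v)‖ ^ 4 ≤ 21 * (q.dmodel y u (u - v) - q.dmodel y v (u - v)) := by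
  have h1 := model_ge hc y u v
  have h2 := model_ge hc y v u
  have h3 := breg_ge hc y u v
  have h4 := breg_ge hc y v u
  obtain ⟨-, h5, -⟩ := sqrt_two_inv_bounds
  rw [← neg_sub u v, map_neg] at h2
  rw [← neg_sub u v, map_neg, norm_neg] at h4
  set c := 1 / √2
  have h6 : 2 / 7 * (1 / 12 * ‖q.emb (u - v)‖ ^ 4) ≤ (1 - c) * q.breg y u v :=
    mul_le_mul (by linarith) h3 (by positivity) (by linarith)
  have h7 : 2 / 7 * (1 / 12 * ‖q.emb (u - v)‖ ^ 4) ≤ (1 - c) * q.breg y v u :=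
    mul_le_mul (by linarith) h4 (by positivity) (by linarith)
  linarith

theorem continuous_model (q : Quartic d n) (y : Fin d → ℝ) : Continuous (q.model y) := by
  have h : q.model y = fun h => q.f (y + h) - q.f y - 1 / 24 * q.af h h h h
      + 1 / 4 * ‖q.emb h‖ ^ 4 := by
    funext h
    rw [f_add, model, phi]; ring
  rw [h]
  have h1 := continuous_f q
  have h2 := q.continuous_emb
  have h3 : Continuous fun h => q.af h h h h := by
    simp only [af]
    refine continuous_finsetSum _ fun r _ => ?_
    have : Continuous fun x => q.emb x r := (PiLp.continuous_apply 2 _ r).comp h2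
    fun_prop
  fun_prop

/-- Relative strong convexity at 0 gives quartic growth with constant (2/7)(1/12) = 1/42, hence a
minimizer. Stationarity follows without differentiating Γ, from `model_le` and a Bregman distance of
order t². -/
theorem exists_model_min (hB : (q.Aᵀ * q.A).PosDef) (hc : ConvexOn ℝ Set.univ q.f)
    (y : Fin d → ℝ) : ∃ hs, ∀ u, q.dmodel y hs u = 0 := by
  obtain ⟨hs, hmin⟩ : ∃ h, ∀ z, q.model y h ≤ q.model y z := by
    refine exists_min_of_growth hB (continuous_model q y) (q.d1 y) (a := 0) (c := 1 / 42)
      (by norm_num) fun x => ?_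
    have h1 := model_ge hc y x 0
    have h2 := breg_ge hc y x 0
    obtain ⟨-, h5, -⟩ := sqrt_two_inv_bounds
    have h3 : q.model y 0 = 0 := by simp [model, phi]
    have h4 : q.dmodel y 0 x = q.d1 y x := by simp [dmodel_apply, dphi_apply]
    rw [sub_zero, h3, h4] at h1
    rw [sub_zero] at h2
    have h6 : 2 / 7 * (1 / 12 * ‖q.emb x‖ ^ 4) ≤ (1 - 1 / √2) * q.breg y x 0 :=
      mul_le_mul (by linarith) h2 (by positivity) (by linarith)
    linarith
  refine ⟨hs, ?_⟩
  have key : ∀ u, 0 ≤ q.dmodel y hs u := by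
    intro u
    -- For 0 < t ≤ 1 the Bregman distance from hs to hs + t u is at most t² C.
    set C := 1 / 2 * q.d2 y u u + 1 / 2 * ‖q.emb hs‖ ^ 2 * ‖q.emb u‖ ^ 2 + q.ipB hs u ^ 2
      + |q.ipB hs u| * ‖q.emb u‖ ^ 2 + 1 / 4 * ‖q.emb u‖ ^ 4
    have hC : 0 ≤ C := by
      have := d2_nonneg hc y u
      positivity
    have h1 : ∀ t : ℝ, 0 < t → t ≤ 1 → 0 ≤ q.dmodel y hs u + 2 * t * C := by
      intro t ht ht1
      have h2 := (hmin (hs + t • u)).trans (model_le hc y (hs + t • u) hs)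
      have h3 : q.breg y (hs + t • u) hs ≤ t ^ 2 * C := by
        rw [breg_add]
        simp only [map_smul, LinearMap.smul_apply, norm_smul, smul_eq_mul, Real.norm_eq_abs,
          abs_of_pos ht]
        have h5 : t ^ 3 * (q.ipB hs u * ‖q.emb u‖ ^ 2)
            ≤ t ^ 2 * (|q.ipB hs u| * ‖q.emb u‖ ^ 2) := by
          have h6 : q.ipB hs u ≤ |q.ipB hs u| := le_abs_self _
          calc t ^ 3 * (q.ipB hs u * ‖q.emb u‖ ^ 2)
              ≤ t ^ 3 * (|q.ipB hs u| * ‖q.emb u‖ ^ 2) := by gcongr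
            _ ≤ t ^ 2 * (|q.ipB hs u| * ‖q.emb u‖ ^ 2) :=
              mul_le_mul_of_nonneg_right (pow_le_pow_of_le_one ht.le ht1 (by norm_num))
                (by positivity)
        have h7 : t ^ 4 * (1 / 4 * ‖q.emb u‖ ^ 4) ≤ t ^ 2 * (1 / 4 * ‖q.emb u‖ ^ 4) :=
          mul_le_mul_of_nonneg_right (pow_le_pow_of_le_one ht.le ht1 (by norm_num))
            (by positivity)
        calc _ = t ^ 2 * (1 / 2 * q.d2 y u u + 1 / 2 * ‖q.emb hs‖ ^ 2 * ‖q.emb u‖ ^ 2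
              + q.ipB hs u ^ 2) + t ^ 3 * (q.ipB hs u * ‖q.emb u‖ ^ 2)
              + t ^ 4 * (1 / 4 * ‖q.emb u‖ ^ 4) := by ring
          _ ≤ t ^ 2 * (1 / 2 * q.d2 y u u + 1 / 2 * ‖q.emb hs‖ ^ 2 * ‖q.emb u‖ ^ 2
              + q.ipB hs u ^ 2) + t ^ 2 * (|q.ipB hs u| * ‖q.emb u‖ ^ 2)
              + t ^ 2 * (1 / 4 * ‖q.emb u‖ ^ 4) := by linarith
          _ = t ^ 2 * C := by ring
      obtain ⟨h8, h9, -⟩ := sqrt_two_inv_bounds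
      rw [add_sub_cancel_left, map_smul, smul_eq_mul] at h2
      have h10 : (1 + 1 / √2) * q.breg y (hs + t • u) hs ≤ 2 * (t ^ 2 * C) := by
        refine mul_le_mul (by linarith) h3 (breg_nonneg hc _ _ _) (by norm_num)
      have h11 : 0 ≤ t * (q.dmodel y hs u + 2 * t * C) := by nlinarith
      exact nonneg_of_mul_nonneg_right h11 ht
    refine le_of_forall_pos_le_add fun ε hε => ?_
    have h2 := h1 (min 1 (ε / (2 * C + 1))) (by positivity) (min_le_left _ _)
    have h3 : 2 * min 1 (ε / (2 * C + 1)) * C ≤ ε := by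
      have h4 : min 1 (ε / (2 * C + 1)) ≤ ε / (2 * C + 1) := min_le_right _ _
      calc 2 * min 1 (ε / (2 * C + 1)) * C ≤ 2 * (ε / (2 * C + 1)) * C := by gcongr
        _ = ε * (2 * C / (2 * C + 1)) := by ring
        _ ≤ ε * 1 := by
          gcongr
          rw [div_le_one (by positivity)]; linarith
        _ = ε := mul_one _
    linarith
  intro u
  have h1 := key u
  have h2 := key (-u)
  rw [map_neg] at h2
  linarith

/-- One inexact Bregman gradient step contracts the Bregman distance to the minimizer. -/
theorem breg_step (hc : ConvexOn ℝ Set.univ q.f) {y hs h h' : Fin d → ℝ} {κ : ℝ} (hκ : 0 ≤ κ)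
    (hmin : ∀ u, q.dmodel y hs u = 0)
    (hstep : ∀ u, q.dphi y h' u
      = q.dphi y h u - (1 + 1 / √2)⁻¹ * q.dmodel y h u - κ * q.ipB h' u) :
    q.breg y hs h' ≤ 5 / 6 * q.breg y hs h + κ * (‖q.emb h'‖ * ‖q.emb hs‖) := by
  obtain ⟨h8, h9, -⟩ := sqrt_two_inv_bounds
  have h1 := model_le hc y h' h
  have h2 := model_ge hc y hs h
  have h3 := model_ge hc y h' hs
  rw [hmin] at h3
  have h4 := breg_nonneg hc y h' hs
  have h5 := breg_nonneg hc y hs h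
  set c := 1 / √2
  have h6 : q.dmodel y h (h' - hs)
      = (1 + c) * (q.dphi y h (h' - hs) - q.dphi y h' (h' - hs) - κ * q.ipB h' (h' - hs)) := by
    rw [hstep (h' - hs)]
    have : (1 + c) ≠ 0 := by linarith
    field_simp
    ring
  -- The three-point identity of Bregman distances.
  have h7 : q.dphi y h (h' - hs) - q.dphi y h' (h' - hs)
      = q.breg y hs h - q.breg y hs h' - q.breg y h' h := by
    simp only [breg, map_sub]; ring
  have h10 : q.dmodel y h (h' - hs) = q.dmodel y h (h' - h) - q.dmodel y h (hs - h) := by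
    simp only [map_sub]; ring
  have h11 : -q.ipB h' (h' - hs) ≤ ‖q.emb h'‖ * ‖q.emb hs‖ := by
    rw [map_sub, ipB_self]
    have := (abs_le.1 (abs_ipB_le (q := q) h' hs)).2
    nlinarith [sq_nonneg ‖q.emb h'‖]
  have h12 := mul_le_mul_of_nonneg_left h11 hκ
  rw [h7] at h6
  have h13 : 0 ≤ (1 - c) * q.breg y h' hs := mul_nonneg (by linarith) h4
  have h14 : (1 + c) * q.breg y hs h'
      ≤ 2 * c * q.breg y hs h - (1 + c) * (κ * q.ipB h' (h' - hs)) := by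
    nlinarith
  -- The exact contraction factor is 2c/(1+c), and c < 5/7 makes it less than 5/6.
  have h15 : (1 + c) * q.breg y hs h'
      ≤ (1 + c) * (5 / 6 * q.breg y hs h + κ * (‖q.emb h'‖ * ‖q.emb hs‖)) := by
    nlinarith
  exact le_of_mul_le_mul_left h15 (by linarith)

end Quartic

namespace Quartic

variable {d n : ℕ} {q : Quartic d n}

/-! ### The shifted Newton systems -/

/-- `h` solves `(∇²f(y) + l B) h = p`. -/
def IsShiftSol (q : Quartic d n) (y p : Fin d → ℝ) (l : ℝ) (h : Fin d → ℝ) : Prop :=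
  ∀ u, q.d2 y h u + l * q.ipB h u = p ⬝ᵥ u

theorem isShiftSol_inv (hB : (q.Aᵀ * q.A).PosDef) (hc : ConvexOn ℝ Set.univ q.f)
    (y p : Fin d → ℝ) {l : ℝ} (hl : 0 < l) :
    q.IsShiftSol y p l ((hessMat q.f y + l • q.B)⁻¹ *ᵥ p) := by
  set M := hessMat q.f y + l • q.B with hM
  have hdot : ∀ u v, u ⬝ᵥ (M *ᵥ v) = q.d2 y u v + l * q.ipB u v := by
    intro u v
    rw [hM, Matrix.add_mulVec, dotProduct_add, dot_hessMat, Matrix.smul_mulVec, dotProduct_smul,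
      ← inner_emb, smul_eq_mul, ipB_apply]
  have hinj : Function.Injective M.mulVec := by
    have : Function.Injective M.mulVecLin := by
      rw [injective_iff_map_eq_zero]
      intro v hv
      have h1 := hdot v v
      rw [show M *ᵥ v = 0 from hv, dotProduct_zero, ipB_self] at h1
      have h2 := d2_nonneg hc y v
      have h3 : ‖q.emb v‖ ^ 2 = 0 := by nlinarith [sq_nonneg ‖q.emb v‖]
      exact norm_emb_eq_zero hB (pow_eq_zero_iff (two_ne_zero) |>.1 h3)
    exact this
  have hu : IsUnit M := Matrix.mulVec_injective_iff_isUnit.1 hinj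
  have hsol : M *ᵥ (M⁻¹ *ᵥ p) = p := by
    rw [Matrix.mulVec_mulVec, Matrix.mul_nonsing_inv _ ((Matrix.isUnit_iff_isUnit_det _).1 hu),
      Matrix.one_mulVec]
  intro u
  rw [q.d2_symm, ipB_symm, ← hdot, hsol, dotProduct_comm]

theorem B_inv (hB : (q.Aᵀ * q.A).PosDef) (p u : Fin d → ℝ) :
    q.ipB (q.B⁻¹ *ᵥ p) u = p ⬝ᵥ u := by
  have hsol : q.B *ᵥ (q.B⁻¹ *ᵥ p) = p := by
    have hu : IsUnit q.B := hB.isUnit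
    rw [Matrix.mulVec_mulVec, Matrix.mul_nonsing_inv _ ((Matrix.isUnit_iff_isUnit_det _).1 hu),
      Matrix.one_mulVec]
  rw [ipB_apply, ← B_dot, hsol]

/-- Testing both equations on h₁ − h₂ gives (b − a)(t b − s a) ≤ 0 for the norms a, b of h₁, h₂. It
makes l‖h_l‖ nondecreasing in l, so a short bracket means a small residual, without diagonalizing
the Hessian. -/
theorem IsShiftSol.mul_norm_le (hc : ConvexOn ℝ Set.univ q.f) {y p h₁ h₂ : Fin d → ℝ} {s t : ℝ}
    (hs : 0 ≤ s) (hst : s ≤ t) (h1 : q.IsShiftSol y p s h₁) (h2 : q.IsShiftSol y p t h₂) :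
    s * ‖q.emb h₁‖ ≤ t * ‖q.emb h₂‖ := by
  have e1 := h1 (h₁ - h₂)
  have e2 := h2 (h₁ - h₂)
  have e3 := d2_nonneg hc y (h₁ - h₂)
  have e4 := (abs_le.1 (abs_ipB_le (q := q) h₁ h₂)).2
  have e5 := q.ipB_self h₁
  have e6 := q.ipB_self h₂
  have e7 := q.ipB_symm h₂ h₁
  simp only [map_sub, LinearMap.sub_apply] at e1 e2 e3
  rw [e5] at e1
  rw [e6, e7] at e2
  have ha := norm_nonneg (q.emb h₁)
  have hb := norm_nonneg (q.emb h₂)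
  set a := ‖q.emb h₁‖
  set b := ‖q.emb h₂‖
  have e8 : t * b ^ 2 + s * a ^ 2 ≤ (t + s) * (a * b) := by nlinarith
  by_contra hlt
  push Not at hlt
  have hb' : b < a := by
    by_contra hab
    push Not at hab
    have := mul_le_mul hst hab ha (hs.trans hst)
    linarith
  nlinarith

/-- The bracket keeps the sign of l − ‖h_l‖² at both ends. Monotonicity gives hi²‖h_hi‖² ≥ lo³, so
the residual is at most (hi³ − lo³)/hi² ≤ 3(hi − lo). A lower end 0 is allowed separately, since the
Hessian may be singular there. -/
theorem bisect_spec (hB : (q.Aᵀ * q.A).PosDef) (hc : ConvexOn ℝ Set.univ q.f)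
    (y p : Fin d → ℝ) (J : ℕ) (lo hi : ℝ) (h0 : 0 ≤ lo) (hle : lo ≤ hi) (hpos : 0 < hi)
    (hhi : ‖q.emb ((hessMat q.f y + hi • q.B)⁻¹ *ᵥ p)‖ ^ 2 ≤ hi)
    (hlo : lo = 0 ∨ (0 < lo ∧ lo < ‖q.emb ((hessMat q.f y + lo • q.B)⁻¹ *ᵥ p)‖ ^ 2)) :
    0 < (q.bisect y p J lo hi).val ∧ (q.bisect y p J lo hi).val ≤ hi ∧
      ‖q.emb ((hessMat q.f y + (q.bisect y p J lo hi).val • q.B)⁻¹ *ᵥ p)‖ ^ 2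
        ≤ (q.bisect y p J lo hi).val ∧
      (q.bisect y p J lo hi).val
        - ‖q.emb ((hessMat q.f y + (q.bisect y p J lo hi).val • q.B)⁻¹ *ᵥ p)‖ ^ 2
        ≤ 3 * (hi - lo) / 2 ^ J := by
  induction J generalizing lo hi with
  | zero =>
    have hval : (q.bisect y p 0 lo hi).val = hi := rfl
    rw [hval]
    refine ⟨hpos, le_rfl, hhi, ?_⟩
    rw [pow_zero, div_one]
    rcases hlo with rfl | ⟨hlo0, hlo1⟩
    · have := sq_nonneg ‖q.emb ((hessMat q.f y + hi • q.B)⁻¹ *ᵥ p)‖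
      linarith
    · have h1 := (isShiftSol_inv hB hc y p hlo0).mul_norm_le hc h0 hle
        (isShiftSol_inv hB hc y p hpos)
      set a := ‖q.emb ((hessMat q.f y + lo • q.B)⁻¹ *ᵥ p)‖
      set b := ‖q.emb ((hessMat q.f y + hi • q.B)⁻¹ *ᵥ p)‖
      have h2 : (lo * a) ^ 2 ≤ (hi * b) ^ 2 :=
        pow_le_pow_left₀ (mul_nonneg h0 (norm_nonneg _)) h1 2
      have h3 : lo ^ 3 ≤ hi ^ 2 * b ^ 2 := by nlinarith [mul_pos hlo0 hlo0]
      have h4 : hi ^ 2 * (hi - b ^ 2) ≤ hi ^ 2 * (3 * (hi - lo)) := by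
        nlinarith [mul_nonneg (sub_nonneg.2 hle) (mul_nonneg h0 hpos.le),
          mul_nonneg (sub_nonneg.2 hle) (mul_nonneg hpos.le (sub_nonneg.2 hle)),
          mul_nonneg (sub_nonneg.2 hle) (mul_nonneg h0 (sub_nonneg.2 hle))]
      exact le_of_mul_le_mul_left h4 (by positivity)
  | succ J ih =>
    have hval : (q.bisect y p (J + 1) lo hi).val =
        if ‖q.emb ((hessMat q.f y + ((lo + hi) / 2) • q.B)⁻¹ *ᵥ p)‖ ^ 2 ≤ (lo + hi) / 2
        then (q.bisect y p J lo ((lo + hi) / 2)).val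
        else (q.bisect y p J ((lo + hi) / 2) hi).val := by
      rw [bisect]
      simp only [Timed.bind_val, Timed.op_val, Timed.solve_val, evalNormSqB_val]
      split_ifs <;> rfl
    have hmid : 0 < (lo + hi) / 2 := by linarith
    rw [hval]
    split_ifs with hif
    · obtain ⟨g1, g2, g3, g4⟩ := ih lo ((lo + hi) / 2) h0 (by linarith) hmid hif hlo
      refine ⟨g1, g2.trans (by linarith), g3, g4.trans (le_of_eq ?_)⟩
      rw [pow_succ]; field_simp; ring
    · obtain ⟨g1, g2, g3, g4⟩ := ih ((lo + hi) / 2) hi hmid.le (by linarith) hpos hhi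
        (Or.inr ⟨hmid, not_le.1 hif⟩)
      refine ⟨g1, g2, g3, g4.trans (le_of_eq ?_)⟩
      rw [pow_succ]; field_simp; ring

/-- The defect l − ‖h‖² is the κ of `breg_step`: returning the upper end of the bracket makes it
nonnegative. -/
theorem innerSolve_spec (hB : (q.Aᵀ * q.A).PosDef) (hc : ConvexOn ℝ Set.univ q.f)
    (J : ℕ) (y p : Fin d → ℝ) {c X : ℝ} (hX : 0 ≤ X) (hp : ∀ u, |p ⬝ᵥ u| ≤ c * ‖q.emb u‖)
    (hcX : c ^ 2 ≤ X ^ 3) :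
    ∃ l, q.IsShiftSol y p l (q.innerSolve J y p).val ∧
      ‖q.emb (q.innerSolve J y p).val‖ ^ 2 ≤ l ∧ l ≤ X ∧
      l - ‖q.emb (q.innerSolve J y p).val‖ ^ 2 ≤ 3 * X / 2 ^ J := by
  have hval : (q.innerSolve J y p).val = (hessMat q.f y
      + (q.bisect y p J 0 ((p ⬝ᵥ (q.B⁻¹ *ᵥ p)) ^ ((1 : ℝ) / 3))).val • q.B)⁻¹ *ᵥ p := rfl
  set z := q.B⁻¹ *ᵥ p with hz
  have hzp : ∀ u, q.ipB z u = p ⬝ᵥ u := B_inv hB p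
  have hs : p ⬝ᵥ z = ‖q.emb z‖ ^ 2 := by rw [← hzp, ipB_self]
  rcases (norm_nonneg (q.emb z)).eq_or_lt with hz0 | hz0
  -- For p = 0 the bracket is degenerate and the system possibly singular, but the matrix applied to
  -- 0 gives 0 whatever it is.
  · have hp0 : p = 0 := by
      refine dotProduct_eq _ _ fun u => ?_
      rw [← hzp, norm_emb_eq_zero hB hz0.symm]; simp [ipB_apply]
    refine ⟨0, ?_, ?_, hX, ?_⟩
    · rw [hval, hp0]; intro u; simp
    · rw [hval, hp0]; simp
    · rw [hval, hp0]; simp; positivity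
  · set hi := (p ⬝ᵥ z) ^ ((1 : ℝ) / 3) with hhi
    have hs0 : 0 < p ⬝ᵥ z := by rw [hs]; positivity
    have hhi0 : 0 < hi := Real.rpow_pos_of_pos hs0 _
    have hhi3 : hi ^ 3 = ‖q.emb z‖ ^ 2 := by
      rw [hhi, ← Real.rpow_natCast, ← Real.rpow_mul hs0.le, ← hs]; norm_num
    have hr : ‖q.emb ((hessMat q.f y + hi • q.B)⁻¹ *ᵥ p)‖ ^ 2 ≤ hi := by
      have h1 := isShiftSol_inv hB hc y p hhi0
      set h := (hessMat q.f y + hi • q.B)⁻¹ *ᵥ p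
      have h2 := h1 h
      have h3 := d2_nonneg hc y h
      have h4 := (abs_le.1 (abs_ipB_le (q := q) z h)).2
      rw [hzp] at h4
      rw [ipB_self] at h2
      rcases (norm_nonneg (q.emb h)).eq_or_lt with hh | hh
      · rw [← hh]; nlinarith
      -- Positivity of the Hessian gives hi‖h‖ ≤ ‖z‖; with hi³ = ‖z‖² the upper end satisfies the
      -- bracket condition.
      · have h5 : hi * ‖q.emb h‖ ≤ ‖q.emb z‖ := by
          have : (hi * ‖q.emb h‖) * ‖q.emb h‖ ≤ ‖q.emb z‖ * ‖q.emb h‖ := by nlinarith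
          exact le_of_mul_le_mul_right this hh
        have h6 : (hi * ‖q.emb h‖) ^ 2 ≤ hi ^ 3 := by
          rw [hhi3]; exact pow_le_pow_left₀ (by positivity) h5 2
        have h7 : hi ^ 2 * ‖q.emb h‖ ^ 2 ≤ hi ^ 2 * hi := by nlinarith
        exact le_of_mul_le_mul_left h7 (by positivity)
    have hhiX : hi ≤ X := by
      have h1 : ‖q.emb z‖ ≤ c := by
        have := (le_abs_self _).trans (hp z)
        rw [hs] at this
        have h2 : ‖q.emb z‖ * ‖q.emb z‖ ≤ c * ‖q.emb z‖ := by nlinarith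
        exact le_of_mul_le_mul_right h2 hz0
      have h2 : hi ^ 3 ≤ X ^ 3 := by
        rw [hhi3]; exact (pow_le_pow_left₀ hz0.le h1 2).trans hcX
      exact le_of_pow_le_pow_left₀ (by norm_num) hX h2
    obtain ⟨g1, g2, g3, g4⟩ := bisect_spec hB hc y p J 0 hi le_rfl hhi0.le hhi0 hr (Or.inl rfl)
    refine ⟨(q.bisect y p J 0 hi).val, ?_, ?_, g2.trans hhiX, ?_⟩
    · rw [hval]; exact isShiftSol_inv hB hc y p g1
    · rw [hval]; exact g3
    · rw [hval]
      refine g4.trans ?_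
      rw [sub_zero]
      gcongr

/-! ### Convergence of `ApproxAuxMin` -/

theorem abs_dmodel_sub_le (hB : (q.Aᵀ * q.A).PosDef) (hc : ConvexOn ℝ Set.univ q.f)
    {y h₀ : Fin d → ℝ} {L : ℝ} (hL : q.HessLe (y + h₀) L) (w u : Fin d → ℝ) :
    |q.dmodel y (h₀ + w) u - q.dmodel y h₀ u| ≤
      (L + (L + 1) * ‖q.emb w‖ + ‖q.emb w‖ ^ 2 + 7 / 6 * (‖q.emb (h₀ + w)‖ ^ 2
        + ‖q.emb (h₀ + w)‖ * ‖q.emb h₀‖ + ‖q.emb h₀‖ ^ 2)) * ‖q.emb w‖ * ‖q.emb u‖ := by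
  have h1 := hL.abs_d1_sub_le hB hc w u
  rw [add_assoc] at h1
  set h := h₀ + w with hh
  have e1 : ‖q.emb h‖ ^ 2 * q.ipB h u - ‖q.emb h₀‖ ^ 2 * q.ipB h₀ u
      = ‖q.emb h‖ ^ 2 * q.ipB w u
        + (‖q.emb h‖ - ‖q.emb h₀‖) * (‖q.emb h‖ + ‖q.emb h₀‖) * q.ipB h₀ u := by
    have : q.ipB h u = q.ipB h₀ u + q.ipB w u := by rw [hh, ipB_add_left]
    rw [this]; ring
  have e2 : |‖q.emb h‖ - ‖q.emb h₀‖| ≤ ‖q.emb w‖ := by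
    have := abs_norm_sub_norm_le (q.emb h) (q.emb h₀)
    rwa [← map_sub, hh, add_sub_cancel_left] at this
  have e3 : |‖q.emb h‖ ^ 2 * q.ipB h u - ‖q.emb h₀‖ ^ 2 * q.ipB h₀ u| ≤
      (‖q.emb h‖ ^ 2 + ‖q.emb h‖ * ‖q.emb h₀‖ + ‖q.emb h₀‖ ^ 2) * ‖q.emb w‖ * ‖q.emb u‖ := by
    rw [e1]
    refine (abs_add_le _ _).trans ?_
    rw [abs_mul, abs_mul, abs_mul, abs_of_nonneg (by positivity : 0 ≤ ‖q.emb h‖ ^ 2),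
      abs_of_nonneg (by positivity : 0 ≤ ‖q.emb h‖ + ‖q.emb h₀‖)]
    calc _ ≤ ‖q.emb h‖ ^ 2 * (‖q.emb w‖ * ‖q.emb u‖)
          + ‖q.emb w‖ * (‖q.emb h‖ + ‖q.emb h₀‖) * (‖q.emb h₀‖ * ‖q.emb u‖) := by
          gcongr
          · exact abs_ipB_le _ _
          · exact abs_ipB_le _ _
      _ = _ := by ring
  have e4 : q.af h h h u - q.af h₀ h₀ h₀ u
      = q.af w h h u + q.af h₀ w h u + q.af h₀ h₀ w u := by
    rw [hh]
    simp only [af_add₁, af_add₂, af_add₃]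
    ring
  have e5 : |q.af h h h u - q.af h₀ h₀ h₀ u| ≤
      (‖q.emb h‖ ^ 2 + ‖q.emb h‖ * ‖q.emb h₀‖ + ‖q.emb h₀‖ ^ 2) * ‖q.emb w‖ * ‖q.emb u‖ := by
    rw [e4]
    refine (abs_add_le _ _).trans ?_
    refine (add_le_add (abs_add_le _ _) le_rfl).trans ?_
    refine (add_le_add (add_le_add (abs_af_le _ _ _ _) (abs_af_le _ _ _ _))
      (abs_af_le _ _ _ _)).trans (le_of_eq (by ring))
  have e6 : q.dmodel y h u - q.dmodel y h₀ u = (q.d1 (y + h) u - q.d1 (y + h₀) u)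
      + (‖q.emb h‖ ^ 2 * q.ipB h u - ‖q.emb h₀‖ ^ 2 * q.ipB h₀ u)
      - 1 / 6 * (q.af h h h u - q.af h₀ h₀ h₀ u) := by
    rw [dmodel_eq, dmodel_eq]; ring
  rw [e6]
  rw [abs_le] at *
  constructor <;> nlinarith

theorem sub_le_d1 (hc : ConvexOn ℝ Set.univ q.f) (xs x : Fin d → ℝ) : q.f x - q.f xs ≤ q.d1 x (x - xs) := by
  have h1 := f_add_ge_d1 hc x (xs - x)
  rw [add_sub_cancel, ← neg_sub x xs, map_neg] at h1
  linarith

/-- Near-stationary points of the model are no farther away than the minimizer of `f`. -/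
theorem norm_le_of_dmodel_le (hc : ConvexOn ℝ Set.univ q.f) {xs : Fin d → ℝ}
    (hmin : ∀ z, q.f xs ≤ q.f z) {y h : Fin d → ℝ} {η b : ℝ} (hη : 0 ≤ η)
    (hres : ∀ u, |q.dmodel y h u| ≤ η * ‖q.emb u‖) (hb : ‖q.emb (y - xs)‖ ≤ b)
    (hηb : 100 * η ≤ b ^ 3) : ‖q.emb h‖ ≤ 29 / 20 * b := by
  have h1 := (sub_nonneg.2 (hmin (y + h))).trans (sub_le_d1 hc xs (y + h))
  have h2 := dmodel_eq (q := q) y h (y + h - xs)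
  have h3 := (le_abs_self _).trans (hres (y + h - xs))
  have e : y + h - xs = h + (y - xs) := by abel
  rw [e] at h1 h2 h3
  have h4 : ‖q.emb (h + (y - xs))‖ ≤ ‖q.emb h‖ + b := by
    rw [map_add]; exact (norm_add_le _ _).trans (by linarith)
  have h5 : q.ipB h (h + (y - xs)) = ‖q.emb h‖ ^ 2 + q.ipB h (y - xs) := by
    rw [map_add, ipB_self]
  have h6 := (abs_le.1 ((abs_ipB_le (q := q) h (y - xs)))).1
  have h7 := q.af_add₄ h (y - xs) h h h
  have h8 := af_self_le (q := q) h h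
  have h9 := (le_abs_self _).trans (abs_af_le (q := q) h h h (y - xs))
  have ha := norm_nonneg (q.emb h)
  have hb' := norm_nonneg (q.emb (y - xs))
  set a := ‖q.emb h‖
  set β := ‖q.emb (y - xs)‖
  have hb0 : 0 ≤ b := hb'.trans hb
  by_contra hlt
  push Not at hlt
  have ha0 : 0 < a := by nlinarith
  rw [h5] at h2
  rw [h7] at h2
  have h10 : a ^ 2 * (-(a * β)) ≤ a ^ 2 * q.ipB h (y - xs) :=
    mul_le_mul_of_nonneg_left h6 (by positivity)
  have h11 : a ^ 3 * β ≤ a ^ 3 * b := mul_le_mul_of_nonneg_left hb (by positivity)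
  have h12 : η * ‖q.emb (h + (y - xs))‖ ≤ η * (a + b) := mul_le_mul_of_nonneg_left h4 hη
  -- This comes from testing the model gradient on y + h − xs, where f increases. For η = 0 it gives
  -- a ≤ 7b/5; enlarging 7/5 to 29/20 absorbs η ≤ b³/100.
  have h13 : 5 / 6 * a ^ 4 ≤ 7 / 6 * (a ^ 3 * b) + η * (a + b) := by nlinarith
  have hba : b ≤ 20 / 29 * a := by linarith
  have h14 : a ^ 3 * b ≤ a ^ 3 * (20 / 29 * a) := mul_le_mul_of_nonneg_left hba (by positivity)
  have h15 : b ^ 3 ≤ (20 / 29 * a) ^ 3 := pow_le_pow_left₀ hb0 hba 3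
  have h16 : η * (a + b) ≤ ((20 / 29 * a) ^ 3 / 100) * (a + 20 / 29 * a) :=
    mul_le_mul (by linarith) (by linarith) (by positivity) (by positivity)
  have h17 : 0 < a ^ 4 := by positivity
  nlinarith

/-- The setting of one call of `ApproxAuxMin`: curvature and size of the minimizer `hs` of the
model are bounded by `L`. -/
structure AuxBound (q : Quartic d n) (y hs : Fin d → ℝ) (L : ℝ) : Prop where
  one_le : 1 ≤ L
  hess : q.HessLe y L
  hess' : q.HessLe (y + hs) L
  norm_le : ‖q.emb hs‖ ≤ L
  min : ∀ u, q.dmodel y hs u = 0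

/-- The inner loop never leaves this Bregman ball, so all its constants are uniform. Here 12 · 2 =
24 < 3⁴. -/
theorem AuxBound.norm_sub_le (hc : ConvexOn ℝ Set.univ q.f) {y hs h : Fin d → ℝ} {L : ℝ}
    (hb : q.AuxBound y hs L) (hD : q.breg y hs h ≤ 2 * L ^ 4) :
    ‖q.emb (h - hs)‖ ≤ 3 * L ∧ ‖q.emb h‖ ≤ 4 * L := by
  have h1 := breg_ge hc y hs h
  have h0 := hb.one_le
  have h2 : ‖q.emb (h - hs)‖ ≤ 3 * L := by
    rw [← neg_sub hs h, map_neg, norm_neg]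
    refine le_of_pow_le_pow_left₀ (n := 4) (by norm_num) (by positivity) ?_
    have : 0 < L ^ 4 := by positivity
    nlinarith
  refine ⟨h2, ?_⟩
  have h3 : ‖q.emb h‖ ≤ ‖q.emb (h - hs)‖ + ‖q.emb hs‖ := by
    have := norm_add_le (q.emb (h - hs)) (q.emb hs)
    rwa [← map_add, sub_add_cancel] at this
  have := hb.norm_le
  linarith

theorem AuxBound.abs_dmodel_le (hB : (q.Aᵀ * q.A).PosDef) (hc : ConvexOn ℝ Set.univ q.f)
    {y hs h : Fin d → ℝ} {L : ℝ} (hb : q.AuxBound y hs L) (hD : q.breg y hs h ≤ 2 * L ^ 4)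
    (u : Fin d → ℝ) : |q.dmodel y h u| ≤ 41 * L ^ 2 * ‖q.emb (h - hs)‖ * ‖q.emb u‖ := by
  obtain ⟨h1, h2⟩ := hb.norm_sub_le hc hD
  have h3 := abs_dmodel_sub_le hB hc hb.hess' (h - hs) u
  rw [add_sub_cancel, hb.min, sub_zero] at h3
  refine h3.trans ?_
  have h0 := hb.one_le
  have h4 := hb.norm_le
  refine mul_le_mul_of_nonneg_right (mul_le_mul_of_nonneg_right ?_ (norm_nonneg _))
    (norm_nonneg _)
  calc _ ≤ L + (L + 1) * (3 * L) + (3 * L) ^ 2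
        + 7 / 6 * ((4 * L) ^ 2 + (4 * L) * L + L ^ 2) := by gcongr
    _ ≤ 41 * L ^ 2 := by nlinarith

theorem auxStep (hB : (q.Aᵀ * q.A).PosDef) (hc : ConvexOn ℝ Set.univ q.f)
    {y hs h p : Fin d → ℝ} {L : ℝ} (hb : q.AuxBound y hs L) (hD : q.breg y hs h ≤ 2 * L ^ 4)
    (J : ℕ)
    (hp : ∀ u, p ⬝ᵥ u = q.dphi y h u - (1 + 1 / √2)⁻¹ * q.dmodel y h u) :
    q.breg y hs (q.innerSolve J y p).val ≤ 5 / 6 * q.breg y hs h + 612 * L ^ 4 / 2 ^ J := by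
  have h0 := hb.one_le
  obtain ⟨h1, h2⟩ := hb.norm_sub_le hc hD
  have hpb : ∀ u, |p ⬝ᵥ u| ≤ (192 * L ^ 3) * ‖q.emb u‖ := by
    intro u
    have e1 : |q.dmodel y h u| ≤ 123 * L ^ 3 * ‖q.emb u‖ :=
      (hb.abs_dmodel_le hB hc hD u).trans (by
        calc _ ≤ 41 * L ^ 2 * (3 * L) * ‖q.emb u‖ := by gcongr
          _ = _ := by ring)
    have e2 : |q.dphi y h u| ≤ 68 * L ^ 3 * ‖q.emb u‖ := by
      rw [dphi_apply]
      refine (abs_add_le _ _).trans ?_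
      rw [abs_mul, abs_of_nonneg (sq_nonneg ‖q.emb h‖)]
      calc _ ≤ L * ‖q.emb h‖ * ‖q.emb u‖ + ‖q.emb h‖ ^ 2 * (‖q.emb h‖ * ‖q.emb u‖) := by
            gcongr
            · exact hb.hess.abs_d2_le hB hc h u
            · exact abs_ipB_le _ _
        _ ≤ L * (4 * L) * ‖q.emb u‖ + (4 * L) ^ 2 * ((4 * L) * ‖q.emb u‖) := by gcongr
        _ = (4 * L ^ 2 + 64 * L ^ 3) * ‖q.emb u‖ := by ring
        _ ≤ 68 * L ^ 3 * ‖q.emb u‖ := by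
            gcongr
            nlinarith [mul_le_mul_of_nonneg_left h0 (sq_nonneg L)]
    have e3 : (1 + 1 / √2)⁻¹ ≤ 1 := inv_le_one_of_one_le₀ (by
      have : 0 < 1 / √2 := by positivity
      linarith)
    have e4 : |(1 + 1 / √2)⁻¹ * q.dmodel y h u| ≤ |q.dmodel y h u| := by
      rw [abs_mul, abs_of_nonneg (by positivity)]
      exact mul_le_of_le_one_left (abs_nonneg _) e3
    rw [hp]
    refine (abs_sub _ _).trans ?_
    have : 0 ≤ L ^ 3 * ‖q.emb u‖ := by positivity
    linarith
  -- X is taken so that 192² ≤ 34³; then ‖h'‖ ≤ 6L, and the defect contributes at most 3 · 34 · 6 =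
  -- 612 times L⁴/2^J.
  obtain ⟨l, g1, g2, g3, g4⟩ := innerSolve_spec hB hc J y p (X := 34 * L ^ 2) (by positivity) hpb
    (by
      have : 0 ≤ L ^ 6 := by positivity
      nlinarith)
  set h' := (q.innerSolve J y p).val
  have hκ : 0 ≤ l - ‖q.emb h'‖ ^ 2 := sub_nonneg.2 g2
  have hstep := breg_step hc (h := h) (h' := h') hκ hb.min (fun u => by
    rw [← hp u, ← g1 u, dphi_apply]; ring)
  refine hstep.trans (add_le_add le_rfl ?_)
  have hh' : ‖q.emb h'‖ ≤ 6 * L := by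
    refine le_of_pow_le_pow_left₀ (n := 2) (by norm_num) (by positivity) ?_
    nlinarith [sq_nonneg L]
  calc (l - ‖q.emb h'‖ ^ 2) * (‖q.emb h'‖ * ‖q.emb hs‖)
      ≤ (3 * (34 * L ^ 2) / 2 ^ J) * ((6 * L) * L) := by
        gcongr
        exact hb.norm_le
    _ = 612 * L ^ 4 / 2 ^ J := by ring

theorem auxLoop_succ_val (q : Quartic d n) (J : ℕ) (y g h : Fin d → ℝ) (K : ℕ) :
    ∃ p, (q.auxLoop J y g (K + 1) h).val
        = (q.auxLoop J y g K (q.innerSolve J y p).val).val ∧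
      ∀ u, p ⬝ᵥ u = q.dphi y h u
        - (1 + 1 / √2)⁻¹ * (g ⬝ᵥ u + 1 / 2 * q.d3 y h h u + q.dphi y h u) := by
  refine ⟨_, rfl, fun u => ?_⟩
  simp only [Timed.op_val, Timed.dot_val, mulB_val]
  rw [← inner_emb, real_inner_self_eq_norm_sq]
  simp only [sub_dotProduct, add_dotProduct, smul_dotProduct, hessVec_val_dot, thirdVec_val_dot,
    B_dot, smul_eq_mul, dphi_apply, ipB_apply]

/-- The recursion D ↦ 5D/6 + e with e = 612L⁴/2^J contracts to its fixed point 6e. As 2^J ≥ 1836 = 3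
· 612, e is at most L⁴/3, so the level 2L⁴ is preserved. -/
theorem auxLoop_breg_le (hB : (q.Aᵀ * q.A).PosDef) (hc : ConvexOn ℝ Set.univ q.f)
    {y hs g : Fin d → ℝ} {L : ℝ} (hb : q.AuxBound y hs L) (J : ℕ) (hJ : 1836 ≤ (2 : ℝ) ^ J)
    (hg : ∀ u, g ⬝ᵥ u = q.d1 y u) (K : ℕ) (h : Fin d → ℝ) (hD : q.breg y hs h ≤ 2 * L ^ 4) :
    q.breg y hs (q.auxLoop J y g K h).val - 3672 * L ^ 4 / 2 ^ J
        ≤ (5 / 6) ^ K * (q.breg y hs h - 3672 * L ^ 4 / 2 ^ J) ∧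
      q.breg y hs (q.auxLoop J y g K h).val ≤ 2 * L ^ 4 := by
  induction K generalizing h with
  | zero =>
    have hval : (q.auxLoop J y g 0 h).val = h := rfl
    rw [hval]
    exact ⟨by linarith, hD⟩
  | succ K ih =>
    obtain ⟨p, hval, hp⟩ := auxLoop_succ_val q J y g h K
    have h0 := hb.one_le
    have h1 := auxStep hB hc hb hD J (p := p) (fun u => by rw [hp u, hg u, dmodel_apply])
    have h2 : 612 * L ^ 4 / 2 ^ J ≤ L ^ 4 / 3 := by
      rw [div_le_div_iff₀ (by positivity) (by norm_num)]
      have : 0 < L ^ 4 := by positivity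
      nlinarith
    obtain ⟨g1, g2⟩ := ih _ (h1.trans (by nlinarith))
    rw [hval]
    refine ⟨g1.trans ?_, g2⟩
    rw [pow_succ (5 / 6 : ℝ) K, mul_assoc]
    refine mul_le_mul_of_nonneg_left ?_ (by positivity)
    have e : 3672 * L ^ 4 / 2 ^ J = 6 * (612 * L ^ 4 / 2 ^ J) := by ring
    rw [e]
    linarith

theorem approxAuxMin_val (q : Quartic d n) (K J : ℕ) (y : Fin d → ℝ) :
    (q.approxAuxMin K J y).val = y + (q.auxLoop J y (q.gradient y).val K 0).val := rfl

/-- The output of `ApproxAuxMin` is a near-stationary point of the model. -/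
theorem abs_dmodel_approxAuxMin_le (hB : (q.Aᵀ * q.A).PosDef) (hc : ConvexOn ℝ Set.univ q.f)
    {xs y : Fin d → ℝ} (hmin : ∀ z, q.f xs ≤ q.f z) {L b ω : ℝ} (h1 : 1 ≤ L)
    (hb : ‖q.emb (y - xs)‖ ≤ b) (hbL : 29 / 20 * b ≤ L)
    (hess : ∀ x, ‖q.emb (x - xs)‖ ≤ 3 * b → q.HessLe x L) {K J : ℕ}
    (hJ : 1836 ≤ (2 : ℝ) ^ J) (hω : 0 ≤ ω)
    (hKJ : 12 * ((5 / 6) ^ K * L ^ 4 + 3672 * L ^ 4 / 2 ^ J) ≤ ω ^ 4) (u : Fin d → ℝ) :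
    |q.dmodel y ((q.approxAuxMin K J y).val - y) u| ≤ 41 * L ^ 2 * ω * ‖q.emb u‖ := by
  obtain ⟨hs, hhs⟩ := exists_model_min hB hc y
  have hb0 : 0 ≤ b := (norm_nonneg _).trans hb
  have hn : ‖q.emb hs‖ ≤ 29 / 20 * b :=
    norm_le_of_dmodel_le hc hmin (η := 0) le_rfl (fun u => by simp [hhs u]) hb
      (by rw [mul_zero]; positivity)
  have hab : q.AuxBound y hs L := by
    refine ⟨h1, hess y (by linarith), hess _ ?_, hn.trans hbL, hhs⟩
    rw [add_sub_right_comm, map_add]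
    exact (norm_add_le _ _).trans (by linarith)
  have hD0 : q.breg y hs 0 ≤ L ^ 4 := by
    have e1 : q.breg y hs 0 = 1 / 2 * q.d2 y hs hs + 1 / 4 * ‖q.emb hs‖ ^ 4 := by
      simp [breg, phi, dphi_apply]
    have e2 := hab.hess hs
    have e3 := hab.norm_le
    have e4 : ‖q.emb hs‖ ^ 2 ≤ L ^ 2 := pow_le_pow_left₀ (norm_nonneg _) e3 2
    have e5 : ‖q.emb hs‖ ^ 4 ≤ L ^ 4 := pow_le_pow_left₀ (norm_nonneg _) e3 4
    have e6 : L * ‖q.emb hs‖ ^ 2 ≤ L * L ^ 2 := by gcongr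
    have e7 : L ^ 3 ≤ L ^ 4 := pow_le_pow_right₀ h1 (by norm_num)
    rw [e1]
    nlinarith
  obtain ⟨g1, g2⟩ := auxLoop_breg_le hB hc hab J hJ (g := (q.gradient y).val)
    (fun u => q.gradient_val_dot y u) K 0 (by linarith [(by positivity : 0 ≤ L ^ 4)])
  rw [approxAuxMin_val, add_sub_cancel_left]
  set h := (q.auxLoop J y (q.gradient y).val K 0).val
  refine (hab.abs_dmodel_le hB hc g2 u).trans ?_
  have g3 : ‖q.emb (h - hs)‖ ≤ ω := by
    have e1 := breg_ge hc y hs h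
    rw [← neg_sub h hs, map_neg, norm_neg] at e1
    refine le_of_pow_le_pow_left₀ (n := 4) (by norm_num) hω (le_trans ?_ hKJ)
    have e2 : (5 / 6 : ℝ) ^ K * (q.breg y hs 0 - 3672 * L ^ 4 / 2 ^ J) ≤ (5 / 6) ^ K * L ^ 4 := by
      refine mul_le_mul_of_nonneg_left ?_ (by positivity)
      have : 0 ≤ 3672 * L ^ 4 / 2 ^ J := by positivity
      linarith
    linarith
  gcongr

end Quartic

namespace Quartic

variable {d n : ℕ} {q : Quartic d n}

/-! ### The step size -/

theorem stepA_pos {A ρ : ℝ} (hρ : 0 < ρ) : 0 < stepA A ρ := by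
  rw [stepA]; positivity

theorem stepA_sq {A ρ : ℝ} (hA : 0 ≤ A) (hρ : 0 < ρ) :
    ρ * stepA A ρ ^ 2 = A + stepA A ρ := by
  have h1 : √(1 + 4 * A * ρ) ^ 2 = 1 + 4 * A * ρ := Real.sq_sqrt (by positivity)
  rw [stepA]
  set s := √(1 + 4 * A * ρ)
  field_simp
  linarith

theorem stepA_div {A ρ : ℝ} (hA : 0 ≤ A) (hρ : 0 < ρ) :
    stepA A ρ / (A + stepA A ρ) = 2 / (1 + √(1 + 4 * A * ρ)) := by
  have h1 := stepA_pos (A := A) hρ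
  rw [← stepA_sq hA hρ, pow_two, ← mul_assoc, div_mul_cancel_right₀ h1.ne', stepA]
  field_simp

/-- The mixing weight is 2/(1 + √(1 + 4Aρ)). Its modulus of continuity is independent of A, so it
serves every iteration. -/
theorem stepA_div_sub_le {A ρ ρ' : ℝ} (hA : 0 ≤ A) (hρ : 0 < ρ) (h : ρ ≤ ρ') :
    0 ≤ stepA A ρ / (A + stepA A ρ) - stepA A ρ' / (A + stepA A ρ') ∧
    stepA A ρ / (A + stepA A ρ) - stepA A ρ' / (A + stepA A ρ') ≤ (ρ' - ρ) / ρ := by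
  rw [stepA_div hA hρ, stepA_div hA (hρ.trans_le h)]
  have h1 : √(1 + 4 * A * ρ) ^ 2 = 1 + 4 * A * ρ := Real.sq_sqrt (by positivity)
  have h2 : √(1 + 4 * A * ρ') ^ 2 = 1 + 4 * A * ρ' :=
    Real.sq_sqrt (by have := hρ.trans_le h; positivity)
  have h3 : √(1 + 4 * A * ρ) ≤ √(1 + 4 * A * ρ') := by
    apply Real.sqrt_le_sqrt; nlinarith
  have h4 : 1 ≤ √(1 + 4 * A * ρ) := Real.one_le_sqrt.2 (by nlinarith [mul_nonneg hA hρ.le])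
  set s := √(1 + 4 * A * ρ)
  set s' := √(1 + 4 * A * ρ')
  have e : 2 / (1 + s) - 2 / (1 + s') = 2 * (s' - s) / ((1 + s) * (1 + s')) := by
    have : 0 < 1 + s := by linarith
    have : 0 < 1 + s' := by linarith
    field_simp
    ring
  rw [e]
  constructor
  · apply div_nonneg <;> nlinarith
  · rw [div_le_div_iff₀ (by nlinarith) hρ]
    have h5 : (s' - s) * (s' + s) = 4 * A * (ρ' - ρ) := by nlinarith
    have h6 : 4 * A * ρ = s ^ 2 - 1 := by linarith
    have h7 : 0 ≤ ρ' - ρ := sub_nonneg.2 h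
    have h8 : 2 * (s' - s) * ρ * (s' + s) = 2 * (s ^ 2 - 1) * (ρ' - ρ) := by
      rw [← h6]; linear_combination (2 * ρ) * h5
    have h9 : 2 * (s ^ 2 - 1) * (ρ' - ρ) ≤ ((ρ' - ρ) * ((1 + s) * (1 + s'))) * (s' + s) := by
      have e1 : 2 * (s ^ 2 - 1) ≤ ((1 + s) * (1 + s')) * (s' + s) := by
        have e2 : (1 + s) * (1 + s) ≤ (1 + s) * (1 + s') := by nlinarith
        nlinarith [mul_le_mul e2 (by linarith : 2 ≤ s' + s) (by norm_num) (by nlinarith)]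
      nlinarith
    exact le_of_mul_le_mul_right (h8.le.trans h9) (by linarith)

theorem smul_mix {x v : Fin d → ℝ} {A a : ℝ} (h : 0 < A + a) :
    (A + a) • mix x v A a = A • x + a • v := by
  have h1 : (A + a) * (1 - a / (A + a)) = A := by field_simp; ring
  have h2 : (A + a) * (a / (A + a)) = a := by field_simp
  rw [mix, smul_add, smul_smul, smul_smul, h1, h2]

/-- The bound on x carries the factor A because for A = 0 the mixture is v and x is irrelevant. -/
theorem norm_mix_sub_le {x v xs : Fin d → ℝ} {A ρ r D : ℝ} (hA : 0 ≤ A) (hρ : 0 < ρ)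
    (hDr : D ≤ r) (hx : A * ‖q.emb (x - xs)‖ ≤ A * r) (hv : ‖q.emb (v - xs)‖ ≤ D) :
    ‖q.emb (mix x v A (stepA A ρ) - xs)‖ ≤ r := by
  have ha := stepA_pos (A := A) hρ
  set a := stepA A ρ
  have hA' : 0 < A + a := by linarith
  have e : (A + a) • (mix x v A a - xs) = A • (x - xs) + a • (v - xs) := by
    rw [smul_sub, smul_mix hA']
    module
  have h1 : (A + a) * ‖q.emb (mix x v A a - xs)‖ ≤ A * r + a * D := by
    calc (A + a) * ‖q.emb (mix x v A a - xs)‖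
        = ‖q.emb ((A + a) • (mix x v A a - xs))‖ := by
          rw [map_smul, norm_smul, Real.norm_eq_abs, abs_of_pos hA']
      _ = ‖A • q.emb (x - xs) + a • q.emb (v - xs)‖ := by rw [e, map_add, map_smul, map_smul]
      _ ≤ ‖A • q.emb (x - xs)‖ + ‖a • q.emb (v - xs)‖ := norm_add_le _ _
      _ = A * ‖q.emb (x - xs)‖ + a * ‖q.emb (v - xs)‖ := by
          rw [norm_smul, norm_smul, Real.norm_eq_abs, Real.norm_eq_abs, abs_of_nonneg hA,
            abs_of_pos ha]
      _ ≤ A * r + a * D := by gcongr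
  have h2 : a * D ≤ a * r := by gcongr
  refine le_of_mul_le_mul_left (h1.trans ?_) hA'
  linarith

/-! ### One accelerated step -/

/-- Convexity at x' is used towards x and xs with weights A and a. Since ρa² = A + a, the cross
terms complete the square ‖B⁻¹∇f(x') + ρh‖² with h = x' − y; the relative error 1/2 leaves the
dissipation 1/2 − 1/8 = 3/8. -/
theorem accelerated_step (hB : (q.Aᵀ * q.A).PosDef) (hc : ConvexOn ℝ Set.univ q.f)
    {xs x v x' : Fin d → ℝ} {A ρ : ℝ} (hA : 0 ≤ A) (hρ : 0 < ρ)
    (hg : ∀ u, |q.d1 x' u + ρ * q.ipB (x' - mix x v A (stepA A ρ)) u|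
      ≤ 1 / 2 * ρ * ‖q.emb (x' - mix x v A (stepA A ρ))‖ * ‖q.emb u‖) :
    (A + stepA A ρ) * (q.f x' - q.f xs)
      + 1 / 2 * ‖q.emb (v - stepA A ρ • (q.B⁻¹ *ᵥ gradVec q.f x') - xs)‖ ^ 2
      + 3 / 8 * ((A + stepA A ρ) * ρ * ‖q.emb (x' - mix x v A (stepA A ρ))‖ ^ 2)
      ≤ A * (q.f x - q.f xs) + 1 / 2 * ‖q.emb (v - xs)‖ ^ 2 := by
  have ha := stepA_pos (A := A) hρ
  have hsq := stepA_sq hA hρ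
  set a := stepA A ρ
  have hA' : 0 < A + a := by linarith
  set y := mix x v A a
  have ey : (A + a) • y = A • x + a • v := smul_mix hA'
  set h := x' - y with hh
  set G := q.B⁻¹ *ᵥ gradVec q.f x' with hG
  have hGd : ∀ u, q.ipB G u = q.d1 x' u := fun u => by rw [hG, B_inv hB, gradVec_dot]
  have e1 : ‖q.emb (v - a • G - xs)‖ ^ 2
      = ‖q.emb (v - xs)‖ ^ 2 - 2 * a * q.d1 x' (v - xs) + a ^ 2 * ‖q.emb G‖ ^ 2 := by
    have : v - a • G - xs = (v - xs) + (-a) • G := by module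
    rw [this, norm_emb_add_sq, ipB_symm, ipB_smul_left, hGd, map_smul, norm_smul, mul_pow,
      Real.norm_eq_abs, sq_abs]
    ring
  have f1 := f_add_ge_d1 hc x' (xs - x')
  have f2 := f_add_ge_d1 hc x' (x - x')
  rw [add_sub_cancel] at f1 f2
  have e2 : A * q.d1 x' (x - x') + a * q.d1 x' (xs - x') + a * q.d1 x' (v - xs)
      = -((A + a) * q.d1 x' h) := by
    rw [← smul_eq_mul, ← smul_eq_mul, ← smul_eq_mul, ← smul_eq_mul, ← map_smul, ← map_smul,
      ← map_smul, ← map_smul, ← map_add, ← map_add, ← map_neg]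
    congr 1
    rw [hh, smul_sub (A + a), ey]
    module
  have e3 : ‖q.emb (G + ρ • h)‖ ^ 2
      = ‖q.emb G‖ ^ 2 + 2 * ρ * q.d1 x' h + ρ ^ 2 * ‖q.emb h‖ ^ 2 := by
    rw [norm_emb_add_sq, map_smul, hGd, map_smul, norm_smul, mul_pow, Real.norm_eq_abs, sq_abs,
      smul_eq_mul]
    ring
  have e4 : ‖q.emb (G + ρ • h)‖ ≤ 1 / 2 * ρ * ‖q.emb h‖ := by
    have h1 := (le_abs_self _).trans (hg (G + ρ • h))
    rw [← hGd, ← ipB_smul_left, ← ipB_add_left, ipB_self] at h1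
    rcases (norm_nonneg (q.emb (G + ρ • h))).eq_or_lt with h0 | h0
    · rw [← h0]; positivity
    · exact le_of_mul_le_mul_right (by rw [← pow_two]; exact h1) h0
  have e5 : ‖q.emb (G + ρ • h)‖ ^ 2 ≤ 1 / 4 * ρ ^ 2 * ‖q.emb h‖ ^ 2 := by
    calc _ ≤ (1 / 2 * ρ * ‖q.emb h‖) ^ 2 := pow_le_pow_left₀ (norm_nonneg _) e4 2
      _ = _ := by ring
  rw [e3] at e5
  have e6 := mul_le_mul_of_nonneg_left e5 (by positivity : 0 ≤ a ^ 2 / 2)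
  have e7 : a ^ 2 * ρ * q.d1 x' h = (A + a) * q.d1 x' h := by rw [← hsq]; ring
  have e8 : a ^ 2 * ρ ^ 2 * ‖q.emb h‖ ^ 2 = (A + a) * ρ * ‖q.emb h‖ ^ 2 := by rw [← hsq]; ring
  have g1 := mul_le_mul_of_nonneg_left f1 ha.le
  have g2 := mul_le_mul_of_nonneg_left f2 hA
  rw [e1]
  nlinarith

/-- The increment of A^(1/4) is at least t with t⁻⁴ = 256ρ²(A + a). The convex function u ↦ u^(−1/4)
lies above its tangent at u = κ⁻⁴, so t ≥ 5κ/4 − 64κ⁵ρ²(A + a). This linear bound, with κ free,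
replaces Hölder's inequality and can be summed over the iterations. -/
theorem fourth_root_growth {A ρ κ e : ℝ} (hA : 0 ≤ A) (hρ : 0 < ρ) (hκ : 0 < κ)
    (he : (A + stepA A ρ) * ρ ^ 2 ≤ 3 * e) :
    A ^ ((1 : ℝ) / 4) + 5 / 4 * κ - 192 * κ ^ 5 * e
      ≤ (A + stepA A ρ) ^ ((1 : ℝ) / 4) := by
  have ha := stepA_pos (A := A) hρ
  have hsq := stepA_sq hA hρ
  set a := stepA A ρ
  have hA' : 0 < A + a := by linarith
  have hb0 : 0 ≤ A ^ ((1 : ℝ) / 4) := Real.rpow_nonneg hA _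
  have hb1 : 0 < (A + a) ^ ((1 : ℝ) / 4) := Real.rpow_pos_of_pos hA' _
  have h4 : (A ^ ((1 : ℝ) / 4)) ^ 4 = A := by
    rw [← Real.rpow_natCast, ← Real.rpow_mul hA]; norm_num
  have h4' : ((A + a) ^ ((1 : ℝ) / 4)) ^ 4 = A + a := by
    rw [← Real.rpow_natCast, ← Real.rpow_mul hA'.le]; norm_num
  have hle : A ^ ((1 : ℝ) / 4) ≤ (A + a) ^ ((1 : ℝ) / 4) :=
    Real.rpow_le_rpow hA (by linarith) (by norm_num)
  set b := A ^ ((1 : ℝ) / 4)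
  set b' := (A + a) ^ ((1 : ℝ) / 4)
  -- the increment is at least `t = 1 / (4 √ρ b')`
  set r := √ρ with hr
  have hr0 : 0 < r := Real.sqrt_pos.2 hρ
  have hr2 : r ^ 2 = ρ := Real.sq_sqrt hρ.le
  have hb2 : b' ^ 2 = a * r := by
    have : (b' ^ 2) ^ 2 = (a * r) ^ 2 := by
      rw [mul_pow, hr2, ← pow_mul, h4', ← hsq]; ring
    exact (pow_left_inj₀ (by positivity) (by positivity) two_ne_zero).1 this
  have hinc : 1 / (4 * r * b') ≤ b' - b := by
    rw [div_le_iff₀ (by positivity)]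
    have e1 : (b' - b) * ((b' + b) * (b' ^ 2 + b ^ 2)) = a := by linear_combination h4' - h4
    have e2 : (b' + b) * (b' ^ 2 + b ^ 2) ≤ 2 * b' * (2 * b' ^ 2) := by
      have : b ^ 2 ≤ b' ^ 2 := pow_le_pow_left₀ hb0 hle 2
      exact mul_le_mul (by linarith) (by linarith) (by positivity) (by positivity)
    have e3 : a ≤ (b' - b) * (2 * b' * (2 * b' ^ 2)) := by
      rw [← e1]; exact mul_le_mul_of_nonneg_left e2 (sub_nonneg.2 hle)
    rw [hb2] at e3
    have e4 : a * 1 ≤ a * ((b' - b) * (4 * r * b')) := by linarith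
    exact le_of_mul_le_mul_left e4 ha
  set t := 1 / (4 * r * b') with ht
  have ht0 : 0 < t := by positivity
  have ht4 : t ^ 4 * (256 * (ρ ^ 2 * (A + a))) = 1 := by
    rw [ht, ← h4', ← hr2]; field_simp; norm_num
  have hamgm : 5 * κ * t ^ 4 ≤ 4 * t ^ 5 + κ ^ 5 := by
    have : 0 ≤ (t - κ) ^ 2 * (4 * t ^ 3 + 3 * t ^ 2 * κ + 2 * t * κ ^ 2 + κ ^ 3) := by positivity
    linarith
  have htan : 5 / 4 * κ - 64 * κ ^ 5 * (ρ ^ 2 * (A + a)) ≤ t := by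
    have e1 : t ^ 4 * (5 / 4 * κ - 64 * κ ^ 5 * (ρ ^ 2 * (A + a))) ≤ t ^ 4 * t := by
      have e2 : t ^ 4 * (64 * κ ^ 5 * (ρ ^ 2 * (A + a))) = κ ^ 5 / 4 := by
        linear_combination (κ ^ 5 / 4) * ht4
      nlinarith
    exact le_of_mul_le_mul_left e1 (by positivity)
  have hk5 : 0 ≤ κ ^ 5 := by positivity
  have := mul_le_mul_of_nonneg_left he (by positivity : 0 ≤ 64 * κ ^ 5)
  linarith

end Quartic

namespace Quartic

variable {d n : ℕ} {q : Quartic d n}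

/-! ### The binary search -/

/-- The tolerance of the binary search. -/
noncomputable def searchTol (par : Params) (P : ℝ) : ℝ :=
  6 * par.epsAam ^ ((1 : ℝ) / 4) * √P + √(12 * par.epsAam)

/-- The point `x(ρ)`. -/
noncomputable def trialPoint (q : Quartic d n) (par : Params) (x v : Fin d → ℝ) (A ρ : ℝ) :
    Fin d → ℝ :=
  (q.approxAuxMin par.K par.J (mix x v A (stepA A ρ))).val

/-- The step `x(ρ) - y(ρ)`. -/
noncomputable def trialStep (q : Quartic d n) (par : Params) (x v : Fin d → ℝ) (A ρ : ℝ) :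
    Fin d → ℝ :=
  q.trialPoint par x v A ρ - mix x v A (stepA A ρ)

/-- The squared step length. -/
noncomputable def zetaHat (q : Quartic d n) (par : Params) (x v : Fin d → ℝ) (A ρ : ℝ) : ℝ :=
  ‖q.emb (q.trialStep par x v A ρ)‖ ^ 2

theorem rhoSearch_succ_val (par : Params) (P : ℝ) (x v : Fin d → ℝ) (A : ℝ) (M : ℕ)
    (lo hi : ℝ) (last : (Fin d → ℝ) × ℝ) :
    (q.rhoSearch par P x v A (M + 1) lo hi last).val =
      if (lo + hi) / 2 > q.zetaHat par x v A ((lo + hi) / 2) + searchTol par P then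
        (q.rhoSearch par P x v A M lo ((lo + hi) / 2)
          (q.trialPoint par x v A ((lo + hi) / 2), stepA A ((lo + hi) / 2))).val
      else if (lo + hi) / 2 < q.zetaHat par x v A ((lo + hi) / 2) - searchTol par P then
        (q.rhoSearch par P x v A M ((lo + hi) / 2) hi
          (q.trialPoint par x v A ((lo + hi) / 2), stepA A ((lo + hi) / 2))).val
      else ((lo + hi) / 2, q.trialPoint par x v A ((lo + hi) / 2), stepA A ((lo + hi) / 2)) := by
  rw [rhoSearch]
  simp only [Timed.bind_val, Timed.op_val, evalNormSqB_val]
  unfold zetaHat trialStep trialPoint searchTol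
  split_ifs <;> rfl

/-- The ends keep opposite signs of ρ − ζ̂(ρ) with margin δ. If all M halvings were used, a bracket
of width at most θ < δ would carry a drop of ζ̂ of at least 2δ − θ > δ, against `hcont`. So the
search stops in its third branch and the fallback value is never returned. -/
theorem rhoSearch_spec {par : Params} {P : ℝ} {x v : Fin d → ℝ} {A r₀ θ : ℝ}
    (hθ : θ < searchTol par P)
    (hcont : ∀ ρ ρ', r₀ ≤ ρ → ρ ≤ ρ' → ρ' - ρ ≤ θ →
      q.zetaHat par x v A ρ - q.zetaHat par x v A ρ' ≤ searchTol par P)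
    (M : ℕ) (lo hi : ℝ) (last : (Fin d → ℝ) × ℝ) (h0 : r₀ ≤ lo) (hle : lo ≤ hi)
    (hlo : lo + searchTol par P ≤ q.zetaHat par x v A lo)
    (hhi : q.zetaHat par x v A hi ≤ hi - searchTol par P) (hM : hi - lo ≤ θ * 2 ^ M) :
    ∃ ρ, r₀ ≤ ρ ∧ (q.rhoSearch par P x v A M lo hi last).val
        = (ρ, q.trialPoint par x v A ρ, stepA A ρ) ∧
      |ρ - q.zetaHat par x v A ρ| ≤ searchTol par P := by
  induction M generalizing lo hi last with
  | zero =>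
    rw [pow_zero, mul_one] at hM
    have := hcont lo hi h0 hle hM
    linarith
  | succ M ih =>
    rw [rhoSearch_succ_val]
    rw [pow_succ] at hM
    split_ifs with h1 h2
    · exact ih _ _ _ h0 (by linarith) hlo (by linarith) (by linarith)
    · exact ih _ _ _ (by linarith) (by linarith) (by linarith) hhi (by linarith)
    · refine ⟨(lo + hi) / 2, by linarith, rfl, ?_⟩
      rw [abs_le]
      constructor <;> linarith

/-! ### A run of `FastQuartic` -/

/-- The residual bound of `ApproxAuxMin`. -/
noncomputable def resBound (L ω : ℝ) : ℝ := 41 * L ^ 2 * ω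

/-- Sufficient conditions on the parameters for a run started at distance `D` of the minimizer:
`L` bounds the curvature, `ω` the accuracy of the subproblem solver, and `θ` is the width of a
bracket that the binary search cannot reach. -/
structure RunSetting (q : Quartic d n) (par : Params) (xs : Fin d → ℝ) (P D L ω θ ε : ℝ) :
    Prop where
  D_pos : 0 < D
  le_P : 16 * D ^ 2 ≤ P
  one_le : 1 ≤ L
  D_le : 4 * D ≤ L
  hess : ∀ x, ‖q.emb (x - xs)‖ ≤ 33 / 5 * D → q.HessLe x L
  J_large : 1836 ≤ (2 : ℝ) ^ par.J
  ω_nonneg : 0 ≤ ω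
  KJ_large : 12 * ((5 / 6) ^ par.K * L ^ 4 + 3672 * L ^ 4 / 2 ^ par.J) ≤ ω ^ 4
  res_le : 100 * resBound L ω ≤ D ^ 3
  rho_pos : 0 < par.rho
  rho_le : par.rho ≤ D ^ 2
  res_le_rho : 20 * resBound L ω ^ 2 ≤ par.rho ^ 3
  eps_pos : 0 < par.epsAam
  eps_lt : par.epsAam < 1 / 2
  tol_le : (6 * √P + 5) * par.epsAam ^ ((1 : ℝ) / 4) ≤ par.rho / 16
  early : 11 * √par.rho ^ 3 * D ≤ ε
  M_large : P ≤ θ * 2 ^ par.M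
  θ_nonneg : 0 ≤ θ
  θ_lt : θ < searchTol par P
  move_le : θ / par.rho * (16 / 5 * D) ≤ 1
  cont : 300 * D ^ 3 * (42 * resBound L ω + 84 * L * (θ / par.rho * (16 / 5 * D)))
    ≤ searchTol par P ^ 3

/-- The early-return threshold dominates the search tolerance, so a run that does not return has a
valid lower end for its search. -/
theorem searchTol_le {par : Params} (P : ℝ) (h0 : 0 < par.epsAam) (h1 : par.epsAam < 1 / 2) :
    searchTol par P ≤ (6 * √P + 5) * par.epsAam ^ ((1 : ℝ) / 4) := by
  have h2 : √(12 * par.epsAam) ≤ 5 * par.epsAam ^ ((1 : ℝ) / 4) := by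
    rw [Real.sqrt_le_left (by positivity), mul_pow]
    have h3 : 0 < par.epsAam ^ ((1 : ℝ) / 4) := Real.rpow_pos_of_pos h0 _
    have h4 : (par.epsAam ^ ((1 : ℝ) / 4)) ^ 4 = par.epsAam := by
      rw [← Real.rpow_natCast, ← Real.rpow_mul h0.le]; norm_num
    set e := par.epsAam ^ ((1 : ℝ) / 4)
    have h5 : e ≤ 1 := by
      by_contra h
      push Not at h
      have : 1 < e ^ 4 := one_lt_pow₀ h (by norm_num)
      linarith
    have h6 : e ^ 4 ≤ e ^ 2 := pow_le_pow_of_le_one h3.le h5 (by norm_num)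
    nlinarith
  rw [searchTol]
  linarith

/-! ### Consequences of the run conditions -/

section

variable {par : Params} {xs : Fin d → ℝ} {P D L ω θ ε : ℝ}

theorem RunSetting.tol (hS : q.RunSetting par xs P D L ω θ ε) :
    searchTol par P ≤ par.rho / 16 :=
  (searchTol_le P hS.eps_pos hS.eps_lt).trans hS.tol_le

theorem resBound_nonneg (hS : q.RunSetting par xs P D L ω θ ε) : 0 ≤ resBound L ω := by
  have := hS.ω_nonneg
  rw [resBound]; positivity

theorem RunSetting.aux (hB : (q.Aᵀ * q.A).PosDef) (hc : ConvexOn ℝ Set.univ q.f)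
    (hmin : ∀ z, q.f xs ≤ q.f z) (hS : q.RunSetting par xs P D L ω θ ε) {y : Fin d → ℝ}
    (hy : ‖q.emb (y - xs)‖ ≤ 11 / 5 * D) :
    (∀ u, |q.dmodel y ((q.approxAuxMin par.K par.J y).val - y) u|
      ≤ resBound L ω * ‖q.emb u‖) ∧
    ‖q.emb ((q.approxAuxMin par.K par.J y).val - y)‖ ≤ 319 / 100 * D := by
  have hD := hS.D_pos
  have h1 := abs_dmodel_approxAuxMin_le hB hc hmin hS.one_le hy
    (by linarith [hS.D_le]) (fun x hx => hS.hess x (by linarith)) hS.J_large hS.ω_nonneg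
    hS.KJ_large
  refine ⟨h1, ?_⟩
  have h2 := norm_le_of_dmodel_le hc hmin (resBound_nonneg hS) h1 hy
    (hS.res_le.trans (by
      have : 0 < D ^ 3 := by positivity
      nlinarith))
  linarith

/-- Changing ρ moves y by at most z. The two steps are then near-stationary for nearby models, and
`dmodel_monotone` gives ‖h − h'‖³ ≤ 21(2η + 4Lz). Both steps have length at most 3.19D, and 6.38³ <
300. -/
theorem RunSetting.zeta_cont (hB : (q.Aᵀ * q.A).PosDef) (hc : ConvexOn ℝ Set.univ q.f)
    (hmin : ∀ z, q.f xs ≤ q.f z) (hS : q.RunSetting par xs P D L ω θ ε) {x v : Fin d → ℝ}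
    {A : ℝ} (hA : 0 ≤ A) (hx : A * ‖q.emb (x - xs)‖ ≤ A * (11 / 5 * D))
    (hv : ‖q.emb (v - xs)‖ ≤ D) {ρ ρ' : ℝ} (h0 : par.rho ≤ ρ) (hρ : ρ ≤ ρ') (hθ : ρ' - ρ ≤ θ) :
    q.zetaHat par x v A ρ - q.zetaHat par x v A ρ' ≤ searchTol par P := by
  have hD := hS.D_pos
  have hr := hS.rho_pos
  have hρ0 : 0 < ρ := hr.trans_le h0
  have hy := norm_mix_sub_le hA hρ0 (by linarith : D ≤ 11 / 5 * D) hx hv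
  have hy' := norm_mix_sub_le hA (hρ0.trans_le hρ) (by linarith : D ≤ 11 / 5 * D) hx hv
  obtain ⟨g1, g2⟩ := hS.aux hB hc hmin hy
  obtain ⟨g1', g2'⟩ := hS.aux hB hc hmin hy'
  change ∀ u, |q.dmodel _ (q.trialStep par x v A ρ) u| ≤ _ at g1
  change ∀ u, |q.dmodel _ (q.trialStep par x v A ρ') u| ≤ _ at g1'
  change ‖q.emb (q.trialStep par x v A ρ)‖ ≤ _ at g2
  change ‖q.emb (q.trialStep par x v A ρ')‖ ≤ _ at g2'
  rw [zetaHat, zetaHat]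
  set h := q.trialStep par x v A ρ
  set h' := q.trialStep par x v A ρ'
  have hz : ‖q.emb (mix x v A (stepA A ρ) - mix x v A (stepA A ρ'))‖
      ≤ θ / par.rho * (16 / 5 * D) := by
    obtain ⟨t0, t1⟩ := stepA_div_sub_le hA hρ0 hρ
    have t2 : (ρ' - ρ) / ρ ≤ θ / par.rho := by gcongr; exact hS.θ_nonneg
    have e : mix x v A (stepA A ρ) - mix x v A (stepA A ρ')
        = (stepA A ρ / (A + stepA A ρ) - stepA A ρ' / (A + stepA A ρ')) • (v - x) := by
      rw [mix, mix]; module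
    rw [e, map_smul, norm_smul, Real.norm_eq_abs, abs_of_nonneg t0]
    -- For A = 0 the point y does not depend on ρ, and nothing is known about x.
    rcases hA.eq_or_lt with rfl | hA0
    · have a1 := stepA_pos (A := 0) hρ0
      have a2 := stepA_pos (A := 0) (hρ0.trans_le hρ)
      rw [zero_add, zero_add, div_self a1.ne', div_self a2.ne', sub_self, zero_mul]
      have := hS.θ_nonneg
      positivity
    · have hx' : ‖q.emb (x - xs)‖ ≤ 11 / 5 * D := le_of_mul_le_mul_left hx hA0
      refine mul_le_mul (t1.trans t2) ?_ (norm_nonneg _) (t0.trans (t1.trans t2))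
      have e2 : v - x = (v - xs) - (x - xs) := by abel
      rw [e2, map_sub]
      exact (norm_sub_le _ _).trans (by linarith)
  set y := mix x v A (stepA A ρ)
  set y' := mix x v A (stepA A ρ')
  set z := θ / par.rho * (16 / 5 * D)
  have hz1 : z ≤ 1 := hS.move_le
  have hL := hS.one_le
  have hη := resBound_nonneg hS
  set η := resBound L ω
  have hH : q.HessLe (y' + h') L := by
    refine hS.hess _ ?_
    rw [add_sub_right_comm, map_add]
    exact (norm_add_le _ _).trans (by linarith)
  have hz0 : 0 ≤ z := (norm_nonneg _).trans hz
  have k1 := hH.abs_d1_sub_le hB hc (y - y') (h - h')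
  have e1 : y' + h' + (y - y') = y + h' := by abel
  rw [e1] at k1
  have k2 : L * ‖q.emb (y - y')‖ + (L + 1) * ‖q.emb (y - y')‖ ^ 2 + ‖q.emb (y - y')‖ ^ 3
      ≤ 4 * L * z := by
    have e2 : ‖q.emb (y - y')‖ ^ 2 ≤ z := by
      calc _ ≤ z ^ 2 := pow_le_pow_left₀ (norm_nonneg _) hz 2
        _ ≤ z := by nlinarith
    have e3 : ‖q.emb (y - y')‖ ^ 3 ≤ z := by
      calc _ ≤ z ^ 3 := pow_le_pow_left₀ (norm_nonneg _) hz 3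
        _ ≤ z ^ 1 := pow_le_pow_of_le_one hz0 hz1 (by norm_num)
        _ = z := pow_one z
    calc _ ≤ L * z + (L + 1) * z + z := by gcongr
      _ ≤ 4 * L * z := by nlinarith
  have k3 := k1.trans (mul_le_mul_of_nonneg_right k2 (norm_nonneg _))
  have k4 := dmodel_monotone hc y h h'
  have k5 := (abs_le.1 (g1 (h - h'))).2
  have k6 := (abs_le.1 (g1' (h - h'))).1
  have k7 := (abs_le.1 k3).1
  have k8 : q.dmodel y h' (h - h') - q.dmodel y' h' (h - h')
      = q.d1 (y + h') (h - h') - q.d1 (y' + h') (h - h') := by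
    rw [dmodel_eq, dmodel_eq]; ring
  have hw := norm_nonneg (q.emb (h - h'))
  set w := ‖q.emb (h - h')‖ with hwdef
  have k9 : w ^ 4 ≤ (42 * η + 84 * L * z) * w := by nlinarith
  have k10 : w ^ 3 ≤ 42 * η + 84 * L * z := by
    rcases hw.eq_or_lt with hw0 | hw0
    · rw [← hw0]; norm_num; positivity
    · exact le_of_mul_le_mul_right (by linarith) hw0
  have hcont : 300 * D ^ 3 * (42 * η + 84 * L * z) ≤ searchTol par P ^ 3 := hS.cont
  have hδ : 0 ≤ searchTol par P := hS.θ_nonneg.trans hS.θ_lt.le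
  have k11 : 638 / 100 * D * w ≤ searchTol par P := by
    refine le_of_pow_le_pow_left₀ (n := 3) (by norm_num) hδ (le_trans ?_ hcont)
    have e4 : D ^ 3 * w ^ 3 ≤ D ^ 3 * (42 * η + 84 * L * z) := by gcongr
    have e5 : 0 ≤ D ^ 3 * w ^ 3 := by positivity
    calc (638 / 100 * D * w) ^ 3 = (638 / 100) ^ 3 * (D ^ 3 * w ^ 3) := by ring
      _ ≤ 300 * (D ^ 3 * w ^ 3) := by nlinarith
      _ ≤ _ := by linarith
  have k12 : ‖q.emb h‖ - ‖q.emb h'‖ ≤ w := by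
    rw [hwdef, map_sub]; exact norm_sub_norm_le _ _
  have k13 : ‖q.emb h‖ ^ 2 - ‖q.emb h'‖ ^ 2
      = (‖q.emb h‖ - ‖q.emb h'‖) * (‖q.emb h‖ + ‖q.emb h'‖) := by ring
  rw [k13]
  have k14 := norm_nonneg (q.emb h)
  have k15 := norm_nonneg (q.emb h')
  calc (‖q.emb h‖ - ‖q.emb h'‖) * (‖q.emb h‖ + ‖q.emb h'‖)
      ≤ w * (‖q.emb h‖ + ‖q.emb h'‖) := by gcongr
    _ ≤ w * (638 / 100 * D) := by
        apply mul_le_mul_of_nonneg_left _ hw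
        linarith
    _ ≤ searchTol par P := by linarith

/-- The gradient condition of the accelerated method holds at an accepted trial point. -/
theorem RunSetting.accept (hB : (q.Aᵀ * q.A).PosDef) (hc : ConvexOn ℝ Set.univ q.f)
    (hmin : ∀ z, q.f xs ≤ q.f z) (hS : q.RunSetting par xs P D L ω θ ε) {x v : Fin d → ℝ}
    {A : ℝ} (hA : 0 ≤ A) (hx : A * ‖q.emb (x - xs)‖ ≤ A * (11 / 5 * D))
    (hv : ‖q.emb (v - xs)‖ ≤ D) {ρ : ℝ} (h0 : par.rho ≤ ρ)
    (hρ : |ρ - q.zetaHat par x v A ρ| ≤ searchTol par P) :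
    (∀ u, |q.d1 (q.trialPoint par x v A ρ) u + ρ * q.ipB (q.trialStep par x v A ρ) u|
      ≤ 1 / 2 * ρ * ‖q.emb (q.trialStep par x v A ρ)‖ * ‖q.emb u‖) ∧
    8 / 9 * ρ ≤ q.zetaHat par x v A ρ := by
  have hr := hS.rho_pos
  have hD := hS.D_pos
  have hρ0 : 0 < ρ := hr.trans_le h0
  have hδ := hS.tol
  have hy := norm_mix_sub_le hA hρ0 (by linarith : D ≤ 11 / 5 * D) hx hv
  obtain ⟨g1, -⟩ := hS.aux hB hc hmin hy
  change ∀ u, |q.dmodel _ (q.trialStep par x v A ρ) u| ≤ _ at g1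
  have e : mix x v A (stepA A ρ) + q.trialStep par x v A ρ = q.trialPoint par x v A ρ := by
    rw [trialStep, add_sub_cancel]
  obtain ⟨k1, k2⟩ := abs_le.1 hρ
  refine ⟨?_, by linarith⟩
  intro u
  have g2 := g1 u
  rw [dmodel_eq, e] at g2
  rw [zetaHat] at k1 k2
  have hη := resBound_nonneg hS
  set h := q.trialStep par x v A ρ
  set η := resBound L ω
  have ha := norm_nonneg (q.emb h)
  -- The relative error 1/2 is shared out: 1/4 for the solver, 1/16 for the search tolerance and
  -- (1/6)(17/16) for the Taylor term.
  have hη2 : η ≤ 1 / 4 * ρ * ‖q.emb h‖ := by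
    refine le_of_pow_le_pow_left₀ (n := 2) (by norm_num) (by positivity) ?_
    have e1 := hS.res_le_rho
    have e2 : par.rho ^ 3 ≤ ρ ^ 3 := pow_le_pow_left₀ hr.le h0 3
    have e3 : ρ ^ 2 * (15 / 16 * ρ) ≤ ρ ^ 2 * ‖q.emb h‖ ^ 2 := by
      apply mul_le_mul_of_nonneg_left _ (by positivity)
      linarith
    have e4 : 0 < ρ ^ 3 := by positivity
    nlinarith
  have g3 := abs_af_le (q := q) h h h u
  have g4 := abs_ipB_le (q := q) h u
  have g5 : |(ρ - ‖q.emb h‖ ^ 2) * q.ipB h u| ≤ ρ / 16 * (‖q.emb h‖ * ‖q.emb u‖) := by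
    rw [abs_mul]
    refine mul_le_mul ?_ g4 (abs_nonneg _) (by positivity)
    rw [abs_le]; constructor <;> linarith
  have hu := norm_nonneg (q.emb u)
  have g6 : η * ‖q.emb u‖ ≤ 1 / 4 * ρ * ‖q.emb h‖ * ‖q.emb u‖ := by gcongr
  have g7 : ‖q.emb h‖ * ‖q.emb h‖ * ‖q.emb h‖ * ‖q.emb u‖
      ≤ 17 / 16 * ρ * (‖q.emb h‖ * ‖q.emb u‖) := by
    calc _ = ‖q.emb h‖ ^ 2 * (‖q.emb h‖ * ‖q.emb u‖) := by ring
      _ ≤ _ := by gcongr; linarith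
  have g8 : 0 ≤ ρ * (‖q.emb h‖ * ‖q.emb u‖) := by positivity
  have e9 : q.d1 (q.trialPoint par x v A ρ) u + ρ * q.ipB h u
      = (q.d1 (q.trialPoint par x v A ρ) u + ‖q.emb h‖ ^ 2 * q.ipB h u - 1 / 6 * q.af h h h u)
        + (ρ - ‖q.emb h‖ ^ 2) * q.ipB h u + 1 / 6 * q.af h h h u := by ring
  rw [e9]
  rw [abs_le] at *
  constructor <;> linarith

/-- A trial point with a short step is nearly optimal. -/
theorem RunSetting.early_return (hB : (q.Aᵀ * q.A).PosDef) (hc : ConvexOn ℝ Set.univ q.f)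
    (hmin : ∀ z, q.f xs ≤ q.f z) (hS : q.RunSetting par xs P D L ω θ ε) {x v : Fin d → ℝ}
    {A : ℝ} (hA : 0 ≤ A) (hx : A * ‖q.emb (x - xs)‖ ≤ A * (11 / 5 * D))
    (hv : ‖q.emb (v - xs)‖ ≤ D)
    (hr : q.zetaHat par x v A par.rho ≤ 17 / 16 * par.rho) :
    q.f (q.trialPoint par x v A par.rho) - q.f xs ≤ ε := by
  have hr0 := hS.rho_pos
  have hD := hS.D_pos
  have hy := norm_mix_sub_le hA hr0 (by linarith : D ≤ 11 / 5 * D) hx hv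
  obtain ⟨g1, g2⟩ := hS.aux hB hc hmin hy
  change ∀ u, |q.dmodel _ (q.trialStep par x v A par.rho) u| ≤ _ at g1
  change ‖q.emb (q.trialStep par x v A par.rho)‖ ≤ _ at g2
  have e : mix x v A (stepA A par.rho) + q.trialStep par x v A par.rho
      = q.trialPoint par x v A par.rho := by rw [trialStep, add_sub_cancel]
  set x' := q.trialPoint par x v A par.rho
  refine (sub_le_d1 hc xs x').trans ?_
  have g3 := (abs_le.1 (g1 (x' - xs))).2
  rw [dmodel_eq, e] at g3
  rw [zetaHat] at hr
  set h := q.trialStep par x v A par.rho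
  have hη := resBound_nonneg hS
  set η := resBound L ω
  have hσ : 0 < √par.rho := Real.sqrt_pos.2 hr0
  have hσ2 : √par.rho ^ 2 = par.rho := Real.sq_sqrt hr0.le
  have hres := hS.res_le_rho
  have hearly := hS.early
  rw [← hσ2] at hr hres
  set σ := √par.rho
  have ha := norm_nonneg (q.emb h)
  have h1 : ‖q.emb h‖ ≤ 17 / 16 * σ := by
    refine le_of_pow_le_pow_left₀ (n := 2) (by norm_num) (by positivity) ?_
    nlinarith
  have h2 : ‖q.emb h‖ ^ 3 ≤ (17 / 16 * σ) ^ 3 := pow_le_pow_left₀ ha h1 3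
  have hσ3 : 0 < σ ^ 3 := by positivity
  have h3 : η ≤ 1 / 4 * σ ^ 3 := by
    refine le_of_pow_le_pow_left₀ (n := 2) (by norm_num) (by positivity) ?_
    nlinarith [sq_nonneg (σ ^ 3)]
  have h4 : ‖q.emb (x' - xs)‖ ≤ 539 / 100 * D := by
    rw [← e, add_sub_right_comm, map_add]
    exact (norm_add_le _ _).trans (by linarith)
  have g4 := (abs_le.1 (abs_ipB_le (q := q) h (x' - xs))).1
  have g5 := (abs_le.1 (abs_af_le (q := q) h h h (x' - xs))).2
  have hu := norm_nonneg (q.emb (x' - xs))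
  set u := ‖q.emb (x' - xs)‖
  have g6 := mul_le_mul_of_nonneg_left g4 (sq_nonneg ‖q.emb h‖)
  have g7 : q.d1 x' (x' - xs) ≤ (η + 7 / 6 * ‖q.emb h‖ ^ 3) * u := by nlinarith
  have g8 : (η + 7 / 6 * ‖q.emb h‖ ^ 3) * u ≤ (2 * σ ^ 3) * (539 / 100 * D) :=
    mul_le_mul (by nlinarith) h4 hu (by positivity)
  have g9 : 0 < σ ^ 3 * D := by positivity
  linarith

theorem RunSetting.upper_end (hB : (q.Aᵀ * q.A).PosDef) (hc : ConvexOn ℝ Set.univ q.f)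
    (hmin : ∀ z, q.f xs ≤ q.f z) (hS : q.RunSetting par xs P D L ω θ ε) {x v : Fin d → ℝ}
    {A : ℝ} (hA : 0 ≤ A) (hx : A * ‖q.emb (x - xs)‖ ≤ A * (11 / 5 * D))
    (hv : ‖q.emb (v - xs)‖ ≤ D) :
    q.zetaHat par x v A P ≤ P - searchTol par P := by
  have hD := hS.D_pos
  have hP := hS.le_P
  have hy := norm_mix_sub_le hA (lt_of_lt_of_le (by positivity) hP)
    (by linarith : D ≤ 11 / 5 * D) hx hv
  obtain ⟨-, g2⟩ := hS.aux hB hc hmin hy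
  change ‖q.emb (q.trialStep par x v A P)‖ ≤ _ at g2
  have h1 : ‖q.emb (q.trialStep par x v A P)‖ ^ 2 ≤ (319 / 100 * D) ^ 2 :=
    pow_le_pow_left₀ (norm_nonneg _) g2 2
  have h2 := hS.tol
  have h3 := hS.rho_le
  rw [zetaHat]
  nlinarith [sq_nonneg D]

end

/-! ### The loop invariant and the rate of one run -/

/-- The invariant of the main loop after `k` iterations. -/
def RunInv (q : Quartic d n) (xs x₀ : Fin d → ℝ) (κ : ℝ) (k : ℕ) (x : Fin d → ℝ) (A : ℝ)
    (s : Fin d → ℝ) : Prop :=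
  -- E is the energy dissipated so far, e bounds the drift of the iterate beyond the initial
  -- distance, and the last clause is `fourth_root_growth` summed up.
  0 ≤ A ∧ ∃ E e : ℝ, 0 ≤ E ∧ 0 ≤ e ∧ 3 * e ^ 2 ≤ 8 * E ∧
    A * (q.f x - q.f xs) + 1 / 2 * ‖q.emb (x₀ - q.B⁻¹ *ᵥ s - xs)‖ ^ 2 + E
      ≤ 1 / 2 * ‖q.emb (x₀ - xs)‖ ^ 2 ∧
    A * ‖q.emb (x - xs)‖ ≤ A * (‖q.emb (x₀ - xs)‖ + e) ∧
    5 / 4 * κ * k - 192 * κ ^ 5 * E ≤ A ^ ((1 : ℝ) / 4)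

theorem RunInv.init (xs x₀ : Fin d → ℝ) (κ : ℝ) : q.RunInv xs x₀ κ 0 x₀ 0 0 := by
  refine ⟨le_rfl, 0, 0, le_rfl, le_rfl, by norm_num, by simp, by simp, by simp⟩

/-- The energy is at most D²/2, so e² ≤ 4D²/3 ≤ (6D/5)²: this is the origin of the radius 11D/5. -/
theorem RunInv.bounds {xs x₀ x s : Fin d → ℝ} {κ A : ℝ} {k : ℕ} (hmin : ∀ z, q.f xs ≤ q.f z)
    (h : q.RunInv xs x₀ κ k x A s) :
    0 ≤ A ∧ A * ‖q.emb (x - xs)‖ ≤ A * (11 / 5 * ‖q.emb (x₀ - xs)‖) ∧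
      ‖q.emb (x₀ - q.B⁻¹ *ᵥ s - xs)‖ ≤ ‖q.emb (x₀ - xs)‖ := by
  obtain ⟨hA, E, e, hE, he, heE, h1, h2, -⟩ := h
  have h3 : 0 ≤ A * (q.f x - q.f xs) := mul_nonneg hA (sub_nonneg.2 (hmin x))
  have hD := norm_nonneg (q.emb (x₀ - xs))
  refine ⟨hA, h2.trans (mul_le_mul_of_nonneg_left ?_ hA), ?_⟩
  · have : e ≤ 6 / 5 * ‖q.emb (x₀ - xs)‖ := by
      refine le_of_pow_le_pow_left₀ (n := 2) (by norm_num) (by positivity) ?_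
      nlinarith [sq_nonneg ‖q.emb (x₀ - q.B⁻¹ *ᵥ s - xs)‖]
    linarith
  · refine le_of_pow_le_pow_left₀ (n := 2) (by norm_num) hD ?_
    linarith

/-- With g = ρal one has g² = (A + a)ρl², the energy of the step up to a constant, and
Cauchy–Schwarz gives (Ae + ag)² ≤ (A + a)²(e² + g²). Drifts thus add in squares, and the bound does
not grow with the number of iterations. -/
theorem norm_step_sub_le {x v x' xs : Fin d → ℝ} {A a ρ e D : ℝ} (hA : 0 ≤ A) (ha : 0 < a)
    (hg : 0 ≤ (A + a) * ρ * ‖q.emb (x' - mix x v A a)‖ ^ 2) (hsq : ρ * a ^ 2 = A + a)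
    (hx : A * ‖q.emb (x - xs)‖ ≤ A * (D + e)) (hv : ‖q.emb (v - xs)‖ ≤ D) :
    (A + a) * ‖q.emb (x' - xs)‖ ≤ (A + a) * (D
      + √(e ^ 2 + (A + a) * ρ * ‖q.emb (x' - mix x v A a)‖ ^ 2)) := by
  have hA' : 0 < A + a := by linarith
  set l := ‖q.emb (x' - mix x v A a)‖
  have hl0 : 0 ≤ l := norm_nonneg _
  have ey : (A + a) • (x' - xs)
      = A • (x - xs) + a • (v - xs) + (A + a) • (x' - mix x v A a) := by
    rw [smul_sub (A + a) x' (mix x v A a), smul_mix hA']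
    module
  have k1 : (A + a) * ‖q.emb (x' - xs)‖
      ≤ A * ‖q.emb (x - xs)‖ + a * ‖q.emb (v - xs)‖ + (A + a) * l := by
    calc (A + a) * ‖q.emb (x' - xs)‖ = ‖q.emb ((A + a) • (x' - xs))‖ := by
          rw [map_smul, norm_smul, Real.norm_eq_abs, abs_of_pos hA']
      _ = ‖A • q.emb (x - xs) + a • q.emb (v - xs) + (A + a) • q.emb (x' - mix x v A a)‖ := by
          rw [ey, map_add, map_add, map_smul, map_smul, map_smul]
      _ ≤ ‖A • q.emb (x - xs)‖ + ‖a • q.emb (v - xs)‖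
          + ‖(A + a) • q.emb (x' - mix x v A a)‖ := norm_add₃_le
      _ = _ := by
          rw [norm_smul, norm_smul, norm_smul, Real.norm_eq_abs, Real.norm_eq_abs,
            Real.norm_eq_abs, abs_of_nonneg hA, abs_of_pos ha, abs_of_pos hA']
  have k2 : a * ‖q.emb (v - xs)‖ ≤ a * D := by gcongr
  have k3 : A * e + (A + a) * l ≤ (A + a) * √(e ^ 2 + (A + a) * ρ * l ^ 2) := by
    refine le_of_pow_le_pow_left₀ (n := 2) (by norm_num) (by positivity) ?_
    have t1 : (A + a) * ρ * l ^ 2 = (ρ * a * l) ^ 2 := by rw [← hsq]; ring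
    have t2 : (A + a) * l = a * (ρ * a * l) := by rw [← hsq]; ring
    rw [mul_pow, Real.sq_sqrt (by positivity), t1, t2]
    set g := ρ * a * l
    calc (A * e + a * g) ^ 2
        ≤ (A * e + a * g) ^ 2 + (A * g - a * e) ^ 2 := le_add_of_nonneg_right (sq_nonneg _)
      _ = (A ^ 2 + a ^ 2) * (e ^ 2 + g ^ 2) := by ring
      _ ≤ (A + a) ^ 2 * (e ^ 2 + g ^ 2) := by
        apply mul_le_mul_of_nonneg_right _ (by positivity)
        have := mul_nonneg hA ha.le
        linarith [show (A + a) ^ 2 = A ^ 2 + a ^ 2 + 2 * (A * a) by ring]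
  linarith

theorem RunInv.step (hB : (q.Aᵀ * q.A).PosDef) (hc : ConvexOn ℝ Set.univ q.f)
    {xs x₀ x s x' : Fin d → ℝ} {κ A ρ : ℝ} {k : ℕ} (hmin : ∀ z, q.f xs ≤ q.f z) (hκ : 0 < κ)
    (h : q.RunInv xs x₀ κ k x A s) (hρ : 0 < ρ)
    (hg : ∀ u, |q.d1 x' u + ρ * q.ipB (x' - mix x (x₀ - q.B⁻¹ *ᵥ s) A (stepA A ρ)) u|
      ≤ 1 / 2 * ρ * ‖q.emb (x' - mix x (x₀ - q.B⁻¹ *ᵥ s) A (stepA A ρ))‖ * ‖q.emb u‖)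
    (hlen : 8 / 9 * ρ ≤ ‖q.emb (x' - mix x (x₀ - q.B⁻¹ *ᵥ s) A (stepA A ρ))‖ ^ 2) :
    q.RunInv xs x₀ κ (k + 1) x' (A + stepA A ρ) (s + stepA A ρ • gradVec q.f x') := by
  obtain ⟨-, -, hvD⟩ := h.bounds hmin
  obtain ⟨hA, E, e, hE, he, heE, h1, h2, h3⟩ := h
  have hstep := accelerated_step hB hc (xs := xs) hA hρ hg
  have ha := stepA_pos (A := A) hρ
  have hsq := stepA_sq hA hρ
  have hv' : x₀ - q.B⁻¹ *ᵥ (s + stepA A ρ • gradVec q.f x')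
      = x₀ - q.B⁻¹ *ᵥ s - stepA A ρ • (q.B⁻¹ *ᵥ gradVec q.f x') := by
    rw [Matrix.mulVec_add, Matrix.mulVec_smul]; abel
  set v := x₀ - q.B⁻¹ *ᵥ s
  -- The length condition ρ ≤ 9‖h‖²/8 turns (A + a)ρ² into at most three times the dissipation 3/8
  -- (A + a)ρ‖h‖².
  have hgrow := fourth_root_growth (e := 3 / 8 * ((A + stepA A ρ) * ρ
    * ‖q.emb (x' - mix x v A (stepA A ρ))‖ ^ 2)) hA hρ hκ (by
      have : (A + stepA A ρ) * ρ * (8 / 9 * ρ)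
        ≤ (A + stepA A ρ) * ρ * ‖q.emb (x' - mix x v A (stepA A ρ))‖ ^ 2 := by gcongr
      linarith)
  set a := stepA A ρ
  have hA' : 0 < A + a := by linarith
  set D := ‖q.emb (x₀ - xs)‖
  set l := ‖q.emb (x' - mix x v A a)‖ with hl
  have hl0 : 0 ≤ l := norm_nonneg _
  have hg0 : 0 ≤ (A + a) * ρ * l ^ 2 := by positivity
  set e' := √(e ^ 2 + (A + a) * ρ * l ^ 2) with he'
  have he'2 : e' ^ 2 = e ^ 2 + (A + a) * ρ * l ^ 2 := Real.sq_sqrt (by positivity)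
  have he'0 : 0 ≤ e' := Real.sqrt_nonneg _
  refine ⟨hA'.le, E + 3 / 8 * ((A + a) * ρ * l ^ 2), e', by positivity, he'0, by
    rw [he'2]; linarith, ?_, ?_, ?_⟩
  · rw [hv']; linarith
  · have k1 := norm_step_sub_le (x' := x') hA ha hg0 hsq h2 hvD
    exact k1.trans_eq (by rw [he'])
  · push_cast
    linarith

theorem fastLoop_succ_val (par : Params) (P Gc : ℝ) (x₀ x s : Fin d → ℝ) (A : ℝ) (m : ℕ) :
    (q.fastLoop par P Gc x₀ (m + 1) x A s).val =
      if par.rho > (1 + min (3 * P * par.rho / (32 * Gc)) (1 / 2))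
          * q.zetaHat par x (x₀ - q.B⁻¹ *ᵥ s) A par.rho then
        q.trialPoint par x (x₀ - q.B⁻¹ *ᵥ s) A par.rho
      else if par.rho > q.zetaHat par x (x₀ - q.B⁻¹ *ᵥ s) A par.rho
          - (6 * √P + 5) * par.epsAam ^ ((1 : ℝ) / 4) then
        q.trialPoint par x (x₀ - q.B⁻¹ *ᵥ s) A par.rho
      else
        let r := (q.rhoSearch par P x (x₀ - q.B⁻¹ *ᵥ s) A par.M par.rho P (x, 0)).val
        (q.fastLoop par P Gc x₀ m r.2.1 (A + r.2.2) (s + r.2.2 • gradVec q.f r.2.1)).val := by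
  have hz : q.zetaHat par x (x₀ - q.B⁻¹ *ᵥ s) A par.rho
      = (q.evalNormSqB (q.trialStep par x (x₀ - q.B⁻¹ *ᵥ s) A par.rho)).val :=
    (q.evalNormSqB_val _).symm
  rw [hz, fastLoop]
  simp only [Timed.bind_val]
  by_cases h1 : par.rho > (1 + min (3 * P * par.rho / (32 * Gc)) (1 / 2))
      * (q.evalNormSqB (q.trialStep par x (x₀ - q.B⁻¹ *ᵥ s) A par.rho)).val
  · rw [if_pos h1]
    exact (congrArg Timed.val (if_pos h1)).trans rfl
  · rw [if_neg h1]
    refine (congrArg Timed.val (if_neg h1)).trans ?_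
    by_cases h2 : par.rho > (q.evalNormSqB (q.trialStep par x (x₀ - q.B⁻¹ *ᵥ s) A par.rho)).val
        - (6 * √P + 5) * par.epsAam ^ ((1 : ℝ) / 4)
    · rw [if_pos h2]
      exact (congrArg Timed.val (if_pos h2)).trans rfl
    · rw [if_neg h2]
      refine (congrArg Timed.val (if_neg h2)).trans ?_
      simp only [Timed.bind_val, gradient_val]
      rfl

theorem fastLoop_spec (hB : (q.Aᵀ * q.A).PosDef) (hc : ConvexOn ℝ Set.univ q.f)
    {par : Params} {xs x₀ : Fin d → ℝ} {P Gc L ω θ ε κ : ℝ} (hmin : ∀ z, q.f xs ≤ q.f z)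
    (hS : q.RunSetting par xs P ‖q.emb (x₀ - xs)‖ L ω θ ε) (hG : 0 ≤ Gc) (hκ : 0 < κ)
    (m k : ℕ) (x s : Fin d → ℝ) (A : ℝ) (h : q.RunInv xs x₀ κ k x A s) :
    q.f (q.fastLoop par P Gc x₀ m x A s).val - q.f xs ≤ ε ∨
      ∃ A' s', q.RunInv xs x₀ κ (k + m) (q.fastLoop par P Gc x₀ m x A s).val A' s' := by
  induction m generalizing k x s A with
  | zero => exact Or.inr ⟨A, s, h⟩
  | succ m ih =>
    obtain ⟨hA, hx, hv⟩ := h.bounds hmin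
    have hr := hS.rho_pos
    have hD := hS.D_pos
    have hP : 0 < P := lt_of_lt_of_le (by positivity) hS.le_P
    rw [fastLoop_succ_val]
    have hz : 0 ≤ q.zetaHat par x (x₀ - q.B⁻¹ *ᵥ s) A par.rho := by
      rw [zetaHat]; positivity
    split_ifs with h1 h2
    · left
      refine hS.early_return hB hc hmin hA hx hv ?_
      have : 0 ≤ min (3 * P * par.rho / (32 * Gc)) (1 / 2) := by positivity
      nlinarith
    · left
      refine hS.early_return hB hc hmin hA hx hv ?_
      have := hS.tol_le
      linarith
    · have htol := searchTol_le P hS.eps_pos hS.eps_lt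
      have hrP : par.rho ≤ P := hS.rho_le.trans (by nlinarith [hS.le_P])
      obtain ⟨ρ, hρ0, hval, hρ⟩ := rhoSearch_spec (q := q) hS.θ_lt
        (fun ρ ρ' a b c => hS.zeta_cont hB hc hmin hA hx hv a b c)
        par.M par.rho P (x, 0) le_rfl hrP (by linarith) (hS.upper_end hB hc hmin hA hx hv)
        (by linarith [hS.M_large])
      obtain ⟨g1, g2⟩ := hS.accept hB hc hmin hA hx hv hρ0 hρ
      have hinv := h.step hB hc hmin hκ (hr.trans_le hρ0) g1 g2
      rw [hval]
      have e : k + (m + 1) = k + 1 + m := by ring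
      rw [e]
      exact ih (k + 1) _ _ _ hinv

/-- A run either reaches accuracy `ε` or has the rate `k⁻⁵`. -/
theorem fastQuarticRun_spec (hB : (q.Aᵀ * q.A).PosDef) (hc : ConvexOn ℝ Set.univ q.f)
    {par : Params} {xs x₀ : Fin d → ℝ} {P Gc L ω θ ε : ℝ} (hmin : ∀ z, q.f xs ≤ q.f z)
    (hS : q.RunSetting par xs P ‖q.emb (x₀ - xs)‖ L ω θ ε) (hG : 0 ≤ Gc) :
    q.f (q.fastQuarticRun par P Gc x₀).val - q.f xs ≤ ε ∨
      ((par.N : ℝ) + 1) ^ 5 * (q.f (q.fastQuarticRun par P Gc x₀).val - q.f xs)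
        ≤ 192 * ‖q.emb (x₀ - xs)‖ ^ 4 := by
  have hD := hS.D_pos
  set D := ‖q.emb (x₀ - xs)‖
  set N : ℝ := (par.N : ℝ) + 1 with hN
  have hN0 : 0 < N := by positivity
  -- With this κ the loss 192κ⁵E is at most κN/4, as E ≤ D²/2; this leaves A^(1/4) ≥ κN, that is, A
  -- ≥ N⁵/(384D²).
  set κ := (N / (384 * D ^ 2)) ^ ((1 : ℝ) / 4) with hκ
  have hκ0 : 0 < κ := Real.rpow_pos_of_pos (by positivity) _
  have hκ4 : κ ^ 4 = N / (384 * D ^ 2) := by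
    rw [hκ, ← Real.rpow_natCast, ← Real.rpow_mul (by positivity)]; norm_num
  rcases fastLoop_spec hB hc hmin hS hG hκ0 (par.N + 1) 0 x₀ 0 0 (RunInv.init xs x₀ κ) with
    h | ⟨A, s, hA, E, e, hE, -, -, h1, -, h3⟩
  · exact Or.inl h
  · right
    change A * (q.f (q.fastQuarticRun par P Gc x₀).val - q.f xs) + _ + E ≤ _ at h1
    have hgap := sub_nonneg.2 (hmin (q.fastQuarticRun par P Gc x₀).val)
    set g := q.f (q.fastQuarticRun par P Gc x₀).val - q.f xs
    have hAg : 0 ≤ A * g := mul_nonneg hA hgap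
    have hE' : E ≤ 1 / 2 * D ^ 2 := by
      nlinarith [sq_nonneg ‖q.emb (x₀ - q.B⁻¹ *ᵥ s - xs)‖]
    have hAg' : A * g ≤ 1 / 2 * D ^ 2 := by
      nlinarith [sq_nonneg ‖q.emb (x₀ - q.B⁻¹ *ᵥ s - xs)‖]
    have h4 : κ * N ≤ A ^ ((1 : ℝ) / 4) := by
      refine le_trans ?_ h3
      push_cast
      rw [zero_add, ← hN]
      have e1 : 192 * κ ^ 5 * E ≤ 192 * κ ^ 5 * (1 / 2 * D ^ 2) := by gcongr
      have e2 : 192 * κ ^ 5 * (1 / 2 * D ^ 2) = κ * N / 4 := by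
        rw [show κ ^ 5 = κ ^ 4 * κ by ring, hκ4]; field_simp; norm_num
      linarith
    have h5 : κ ^ 4 * N ^ 4 ≤ A := by
      have := pow_le_pow_left₀ (by positivity) h4 4
      rw [mul_pow, ← Real.rpow_natCast (A ^ ((1 : ℝ) / 4)), ← Real.rpow_mul hA] at this
      norm_num at this
      exact this
    rw [hκ4] at h5
    have h6 : N ^ 5 ≤ A * (384 * D ^ 2) := by
      rw [div_mul_eq_mul_div, div_le_iff₀ (by positivity)] at h5
      calc N ^ 5 = N * N ^ 4 := by ring
        _ ≤ _ := h5
    calc N ^ 5 * g ≤ A * (384 * D ^ 2) * g := by gcongr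
      _ = (A * g) * (384 * D ^ 2) := by ring
      _ ≤ (1 / 2 * D ^ 2) * (384 * D ^ 2) := by gcongr
      _ = 192 * D ^ 4 := by ring

end Quartic

/-! ### Cost bounds -/

/-- Componentwise bounds on a cost. -/
def Cost.Within (c : Cost) (o r s : ℕ) : Prop := c.ops ≤ o ∧ c.oracle ≤ r ∧ c.solves ≤ s

theorem Cost.Within.add {a b : Cost} {o r s o' r' s' : ℕ} (ha : a.Within o r s)
    (hb : b.Within o' r' s') : (a + b).Within (o + o') (r + r') (s + s') :=
  ⟨add_le_add ha.1 hb.1, add_le_add ha.2.1 hb.2.1, add_le_add ha.2.2 hb.2.2⟩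

theorem Cost.Within.mono {a : Cost} {o r s o' r' s' : ℕ} (ha : a.Within o r s)
    (ho : o ≤ o') (hr : r ≤ r') (hs : s ≤ s') : a.Within o' r' s' :=
  ⟨ha.1.trans ho, ha.2.1.trans hr, ha.2.2.trans hs⟩

theorem Cost.within_mk (o r s : ℕ) : Cost.Within ⟨o, r, s⟩ o r s := ⟨le_rfl, le_rfl, le_rfl⟩

theorem Cost.within_zero (o r s : ℕ) : Cost.Within 0 o r s :=
  ⟨Nat.zero_le _, Nat.zero_le _, Nat.zero_le _⟩

/-- The number of calls of `ApproxAuxMin` times its number of inner steps, per run. -/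
def Params.work (par : Params) : ℕ :=
  (par.N + 1) * ((par.M + 1) * ((par.K + 1) * (par.J + 1)))

namespace Quartic

variable {d n : ℕ} {q : Quartic d n}

/-- Injectivity of A makes each column nonzero, so dense vector operations of cost d can be charged
to nnz. -/
theorem dim_le_nnz (hB : (q.Aᵀ * q.A).PosDef) : d ≤ q.nnz := by
  have h1 : ∀ j : Fin d, ∃ i, q.A i j ≠ 0 := by
    intro j
    by_contra h
    push Not at h
    have h2 : q.emb (Pi.single j 1) = q.emb 0 := by
      ext i
      rw [map_zero, emb_apply, Matrix.mulVec_single_one]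
      exact h i
    have h3 := congrFun (emb_injective hB h2) j
    simp at h3
  have h2 : (Finset.univ : Finset (Fin d)) ⊆
      (Finset.univ.filter fun e : Fin n × Fin d => q.A e.1 e.2 ≠ 0).image Prod.snd := by
    intro j _
    obtain ⟨i, hi⟩ := h1 j
    exact Finset.mem_image.2 ⟨(i, j), by simpa using hi, rfl⟩
  have h3 := (Finset.card_le_card h2).trans Finset.card_image_le
  rw [Finset.card_univ, Fintype.card_fin] at h3
  have h4 : q.nzA.length = (Finset.univ.filter fun e : Fin n × Fin d => q.A e.1 e.2 ≠ 0).card := by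
    rw [nzA, Finset.length_toList]
  rw [nnz]
  omega

theorem gradient_within (q : Quartic d n) (x : Fin d → ℝ) :
    (q.gradient x).cost.Within (9 * q.nnz) 1 0 := by
  rw [gradient_cost]
  refine (Cost.within_mk _ _ _).mono ?_ le_rfl le_rfl
  rw [nnz]; omega

theorem hessVec_within (q : Quartic d n) (y h : Fin d → ℝ) :
    (q.hessVec y h).cost.Within (15 * q.nnz) 1 0 := by
  rw [hessVec_cost]
  refine (Cost.within_mk _ _ _).mono ?_ le_rfl le_rfl
  rw [nnz]; omega

theorem thirdVec_within (q : Quartic d n) (y h : Fin d → ℝ) :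
    (q.thirdVec y h).cost.Within (9 * q.nnz) 1 0 := by
  rw [thirdVec_cost]
  refine (Cost.within_mk _ _ _).mono ?_ le_rfl le_rfl
  rw [nnz]; omega

theorem mulB_within (q : Quartic d n) (x : Fin d → ℝ) :
    (q.mulB x).cost.Within (4 * q.nnz) 0 0 := by
  rw [mulB_cost]
  refine (Cost.within_mk _ _ _).mono ?_ le_rfl le_rfl
  rw [nnz]; omega

theorem evalNormSqB_within (hd : d ≤ q.nnz) (x : Fin d → ℝ) :
    (q.evalNormSqB x).cost.Within (6 * q.nnz) 0 0 := by
  rw [evalNormSqB_cost]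
  refine (Cost.within_mk _ _ _).mono ?_ le_rfl le_rfl
  rw [nnz] at *; omega

theorem bisect_within (hd : d ≤ q.nnz) (h1 : 1 ≤ q.nnz) (y p : Fin d → ℝ) (J : ℕ) (lo hi : ℝ) :
    (q.bisect y p J lo hi).cost.Within (J * (9 * q.nnz)) 0 J := by
  induction J generalizing lo hi with
  | zero => exact Cost.within_zero _ _ _
  | succ J ih =>
    rw [bisect]
    simp only [Timed.bind_cost]
    refine ((Cost.within_mk 2 0 0).add ((Cost.within_mk 0 0 1).add ((evalNormSqB_within hd _).add
      ((Cost.within_mk 1 0 0).add (o' := J * (9 * q.nnz)) (r' := 0) (s' := J) ?_)))).mono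
      ?_ ?_ ?_
    · split_ifs <;> exact ih _ _
    · rw [add_one_mul J]; omega
    · omega
    · omega

theorem innerSolve_within (hd : d ≤ q.nnz) (h1 : 1 ≤ q.nnz) (J : ℕ) (y p : Fin d → ℝ) :
    (q.innerSolve J y p).cost.Within (4 * q.nnz + J * (9 * q.nnz)) 0 (J + 2) := by
  rw [innerSolve]
  simp only [Timed.bind_cost]
  refine ((Cost.within_mk 0 0 1).add ((Cost.within_mk (2 * d) 0 0).add ((Cost.within_mk 2 0 0).add
    ((bisect_within hd h1 _ _ _ _ _).add (Cost.within_mk 0 0 1))))).mono ?_ ?_ ?_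
  · omega
  · omega
  · omega

theorem auxLoop_within (hd : d ≤ q.nnz) (h1 : 1 ≤ q.nnz) (J : ℕ) (y g : Fin d → ℝ) (K : ℕ)
    (h : Fin d → ℝ) : (q.auxLoop J y g K h).cost.Within
      (K * (44 * q.nnz + J * (9 * q.nnz))) (K * 2) (K * (J + 2)) := by
  induction K generalizing h with
  | zero => exact Cost.within_zero _ _ _
  | succ K ih =>
    rw [auxLoop]
    simp only [Timed.bind_cost]
    refine ((hessVec_within q _ _).add ((thirdVec_within q _ _).add ((mulB_within q _).add
      ((Cost.within_mk (2 * d) 0 0).add ((Cost.within_mk (2 * d) 0 0).add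
      ((Cost.within_mk (2 * d) 0 0).add ((Cost.within_mk (2 * d + 4) 0 0).add
      ((innerSolve_within hd h1 _ _ _).add (ih _))))))))).mono ?_ ?_ ?_
    · rw [add_one_mul K]; omega
    · omega
    · rw [add_one_mul K]; omega

theorem approxAuxMin_within (hd : d ≤ q.nnz) (h1 : 1 ≤ q.nnz) (K J : ℕ) (y : Fin d → ℝ) :
    (q.approxAuxMin K J y).cost.Within (54 * ((K + 1) * (J + 1)) * q.nnz)
      (2 * ((K + 1) * (J + 1))) (2 * ((K + 1) * (J + 1))) := by
  rw [approxAuxMin]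
  simp only [Timed.bind_cost]
  refine ((gradient_within q _).add ((auxLoop_within hd h1 _ _ _ _ _).add
    (Cost.within_mk d 0 0))).mono ?_ ?_ ?_
  · have : 9 * q.nnz + (K * (44 * q.nnz + J * (9 * q.nnz)) + q.nnz)
        ≤ 54 * ((K + 1) * (J + 1)) * q.nnz := by ring_nf; omega
    omega
  · ring_nf; omega
  · ring_nf; omega

theorem rhoSearch_within (hd : d ≤ q.nnz) (h1 : 1 ≤ q.nnz) (par : Params) (P : ℝ)
    (x v : Fin d → ℝ) (A : ℝ) (M : ℕ) (lo hi : ℝ) (last : (Fin d → ℝ) × ℝ) :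
    (q.rhoSearch par P x v A M lo hi last).cost.Within
      (M * (88 * ((par.K + 1) * (par.J + 1)) * q.nnz)) (M * (2 * ((par.K + 1) * (par.J + 1))))
      (M * (2 * ((par.K + 1) * (par.J + 1)))) := by
  induction M generalizing lo hi last with
  | zero => exact Cost.within_zero _ _ _
  | succ M ih =>
    rw [rhoSearch]
    simp only [Timed.bind_cost]
    refine ((Cost.within_mk 8 0 0).add ((Cost.within_mk 2 0 0).add ((Cost.within_mk 7 0 0).add
      ((Cost.within_mk (3 * d + 3) 0 0).add ((approxAuxMin_within hd h1 _ _ _).add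
      ((Cost.within_mk d 0 0).add ((evalNormSqB_within hd _).add ((Cost.within_mk 4 0 0).add
      (o' := M * (88 * ((par.K + 1) * (par.J + 1)) * q.nnz))
      (r' := M * (2 * ((par.K + 1) * (par.J + 1))))
      (s' := M * (2 * ((par.K + 1) * (par.J + 1)))) ?_)))))))).mono ?_ ?_ ?_
    · split_ifs
      · exact ih _ _ _
      · exact ih _ _ _
      · exact Cost.within_zero _ _ _
    · have hU : q.nnz ≤ (par.K + 1) * (par.J + 1) * q.nnz :=
        Nat.le_mul_of_pos_left _ (by positivity)
      rw [add_one_mul M, mul_assoc 88, mul_assoc 54]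
      omega
    · rw [add_one_mul M]; omega
    · rw [add_one_mul M]; omega

theorem fastLoop_within (hd : d ≤ q.nnz) (h1 : 1 ≤ q.nnz) (par : Params) (P Gc : ℝ)
    (x₀ : Fin d → ℝ) (m : ℕ) (x : Fin d → ℝ) (A : ℝ) (s : Fin d → ℝ) :
    (q.fastLoop par P Gc x₀ m x A s).cost.Within
      (m * (103 * ((par.M + 1) * ((par.K + 1) * (par.J + 1))) * q.nnz))
      (m * (3 * ((par.M + 1) * ((par.K + 1) * (par.J + 1)))))
      (m * (3 * ((par.M + 1) * ((par.K + 1) * (par.J + 1))))) := by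
  induction m generalizing x A s with
  | zero => exact Cost.within_zero _ _ _
  | succ m ih =>
    rw [fastLoop]
    simp only [Timed.bind_cost]
    set U := (par.K + 1) * (par.J + 1) with hU
    have hU1 : 1 ≤ U := Nat.one_le_iff_ne_zero.2 (by positivity)
    refine ((Cost.within_mk 0 0 1).add ((Cost.within_mk d 0 0).add ((Cost.within_mk 7 0 0).add
      ((Cost.within_mk (3 * d + 3) 0 0).add ((approxAuxMin_within hd h1 _ _ _).add
      ((Cost.within_mk d 0 0).add ((evalNormSqB_within hd _).add ((Cost.within_mk 6 0 0).add
      ((Cost.within_mk 5 0 0).add ((Cost.within_mk 5 0 0).add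
      (o' := par.M * (88 * U * q.nnz) + (9 * q.nnz + (1 + (2 * d
        + m * (103 * ((par.M + 1) * U) * q.nnz)))))
      (r' := par.M * (2 * U) + (1 + (0 + (0 + m * (3 * ((par.M + 1) * U))))))
      (s' := par.M * (2 * U) + (0 + (0 + (0 + m * (3 * ((par.M + 1) * U)))))) ?_)))))))))).mono
      ?_ ?_ ?_
    · split_ifs
      · exact Cost.within_zero _ _ _
      · exact Cost.within_zero _ _ _
      · exact (rhoSearch_within hd h1 _ _ _ _ _ _ _ _ _).add ((gradient_within q _).add
          ((Cost.within_mk 1 0 0).add ((Cost.within_mk (2 * d) 0 0).add (ih _ _ _))))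
    · have e1 : q.nnz ≤ U * q.nnz := Nat.le_mul_of_pos_left _ hU1
      have e2 : par.M * (88 * U * q.nnz) = 88 * (par.M * (U * q.nnz)) := by ring
      have e3 : 103 * ((par.M + 1) * U) * q.nnz = 103 * (par.M * (U * q.nnz)) + 103 * (U * q.nnz) := by
        ring
      rw [add_one_mul m, e2]
      generalize m * (103 * ((par.M + 1) * U) * q.nnz) = R
      rw [e3, mul_assoc 54, ← hU]
      omega
    · have e2 : par.M * (2 * U) = 2 * (par.M * U) := by ring
      have e3 : 3 * ((par.M + 1) * U) = 3 * (par.M * U) + 3 * U := by ring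
      rw [add_one_mul m, e2]
      generalize m * (3 * ((par.M + 1) * U)) = R
      rw [e3]
      omega
    · have e2 : par.M * (2 * U) = 2 * (par.M * U) := by ring
      have e3 : 3 * ((par.M + 1) * U) = 3 * (par.M * U) + 3 * U := by ring
      rw [add_one_mul m, e2]
      generalize m * (3 * ((par.M + 1) * U)) = R
      rw [e3]
      omega

theorem fastQuartic_within (hd : d ≤ q.nnz) (h1 : 1 ≤ q.nnz) (par : Params)
    (P Gc : (Fin d → ℝ) → ℝ) (S : ℕ) (x₀ : Fin d → ℝ) :
    (q.fastQuartic par P Gc S x₀).cost.Within (103 * (S * par.work) * q.nnz)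
      (3 * (S * par.work)) (3 * (S * par.work)) := by
  induction S generalizing x₀ with
  | zero => exact Cost.within_zero _ _ _
  | succ S ih =>
    rw [fastQuartic]
    simp only [Timed.bind_cost]
    refine ((fastLoop_within hd h1 par _ _ _ _ _ _ _).add (ih _)).mono
      (le_of_eq ?_) (le_of_eq ?_) (le_of_eq ?_)
    all_goals rw [Params.work]; ring

end Quartic

namespace Quartic

variable {d n : ℕ} {q : Quartic d n}

/-! ### The level sets of the method -/

theorem mem_ballK {xs x₀ x : Fin d → ℝ} :
    x ∈ q.ballK xs x₀ ↔ ‖q.emb (x - x₀)‖ ≤ 2 * ‖q.emb (x₀ - xs)‖ := by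
  rw [ballK, Set.mem_ofPred_eq, normSqB_eq, normSqB_eq,
    ← pow_le_pow_iff_left₀ (norm_nonneg _) (by positivity) two_ne_zero, mul_pow]
  norm_num

theorem isCompact_norm_emb_le (hB : (q.Aᵀ * q.A).PosDef) (z : Fin d → ℝ) (R : ℝ) :
    IsCompact {x | ‖q.emb (x - z)‖ ≤ R} := by
  obtain ⟨k, hk0, hk⟩ := exists_norm_le hB
  refine Metric.isCompact_of_isClosed_isBounded
    (isClosed_le ((continuous_emb q).comp (continuous_id.sub continuous_const)).norm
      continuous_const) ?_
  refine (Metric.isBounded_closedBall (x := z) (r := k * R)).subset fun x hx => ?_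
  rw [Metric.mem_closedBall, dist_eq_norm]
  exact (hk _).trans (mul_le_mul_of_nonneg_left hx hk0.le)

theorem bddAbove_image_ballK (hB : (q.Aᵀ * q.A).PosDef) (xs x₀ : Fin d → ℝ) :
    BddAbove (q.f '' q.ballK xs x₀) := by
  have h : q.ballK xs x₀ = {x | ‖q.emb (x - x₀)‖ ≤ 2 * ‖q.emb (x₀ - xs)‖} :=
    Set.ext fun x => mem_ballK
  rw [h]
  exact (isCompact_norm_emb_le hB _ _).bddAbove_image (continuous_f q).continuousOn

theorem ballK_subset_levelL (hB : (q.Aᵀ * q.A).PosDef) (xs x₀ : Fin d → ℝ) :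
    q.ballK xs x₀ ⊆ q.levelL xs x₀ := fun x hx =>
  le_csSup (bddAbove_image_ballK hB xs x₀) ⟨x, hx, rfl⟩

theorem self_mem_levelL (hB : (q.Aᵀ * q.A).PosDef) (xs x₀ : Fin d → ℝ) :
    x₀ ∈ q.levelL xs x₀ :=
  ballK_subset_levelL hB xs x₀ (mem_ballK.2 (by rw [sub_self, map_zero, norm_zero]; positivity))

theorem isCompact_levelL (hB : (q.Aᵀ * q.A).PosDef) (hc : ConvexOn ℝ Set.univ q.f)
    {xs : Fin d → ℝ} (hmin : ∀ z, q.f xs ≤ q.f z) (x₀ : Fin d → ℝ) :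
    IsCompact (q.levelL xs x₀) := by
  set R := 72 * n * (q.maxF xs x₀ - q.f xs)
  refine (isCompact_norm_emb_le hB xs (R + 1)).of_isClosed_subset
    (isClosed_le (continuous_f q) continuous_const) fun x hx => ?_
  have h1 := norm_pow_four_le_of_min hc hmin x
  have h2 : ‖q.emb (x - xs)‖ ^ 4 ≤ R :=
    h1.trans (mul_le_mul_of_nonneg_left (sub_le_sub_right hx _) (by positivity))
  by_contra h3
  rw [Set.mem_ofPred_eq] at h3
  push Not at h3
  have h4 : 0 ≤ R := le_trans (by positivity) h2
  have h5 : ‖q.emb (x - xs)‖ ≤ ‖q.emb (x - xs)‖ ^ 4 :=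
    le_self_pow₀ (by linarith) (by norm_num)
  linarith

/-- Quartic growth makes the level set compact; without boundedness `sSup` would not bound the set.
-/
theorem bddAbove_paramP (hB : (q.Aᵀ * q.A).PosDef) (hc : ConvexOn ℝ Set.univ q.f)
    {xs : Fin d → ℝ} (hmin : ∀ z, q.f xs ≤ q.f z) (x₀ : Fin d → ℝ) :
    BddAbove {r | ∃ x ∈ q.levelL xs x₀, ∃ y ∈ q.levelL xs x₀, r = q.normSqB (x - y)} := by
  have h1 := isCompact_levelL hB hc hmin x₀
  have h2 : Continuous fun z : (Fin d → ℝ) × (Fin d → ℝ) => ‖q.emb (z.1 - z.2)‖ ^ 2 :=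
    ((continuous_emb q).comp (continuous_fst.sub continuous_snd)).norm.pow 2
  refine ((h1.prod h1).bddAbove_image h2.continuousOn).mono ?_
  rintro r ⟨x, hx, y, hy, rfl⟩
  exact ⟨(x, y), ⟨hx, hy⟩, (normSqB_eq ..).symm⟩

theorem continuous_gradVec (q : Quartic d n) : Continuous (gradVec q.f) := by
  refine continuous_pi fun i => ?_
  have h : (fun x => gradVec q.f x i) = fun x => q.d1 x (Pi.single i 1) := by
    funext x
    rw [← gradVec_dot, dotProduct_single_one]
  rw [h]
  exact (differentiable_d1 q _).continuous

theorem bddAbove_paramG (hB : (q.Aᵀ * q.A).PosDef) (hc : ConvexOn ℝ Set.univ q.f)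
    {xs : Fin d → ℝ} (hmin : ∀ z, q.f xs ≤ q.f z) (x₀ : Fin d → ℝ) :
    BddAbove {r | ∃ x ∈ q.levelL xs x₀, r = q.normSqBInv (gradVec q.f x)} := by
  have h2 : Continuous fun x => q.normSqBInv (gradVec q.f x) :=
    (continuous_gradVec q).dotProduct (Continuous.matrix_mulVec continuous_const
      (continuous_gradVec q))
  refine ((isCompact_levelL hB hc hmin x₀).bddAbove_image h2.continuousOn).mono ?_
  rintro r ⟨x, hx, rfl⟩
  exact ⟨x, hx, rfl⟩

theorem normSqBInv_eq (hB : (q.Aᵀ * q.A).PosDef) (g : Fin d → ℝ) :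
    q.normSqBInv g = ‖q.emb (q.B⁻¹ *ᵥ g)‖ ^ 2 := by
  rw [← ipB_self, B_inv hB]; rfl

theorem sq_norm_sub_le_paramP (hB : (q.Aᵀ * q.A).PosDef) (hc : ConvexOn ℝ Set.univ q.f)
    {xs : Fin d → ℝ} (hmin : ∀ z, q.f xs ≤ q.f z) {x₀ x y : Fin d → ℝ}
    (hx : x ∈ q.levelL xs x₀) (hy : y ∈ q.levelL xs x₀) :
    ‖q.emb (x - y)‖ ^ 2 ≤ q.paramP xs x₀ :=
  le_csSup (bddAbove_paramP hB hc hmin x₀) ⟨x, hx, y, hy, (normSqB_eq ..).symm⟩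

/-- The antipodal points x₀ ± 2(x₀ − xs) of the ball are four distances apart. -/
theorem sixteen_mul_sq_le_paramP (hB : (q.Aᵀ * q.A).PosDef) (hc : ConvexOn ℝ Set.univ q.f)
    {xs : Fin d → ℝ} (hmin : ∀ z, q.f xs ≤ q.f z) (x₀ : Fin d → ℝ) :
    16 * ‖q.emb (x₀ - xs)‖ ^ 2 ≤ q.paramP xs x₀ := by
  have h : ∀ s : ℝ, |s| = 2 → x₀ + s • (x₀ - xs) ∈ q.levelL xs x₀ := fun s hs =>
    ballK_subset_levelL hB xs x₀ (mem_ballK.2 (by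
      rw [add_sub_cancel_left, map_smul, norm_smul, Real.norm_eq_abs, hs]))
  have h1 := sq_norm_sub_le_paramP hB hc hmin (h 2 (by norm_num)) (h (-2) (by norm_num))
  have h2 : x₀ + (2 : ℝ) • (x₀ - xs) - (x₀ + (-2 : ℝ) • (x₀ - xs)) = (4 : ℝ) • (x₀ - xs) := by
    module
  rw [h2, map_smul, norm_smul, mul_pow] at h1
  rwa [Real.norm_eq_abs, show |(4 : ℝ)| ^ 2 = 16 by norm_num] at h1

theorem paramG_nonneg (hB : (q.Aᵀ * q.A).PosDef) (xs x₀ : Fin d → ℝ) : 0 ≤ q.paramG xs x₀ := by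
  refine Real.sSup_nonneg ?_
  rintro r ⟨x, -, rfl⟩
  rw [normSqBInv_eq hB]; positivity

theorem d1_le_of_mem_levelL (hB : (q.Aᵀ * q.A).PosDef) (hc : ConvexOn ℝ Set.univ q.f)
    {xs : Fin d → ℝ} (hmin : ∀ z, q.f xs ≤ q.f z) {x₀ x : Fin d → ℝ}
    (hx : x ∈ q.levelL xs x₀) (u : Fin d → ℝ) :
    q.d1 x u ≤ √(q.paramG xs x₀) * ‖q.emb u‖ := by
  have h1 : q.normSqBInv (gradVec q.f x) ≤ q.paramG xs x₀ :=
    le_csSup (bddAbove_paramG hB hc hmin x₀) ⟨x, hx, rfl⟩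
  rw [normSqBInv_eq hB] at h1
  rw [← gradVec_dot, ← B_inv hB]
  exact (le_abs_self _).trans ((abs_ipB_le _ _).trans
    (mul_le_mul_of_nonneg_right (Real.le_sqrt_of_sq_le h1) (norm_nonneg _)))

theorem sub_le_of_mem_levelL (hB : (q.Aᵀ * q.A).PosDef) (hc : ConvexOn ℝ Set.univ q.f)
    {xs : Fin d → ℝ} (hmin : ∀ z, q.f xs ≤ q.f z) {x₀ x : Fin d → ℝ}
    (hx : x ∈ q.levelL xs x₀) :
    q.f x - q.f xs ≤ √(q.paramG xs x₀) * ‖q.emb (x - xs)‖ :=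
  (sub_le_d1 hc xs x).trans (d1_le_of_mem_levelL hB hc hmin hx _)

/-- Curvature at the minimizer. -/
theorem hessLe_minimizer (hB : (q.Aᵀ * q.A).PosDef) (hc : ConvexOn ℝ Set.univ q.f)
    {xs : Fin d → ℝ} (hmin : ∀ z, q.f xs ≤ q.f z) {x₀ : Fin d → ℝ}
    (hD : 0 < ‖q.emb (x₀ - xs)‖) :
    q.HessLe xs (6 * √(q.paramG xs x₀) / ‖q.emb (x₀ - xs)‖) := by
  intro w
  rcases eq_or_ne w 0 with rfl | hw
  · simp
  have hw0 : 0 < ‖q.emb w‖ := lt_of_le_of_ne (norm_nonneg _) fun h => hw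
    (emb_injective hB (by rw [map_zero, norm_eq_zero.1 h.symm]))
  set D := ‖q.emb (x₀ - xs)‖
  -- Scaling w to length D keeps xs + s w inside the ball around x₀, where f exceeds its minimum by
  -- at most √𝒢 D; `d2_le_growth` turns this into curvature.
  set s := D / ‖q.emb w‖ with hs
  have hs0 : 0 < s := div_pos hD hw0
  have hsw : s * ‖q.emb w‖ = D := div_mul_cancel₀ _ hw0.ne'
  have hn : ‖q.emb (s • w)‖ = D := by
    rw [map_smul, norm_smul, Real.norm_eq_abs, abs_of_pos hs0, hsw]
  have hmem : xs + s • w ∈ q.levelL xs x₀ := by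
    refine ballK_subset_levelL hB xs x₀ (mem_ballK.2 ?_)
    have e : xs + s • w - x₀ = s • w - (x₀ - xs) := by abel
    rw [e, map_sub]
    refine (norm_sub_le _ _).trans ?_
    rw [hn]; linarith
  have h1 := d2_le_growth hc xs (s • w)
  have h2 := sub_le_of_mem_levelL hB hc hmin hmem
  rw [d1_eq_zero_of_min hmin, sub_zero] at h1
  rw [add_sub_cancel_left, hn] at h2
  have h3 : q.d2 xs (s • w) (s • w) = s ^ 2 * q.d2 xs w w := by
    simp only [map_smul, LinearMap.smul_apply, smul_eq_mul]; ring
  rw [h3] at h1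
  have h4 : s ^ 2 * q.d2 xs w w
      ≤ s ^ 2 * (6 * √(q.paramG xs x₀) / D * ‖q.emb w‖ ^ 2) := by
    have e : s ^ 2 * (6 * √(q.paramG xs x₀) / D * ‖q.emb w‖ ^ 2)
        = 6 * (√(q.paramG xs x₀) * D) := by
      have : s ^ 2 * (6 * √(q.paramG xs x₀) / D * ‖q.emb w‖ ^ 2)
        = 6 * √(q.paramG xs x₀) / D * (s * ‖q.emb w‖) ^ 2 := by ring
      rw [this, hsw]; field_simp
    rw [e]; linarith
  exact le_of_mul_le_mul_left h4 (by positivity)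

/-! ### Monotonicity of the level sets under contraction -/

section Nested

variable {xs x₀ x : Fin d → ℝ}

/-- The new ball lies in the old one since 2/3 + 1/3 + 1 = 2; this is why each run must divide the
distance by three. -/
theorem levelL_subset (hB : (q.Aᵀ * q.A).PosDef)
    (h : ‖q.emb (x - xs)‖ ≤ ‖q.emb (x₀ - xs)‖ / 3) : q.levelL xs x ⊆ q.levelL xs x₀ := by
  have h1 : q.ballK xs x ⊆ q.ballK xs x₀ := by
    intro z hz
    rw [mem_ballK] at hz ⊢
    have e : z - x₀ = (z - x) + ((x - xs) - (x₀ - xs)) := by abel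
    have h2 : ‖q.emb (z - x₀)‖
        ≤ ‖q.emb (z - x)‖ + (‖q.emb (x - xs)‖ + ‖q.emb (x₀ - xs)‖) := by
      rw [e, map_add, map_sub _ (x - xs)]
      exact (norm_add_le _ _).trans (add_le_add le_rfl (norm_sub_le _ _))
    linarith
  have h2 : q.maxF xs x ≤ q.maxF xs x₀ :=
    csSup_le_csSup (bddAbove_image_ballK hB xs x₀)
      ⟨_, x, mem_ballK.2 (by rw [sub_self, map_zero, norm_zero]; positivity), rfl⟩
      (Set.image_mono h1)
  exact fun z hz => le_trans hz h2

theorem paramP_le (hB : (q.Aᵀ * q.A).PosDef) (hc : ConvexOn ℝ Set.univ q.f)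
    (hmin : ∀ z, q.f xs ≤ q.f z) (h : ‖q.emb (x - xs)‖ ≤ ‖q.emb (x₀ - xs)‖ / 3) :
    q.paramP xs x ≤ q.paramP xs x₀ := by
  have hs := levelL_subset hB h
  refine csSup_le_csSup (bddAbove_paramP hB hc hmin x₀)
    ⟨_, x, self_mem_levelL hB xs x, x, self_mem_levelL hB xs x, rfl⟩ ?_
  rintro r ⟨y, hy, z, hz, rfl⟩
  exact ⟨y, hs hy, z, hs hz, rfl⟩

theorem paramG_le (hB : (q.Aᵀ * q.A).PosDef) (hc : ConvexOn ℝ Set.univ q.f)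
    (hmin : ∀ z, q.f xs ≤ q.f z) (h : ‖q.emb (x - xs)‖ ≤ ‖q.emb (x₀ - xs)‖ / 3) :
    q.paramG xs x ≤ q.paramG xs x₀ := by
  have hs := levelL_subset hB h
  refine csSup_le_csSup (bddAbove_paramG hB hc hmin x₀) ⟨_, x, self_mem_levelL hB xs x, rfl⟩ ?_
  rintro r ⟨y, hy, rfl⟩
  exact ⟨y, hs hy, rfl⟩

end Nested

end Quartic

/-! ### Choice of the parameters -/

/-- Parameters of the method for condition number `θ`, with `2 ^ J ≥ θ ^ 520`. -/
noncomputable def runParams (n J : ℕ) (θ : ℝ) : Params where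
  rho := θ⁻¹ ^ 6
  epsAam := θ⁻¹ ^ 60
  N := ⌊20 * (n : ℝ) ^ ((1 : ℝ) / 5)⌋₊
  K := 4 * J
  M := J
  J := J

/-- Four Bregman steps gain at least what one bisection step does, as (5/6)⁴ < 1/2. -/
theorem five_sixths_pow_le (J : ℕ) : ((5 : ℝ) / 6) ^ (4 * J) ≤ (2 ^ J)⁻¹ := by
  rw [pow_mul, ← inv_pow]
  exact pow_le_pow_left₀ (by norm_num) (by norm_num) J

theorem pow_mul_inv_pow_add {θ : ℝ} (h : 0 < θ) (a b : ℕ) :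
    θ ^ a * θ⁻¹ ^ (a + b) = θ⁻¹ ^ b := by
  rw [pow_add, ← mul_assoc, ← mul_pow, mul_inv_cancel₀ h.ne', one_pow, one_mul]

/-- A numerical constant is absorbed by a power of a number `t ≤ 1 / 2`. -/
theorem mul_pow_add_le {t c : ℝ} (h0 : 0 ≤ t) (h : t ≤ 1 / 2) (k b : ℕ) (hc : c ≤ 2 ^ k) :
    c * t ^ (k + b) ≤ t ^ b := by
  have h1 : t ^ k ≤ (1 / 2) ^ k := pow_le_pow_left₀ h0 h k
  have h2 : c * t ^ k ≤ 1 := by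
    calc c * t ^ k ≤ 2 ^ k * (1 / 2) ^ k := mul_le_mul hc h1 (by positivity) (by positivity)
      _ = 1 := by rw [← mul_pow]; norm_num
  rw [pow_add, ← mul_assoc]
  exact mul_le_of_le_one_left (by positivity) h2

theorem three_mul_pow_le_searchTol (n J : ℕ) {θ : ℝ} (hθ : 0 < θ) (P : ℝ) :
    3 * θ⁻¹ ^ 30 ≤ Quartic.searchTol (runParams n J θ) P := by
  have h1 : 0 ≤ (runParams n J θ).epsAam := by rw [runParams]; positivity
  have h2 : 3 * θ⁻¹ ^ 30 ≤ √(12 * (runParams n J θ).epsAam) := by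
    refine Real.le_sqrt_of_sq_le ?_
    have e : (runParams n J θ).epsAam = (θ⁻¹ ^ 30) ^ 2 := by rw [runParams]; ring
    rw [e]
    nlinarith [sq_nonneg (θ⁻¹ ^ 30)]
  have h3 : 0 ≤ 6 * (runParams n J θ).epsAam ^ ((1 : ℝ) / 4) * √P := by positivity
  rw [Quartic.searchTol]
  linarith

namespace Quartic

variable {d n : ℕ} {q : Quartic d n}

/-- Every quantity is a power of t = 1/θ up to a constant, and D lies between t and θ/4. The
exponents are widely separated (6 for ρ⁻, at most 30 for the search tolerance, 110 for the model
residual, 120 for the bracket width, 520 for the bisection), so each condition has spare powers of t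
≤ 1/2 to absorb its constant. -/
theorem runSetting_runParams {J : ℕ} {θ D P ε : ℝ} {xs : Fin d → ℝ} (hθ : 2 ≤ θ)
    (hJ : θ ^ 520 ≤ 2 ^ J) (hD : θ⁻¹ ≤ D) (hDP : 16 * D ^ 2 ≤ P) (hP : 2 * P ≤ θ)
    (hε : θ⁻¹ ≤ ε) (hess : ∀ x, ‖q.emb (x - xs)‖ ≤ 33 / 5 * D → q.HessLe x (θ ^ 5)) :
    q.RunSetting (runParams n J θ) xs P D (θ ^ 5) (θ⁻¹ ^ 120) (θ⁻¹ ^ 120) ε := by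
  have hθ0 : 0 < θ := by linarith
  have hc := pow_mul_inv_pow_add hθ0
  set t := θ⁻¹ with ht
  have ht0 : 0 < t := inv_pos.2 hθ0
  have hth : θ * t = 1 := mul_inv_cancel₀ hθ0.ne'
  have ht2 : t ≤ 1 / 2 := by
    rw [ht, one_div]; exact inv_anti₀ (by norm_num) hθ
  have hab := fun {c : ℝ} (k b : ℕ) (h : c ≤ 2 ^ k) => mul_pow_add_le ht0.le ht2 k b h
  have hD0 : 0 < D := ht0.trans_le hD
  have hDθ : 4 * D ≤ θ := by nlinarith
  have hDle : D ≤ θ := by linarith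
  have hP0 : 0 ≤ P := le_trans (by positivity) hDP
  have hsP : √P ≤ θ := Real.sqrt_le_iff.2 ⟨hθ0.le, by nlinarith⟩
  have hrb : resBound (θ ^ 5) (t ^ 120) = 41 * t ^ 110 := by
    rw [resBound, ← pow_mul, mul_assoc, hc 10 110]
  have hJt : (2 ^ J : ℝ)⁻¹ ≤ t ^ 520 := by
    rw [ht, inv_pow]; exact inv_anti₀ (by positivity) hJ
  have hJbig : (2 : ℝ) ^ 20 ≤ 2 ^ J :=
    ((pow_le_pow_left₀ (by norm_num) hθ 20).trans
      (pow_le_pow_right₀ (by linarith) (by norm_num))).trans hJ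
  have htol := three_mul_pow_le_searchTol n J hθ0 P
  rw [← ht] at htol
  have hquart : (t ^ 60) ^ ((1 : ℝ) / 4) = t ^ 15 := by
    rw [show t ^ 60 = (t ^ 15) ^ 4 by ring, ← Real.rpow_natCast (t ^ 15) 4,
      ← Real.rpow_mul (by positivity)]
    norm_num
  have hsr : √(t ^ 6) = t ^ 3 := by
    rw [show t ^ 6 = (t ^ 3) ^ 2 by ring, Real.sqrt_sq (by positivity)]
  have hmove : t ^ 120 / t ^ 6 * (16 / 5 * D) ≤ 4 * t ^ 113 := by
    rw [show t ^ 120 / t ^ 6 = t ^ 114 by rw [div_eq_iff (by positivity)]; ring]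
    have : t ^ 114 * D ≤ t ^ 114 * θ := mul_le_mul_of_nonneg_left hDle (by positivity)
    have e : t ^ 114 * θ = t ^ 113 := by
      rw [show t ^ 114 * θ = t ^ 113 * (θ * t) by ring, hth, mul_one]
    have : 0 < t ^ 113 := by positivity
    linarith
  refine
    { D_pos := hD0
      le_P := hDP
      one_le := one_le_pow₀ (by linarith)
      D_le := hDθ.trans (le_self_pow₀ (by linarith) (by norm_num))
      hess := hess
      J_large := ?_
      ω_nonneg := by positivity
      KJ_large := ?_
      res_le := ?_
      rho_pos := ?_
      rho_le := ?_
      res_le_rho := ?_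
      eps_pos := ?_
      eps_lt := ?_
      tol_le := ?_
      early := ?_
      M_large := ?_
      θ_nonneg := by positivity
      θ_lt := ?_
      move_le := ?_
      cont := ?_ }
  · refine le_trans ?_ hJbig
    norm_num
  · change 12 * ((5 / 6) ^ (4 * J) * (θ ^ 5) ^ 4 + 3672 * (θ ^ 5) ^ 4 / 2 ^ J) ≤ (t ^ 120) ^ 4
    have h1 : ((5 : ℝ) / 6) ^ (4 * J) ≤ t ^ 520 := (five_sixths_pow_le J).trans hJt
    have h2 : ((5 : ℝ) / 6) ^ (4 * J) * (θ ^ 5) ^ 4 ≤ t ^ 500 := by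
      rw [← pow_mul, mul_comm]
      exact (mul_le_mul_of_nonneg_left h1 (by positivity)).trans_eq (hc 20 500)
    have h3 : 3672 * (θ ^ 5) ^ 4 / 2 ^ J ≤ 3672 * t ^ 500 := by
      rw [div_eq_mul_inv, mul_assoc, ← pow_mul]
      exact mul_le_mul_of_nonneg_left
        ((mul_le_mul_of_nonneg_left hJt (by positivity)).trans_eq (hc 20 500)) (by norm_num)
    have h4 := hab (c := 44076) 20 480 (by norm_num)
    have e : (t ^ 120) ^ 4 = t ^ 480 := by rw [← pow_mul]
    rw [e]
    norm_num at h4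
    linarith
  · rw [hrb]
    have h1 := hab (c := 4100) 107 3 (by norm_num)
    have h2 : t ^ 3 ≤ D ^ 3 := pow_le_pow_left₀ ht0.le hD 3
    norm_num at h1
    linarith
  · change 0 < t ^ 6
    positivity
  · change t ^ 6 ≤ D ^ 2
    have h1 := hab (c := 1) 4 2 (by norm_num)
    have h2 : t ^ 2 ≤ D ^ 2 := pow_le_pow_left₀ ht0.le hD 2
    norm_num at h1
    linarith
  · change 20 * resBound (θ ^ 5) (t ^ 120) ^ 2 ≤ (t ^ 6) ^ 3
    rw [hrb]
    have h1 := hab (c := 33620) 202 18 (by norm_num)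
    calc 20 * (41 * t ^ 110) ^ 2 = 33620 * t ^ (202 + 18) := by ring
      _ ≤ t ^ 18 := h1
      _ = (t ^ 6) ^ 3 := by ring
  · change 0 < t ^ 60
    positivity
  · change t ^ 60 < 1 / 2
    have h1 := hab (c := 2) 59 1 (by norm_num)
    norm_num at h1
    linarith
  · change (6 * √P + 5) * (t ^ 60) ^ ((1 : ℝ) / 4) ≤ t ^ 6 / 16
    rw [hquart]
    have h1 : (6 * √P + 5) * t ^ 15 ≤ (9 * θ) * t ^ 15 :=
      mul_le_mul_of_nonneg_right (by linarith) (by positivity)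
    have e : (9 * θ) * t ^ 15 = 9 * t ^ 14 := by
      rw [show (9 * θ) * t ^ 15 = 9 * t ^ 14 * (θ * t) by ring, hth, mul_one]
    have h2 := hab (c := 144) 8 6 (by norm_num)
    norm_num at h2
    linarith
  · change 11 * √(t ^ 6) ^ 3 * D ≤ ε
    rw [hsr]
    have h1 : 11 * (t ^ 3) ^ 3 * D ≤ 11 * (t ^ 3) ^ 3 * θ :=
      mul_le_mul_of_nonneg_left hDle (by positivity)
    have e : 11 * (t ^ 3) ^ 3 * θ = 11 * t ^ 8 := by
      rw [show 11 * (t ^ 3) ^ 3 * θ = 11 * t ^ 8 * (θ * t) by ring, hth, mul_one]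
    have h2 := hab (c := 11) 7 1 (by norm_num)
    norm_num at h2
    linarith
  · change P ≤ t ^ 120 * 2 ^ J
    have h1 : t ^ 120 * θ ^ 520 ≤ t ^ 120 * 2 ^ J := mul_le_mul_of_nonneg_left hJ (by positivity)
    have e : t ^ 120 * θ ^ 520 = θ ^ 400 := by
      rw [show t ^ 120 * θ ^ 520 = θ ^ 400 * (θ * t) ^ 120 by ring, hth, one_pow, mul_one]
    have h2 : θ ≤ θ ^ 400 := le_self_pow₀ (by linarith) (by norm_num)
    linarith
  · have h1 := hab (c := 1) 90 30 (by norm_num)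
    have h2 : 0 < t ^ 30 := by positivity
    norm_num at h1
    linarith
  · change t ^ 120 / t ^ 6 * (16 / 5 * D) ≤ 1
    have h1 := hab (c := 4) 113 0 (by norm_num)
    norm_num at h1
    linarith
  · change 300 * D ^ 3 * (42 * resBound (θ ^ 5) (t ^ 120)
      + 84 * θ ^ 5 * (t ^ 120 / t ^ 6 * (16 / 5 * D))) ≤ _
    rw [hrb]
    have h1 : 84 * θ ^ 5 * (t ^ 120 / t ^ 6 * (16 / 5 * D)) ≤ 336 * t ^ 108 := by
      calc _ ≤ 84 * θ ^ 5 * (4 * t ^ 113) := mul_le_mul_of_nonneg_left hmove (by positivity)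
        _ = 336 * (θ ^ 5 * t ^ (5 + 108)) := by ring
        _ = _ := by rw [hc]
    have h2 : t ^ 110 ≤ t ^ 108 := pow_le_pow_of_le_one ht0.le (by linarith) (by norm_num)
    have h3 : D ^ 3 ≤ θ ^ 3 := pow_le_pow_left₀ hD0.le hDle 3
    have h4 : 300 * D ^ 3 * (42 * (41 * t ^ 110)
        + 84 * θ ^ 5 * (t ^ 120 / t ^ 6 * (16 / 5 * D))) ≤ 300 * θ ^ 3 * (2058 * t ^ 108) :=
      mul_le_mul (by linarith) (by linarith) (by positivity) (by positivity)
    have h5 : 300 * θ ^ 3 * (2058 * t ^ 108) = 617400 * t ^ (15 + 90) := by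
      rw [show 300 * θ ^ 3 * (2058 * t ^ 108) = 617400 * (θ ^ 3 * t ^ (3 + 105)) by ring, hc]
    have h6 := mul_pow_add_le (c := 617400 / 27) ht0.le ht2 15 90 (by norm_num)
    calc _ ≤ _ := h4
      _ = 27 * (617400 / 27 * t ^ (15 + 90)) := by rw [h5]; ring
      _ ≤ 27 * t ^ 90 := by linarith
      _ = (3 * t ^ 30) ^ 3 := by ring
      _ ≤ _ := pow_le_pow_left₀ (by positivity) htol 3

end Quartic

namespace Quartic

variable {d n : ℕ} {q : Quartic d n}

/-! ### Restarts -/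

section Restart

variable {J : ℕ} {Z θ ε : ℝ} {xs : Fin d → ℝ}

/-- Failure of accuracy supplies the missing lower bounds: ε < f(x) − f(x*) ≤ √𝒢 D gives D ≥ 1/θ and
√𝒢 ≤ θD. The latter bounds the curvature 6√𝒢/D at the minimizer by 6θ, and shifting it stays below
16θ ≤ θ⁵. -/
theorem runSetting_of_not_accurate (hB : (q.Aᵀ * q.A).PosDef) (hc : ConvexOn ℝ Set.univ q.f)
    (hmin : ∀ z, q.f xs ≤ q.f z) {x : Fin d → ℝ} (hZ : 1 ≤ Z) (hθ : 2 * Z ≤ θ)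
    (hε : Z ≤ θ * ε) (hJ : θ ^ 520 ≤ 2 ^ J) (hP : q.paramP xs x ≤ Z) (hG : q.paramG xs x ≤ Z)
    (hx : ε < q.f x - q.f xs) :
    q.RunSetting (runParams n J θ) xs (q.paramP xs x) ‖q.emb (x - xs)‖ (θ ^ 5) (θ⁻¹ ^ 120)
      (θ⁻¹ ^ 120) ε := by
  have hθ0 : 0 < θ := by linarith
  have h16 := sixteen_mul_sq_le_paramP hB hc hmin x
  have hsub := sub_le_of_mem_levelL hB hc hmin (self_mem_levelL hB xs x)
  have hε0 : 0 < ε := by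
    by_contra h
    push Not at h
    nlinarith
  have hD0 : 0 < ‖q.emb (x - xs)‖ := by
    refine lt_of_le_of_ne (norm_nonneg _) fun h => ?_
    rw [← h] at hsub
    linarith
  have hessx := hessLe_minimizer hB hc hmin hD0
  set D := ‖q.emb (x - xs)‖
  have hsG : √(q.paramG xs x) ≤ Z := Real.sqrt_le_iff.2 ⟨by linarith, by nlinarith⟩
  have hsG0 := Real.sqrt_nonneg (q.paramG xs x)
  have hGsq : √(q.paramG xs x) ^ 2 = q.paramG xs x := Real.sq_sqrt (paramG_nonneg hB xs x)
  set s := √(q.paramG xs x)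
  have hsθD : s ≤ θ * D := by
    have h1 : s * s ≤ (θ * D) * s := by nlinarith
    rcases hsG0.eq_or_lt with h | h
    · rw [← h]; positivity
    · exact le_of_mul_le_mul_right h1 h
  have hθD : θ⁻¹ ≤ D := by
    rw [inv_le_iff_one_le_mul₀ hθ0, mul_comm]
    have h1 : Z < θ * D * s := by nlinarith
    nlinarith
  refine runSetting_runParams (by linarith) hJ hθD h16 (by linarith) ?_ fun y hy => ?_
  · rw [inv_le_iff_one_le_mul₀ hθ0, mul_comm]; linarith
  · have h1 := hessx.shift hc (y - xs)
    rw [add_sub_cancel] at h1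
    intro w
    refine (h1 w).trans (mul_le_mul_of_nonneg_right ?_ (by positivity))
    have h2 : 6 * s / D ≤ 6 * θ := by rw [div_le_iff₀ hD0]; linarith
    have h3 : ‖q.emb (y - xs)‖ ^ 2 ≤ (33 / 5 * D) ^ 2 := pow_le_pow_left₀ (norm_nonneg _) hy 2
    have h4 : 16 * θ ≤ θ ^ 5 := by
      have : (2 : ℝ) ^ 4 ≤ θ ^ 4 := pow_le_pow_left₀ (by norm_num) (by linarith) 4
      nlinarith
    nlinarith

theorem runParams_N_large (n J : ℕ) (θ : ℝ) :
    3200000 * (n : ℝ) ≤ (((runParams n J θ).N : ℝ) + 1) ^ 5 := by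
  have h1 : 20 * (n : ℝ) ^ ((1 : ℝ) / 5) ≤ ((runParams n J θ).N : ℝ) + 1 :=
    (Nat.lt_floor_add_one _).le
  have h2 : ((n : ℝ) ^ ((1 : ℝ) / 5)) ^ 5 = n := by
    rw [← Real.rpow_natCast, ← Real.rpow_mul (Nat.cast_nonneg n)]; norm_num
  calc 3200000 * (n : ℝ) = (20 * (n : ℝ) ^ ((1 : ℝ) / 5)) ^ 5 := by rw [mul_pow, h2]; norm_num
    _ ≤ _ := pow_le_pow_left₀ (by positivity) h1 5

/-- A run reaches accuracy `ε`, or it divides the distance to the minimizer by three. -/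
theorem accurate_or_contract (hB : (q.Aᵀ * q.A).PosDef) (hc : ConvexOn ℝ Set.univ q.f)
    (hmin : ∀ z, q.f xs ≤ q.f z) {x : Fin d → ℝ} (hZ : 1 ≤ Z) (hθ : 2 * Z ≤ θ)
    (hε : Z ≤ θ * ε) (hJ : θ ^ 520 ≤ 2 ^ J) (hP : q.paramP xs x ≤ Z) (hG : q.paramG xs x ≤ Z)
    (hx : ε < q.f x - q.f xs) {x' : Fin d → ℝ}
    (hx' : x' = (q.fastQuarticRun (runParams n J θ) (q.paramP xs x) (q.paramG xs x) x).val) :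
    q.f x' - q.f xs ≤ ε ∨ ‖q.emb (x' - xs)‖ ≤ ‖q.emb (x - xs)‖ / 3 := by
  have hS := runSetting_of_not_accurate hB hc hmin hZ hθ hε hJ hP hG hx
  refine (fastQuarticRun_spec hB hc hmin hS (paramG_nonneg hB xs x)).imp ?_ ?_
  · rw [hx']; exact id
  rw [← hx']
  intro h
  have hn : (0 : ℝ) < n := by
    have hne : x ≠ xs := by
      rintro rfl
      have := hS.D_pos
      rw [sub_self, map_zero, norm_zero] at this
      exact this.false
    exact_mod_cast n_pos_of_ne hB hne
  set D := ‖q.emb (x - xs)‖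
  have h1 := norm_pow_four_le_of_min hc hmin x'
  have h2 := runParams_N_large n J θ
  have h3 : 0 ≤ q.f x' - q.f xs := sub_nonneg.2 (hmin x')
  have h4 : 3200000 * n * (q.f x' - q.f xs) ≤ 192 * D ^ 4 :=
    (mul_le_mul_of_nonneg_right h2 h3).trans h
  -- The factor 20 in the number of iterations gives 20⁵ = 3200000, and 72 · 192/3200000 < 1/81.
  have h5 : ‖q.emb (x' - xs)‖ ^ 4 ≤ (D / 3) ^ 4 := by
    have : 0 ≤ D ^ 4 := by positivity
    rw [div_pow]
    linarith
  exact (pow_le_pow_iff_left₀ (norm_nonneg _) (by positivity) (by norm_num)).1 h5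

/-- The number of runs is the first time accuracy is reached. Until then each run contracts, and
once Z times the distance is below ε the gradient bound √𝒢 ≤ Z gives accuracy. -/
theorem exists_runs (hB : (q.Aᵀ * q.A).PosDef) (hc : ConvexOn ℝ Set.univ q.f)
    (hmin : ∀ z, q.f xs ≤ q.f z) (hZ : 1 ≤ Z) (hθ : 2 * Z ≤ θ) (hε : Z ≤ θ * ε)
    (hJ : θ ^ 520 ≤ 2 ^ J) (m : ℕ) (x : Fin d → ℝ) (hP : q.paramP xs x ≤ Z)
    (hG : q.paramG xs x ≤ Z) (hm : Z * ‖q.emb (x - xs)‖ ≤ 3 ^ m * ε) :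
    ∃ S ≤ m, q.f (q.fastQuartic (runParams n J θ) (q.paramP xs) (q.paramG xs) S x).val
      - q.f xs ≤ ε := by
  induction m generalizing x with
  | zero =>
    refine ⟨0, le_rfl, ?_⟩
    have h1 := sub_le_of_mem_levelL hB hc hmin (self_mem_levelL hB xs x)
    have h2 : √(q.paramG xs x) ≤ Z := Real.sqrt_le_iff.2 ⟨by linarith, by nlinarith⟩
    have h3 := mul_le_mul_of_nonneg_right h2 (norm_nonneg (q.emb (x - xs)))
    rw [pow_zero, one_mul] at hm
    change q.f x - q.f xs ≤ ε
    linarith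
  | succ m ih =>
    by_cases hx : q.f x - q.f xs ≤ ε
    · exact ⟨0, Nat.zero_le _, hx⟩
    push Not at hx
    rcases accurate_or_contract hB hc hmin hZ hθ hε hJ hP hG hx rfl with h | h
    · exact ⟨1, Nat.le_add_left _ _, h⟩
    · obtain ⟨S, hS, hf⟩ := ih _ ((paramP_le hB hc hmin h).trans hP)
        ((paramG_le hB hc hmin h).trans hG) (by
          have := mul_le_mul_of_nonneg_left h (zero_le_one.trans hZ)
          rw [pow_succ] at hm
          linarith)
      exact ⟨S + 1, Nat.succ_le_succ hS, hf⟩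

end Restart

/-- Logarithmically many bisection steps suffice. -/
theorem exists_pow_le_two_pow {θ : ℝ} (hθ : 2 ≤ θ) :
    ∃ J : ℕ, θ ^ 520 ≤ 2 ^ J ∧ (J : ℝ) + 1 ≤ 800 * Real.log θ := by
  have h2 := Real.log_two_gt_d9
  have hl : Real.log 2 ≤ Real.log θ := Real.log_le_log (by norm_num) hθ
  have h20 : 0 < Real.log 2 := by linarith
  refine ⟨⌈520 * Real.log θ / Real.log 2⌉₊, ?_, ?_⟩
  · rw [← Real.log_le_log_iff (by positivity) (by positivity), Real.log_pow, Real.log_pow,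
      ← div_le_iff₀ h20]
    exact_mod_cast Nat.le_ceil _
  · have h3 := Nat.ceil_lt_add_one (a := 520 * Real.log θ / Real.log 2)
      (div_nonneg (by linarith) h20.le)
    have h4 : 520 * Real.log θ / Real.log 2 ≤ 754 * Real.log θ := by
      rw [div_le_iff₀ h20]; nlinarith
    linarith

theorem work_le {n J S : ℕ} {θ l : ℝ} (hn : 0 < n) (hJ : (J : ℝ) + 1 ≤ 800 * l) (hS : S ≤ J) :
    ((S * (runParams n J θ).work : ℕ) : ℝ)
      ≤ 21 * 800 ^ 3 * 3200 * ((n : ℝ) ^ ((1 : ℝ) / 5) * l ^ 4) := by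
  have hn1 : (1 : ℝ) ≤ (n : ℝ) ^ ((1 : ℝ) / 5) :=
    Real.one_le_rpow (by exact_mod_cast hn) (by norm_num)
  set r := (n : ℝ) ^ ((1 : ℝ) / 5) with hr
  have hN : (((runParams n J θ).N : ℕ) : ℝ) + 1 ≤ 21 * r := by
    have h1 : (((runParams n J θ).N : ℕ) : ℝ) ≤ 20 * r := Nat.floor_le (by positivity)
    linarith
  have hl0 : 0 ≤ l := by
    have : (0 : ℝ) ≤ J := J.cast_nonneg
    linarith
  have hS' : (S : ℝ) ≤ 800 * l := by
    have : (S : ℝ) ≤ J := by exact_mod_cast hS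
    linarith
  have hK : (4 * (J : ℝ)) + 1 ≤ 3200 * l := by linarith
  have e : ((S * (runParams n J θ).work : ℕ) : ℝ)
      = S * (((runParams n J θ).N + 1) * ((J + 1) * ((4 * J + 1) * (J + 1)))) := by
    rw [Params.work]; push_cast; simp only [runParams]; push_cast; ring
  rw [e]
  calc (S : ℝ) * (((runParams n J θ).N + 1) * ((J + 1) * ((4 * J + 1) * (J + 1))))
      ≤ (800 * l) * ((21 * r) * ((800 * l) * ((3200 * l) * (800 * l)))) := by gcongr
    _ = _ := by ring

end Quartic

/-! ### The main theorem -/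

theorem theorem1 :
    ∃ (C : ℝ) (p : ℕ), ∀ (d n : ℕ) (q : Quartic d n),
      (q.Aᵀ * q.A).PosDef → ConvexOn ℝ Set.univ q.f →
      (∀ x : Fin d → ℝ, (q.gradient x).val = gradVec q.f x ∧
        ((q.gradient x).cost.ops : ℝ) ≤ C * q.nnz) ∧
      ∃ xs : Fin d → ℝ, (∀ z, q.f xs ≤ q.f z) ∧
        ∀ (x₀ : Fin d → ℝ) (ε : ℝ), 0 < ε →
          ∃ (par : Params) (S : ℕ),
            0 < par.rho ∧ par.rho < 1 / 2 ∧ 2 * q.paramP xs x₀ * par.rho ≤ ε ∧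
            0 < par.epsAam ∧ par.epsAam < 1 / 2 ∧
            q.f (q.fastQuartic par (q.paramP xs) (q.paramG xs) S x₀).val - q.f xs ≤ ε ∧
            ((q.fastQuartic par (q.paramP xs) (q.paramG xs) S x₀).cost.oracle : ℝ) ≤
              C * (n : ℝ) ^ ((1 : ℝ) / 5) *
                Real.log (q.paramZ xs x₀ / min ε (1 / 2)) ^ p ∧
            ((q.fastQuartic par (q.paramP xs) (q.paramG xs) S x₀).cost.solves : ℝ) ≤
              C * (n : ℝ) ^ ((1 : ℝ) / 5) *
                Real.log (q.paramZ xs x₀ / min ε (1 / 2)) ^ p ∧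
            ((q.fastQuartic par (q.paramP xs) (q.paramG xs) S x₀).cost.ops : ℝ) ≤
              C * (n : ℝ) ^ ((1 : ℝ) / 5) *
                Real.log (q.paramZ xs x₀ / min ε (1 / 2)) ^ p * q.nnz := by
  refine ⟨103 * (21 * 800 ^ 3 * 3200), 4, fun d n q hB hc => ⟨fun x => ⟨q.gradient_val x, ?_⟩, ?_⟩⟩
  · have h1 : ((q.gradient x).cost.ops : ℝ) ≤ 9 * q.nnz := by
      exact_mod_cast (q.gradient_within x).1
    refine h1.trans (mul_le_mul_of_nonneg_right (by norm_num) (Nat.cast_nonneg _))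
  obtain ⟨xs, hmin⟩ := Quartic.exists_minimizer hB hc
  refine ⟨xs, hmin, fun x₀ ε hε => ?_⟩
  have hZ1 : 1 ≤ q.paramZ xs x₀ := le_max_left _ _
  have hPZ : q.paramP xs x₀ ≤ q.paramZ xs x₀ := (le_max_left _ _).trans (le_max_right _ _)
  have hGZ : q.paramG xs x₀ ≤ q.paramZ xs x₀ := (le_max_right _ _).trans (le_max_right _ _)
  have h16 := Quartic.sixteen_mul_sq_le_paramP hB hc hmin x₀
  set Z := q.paramZ xs x₀
  have hm0 : 0 < min ε (1 / 2) := lt_min hε (by norm_num)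
  have hm1 : min ε (1 / 2) ≤ ε := min_le_left _ _
  have hm2 : min ε (1 / 2) ≤ 1 / 2 := min_le_right _ _
  set θ := Z / min ε (1 / 2) with hθ
  have hθm : θ * min ε (1 / 2) = Z := div_mul_cancel₀ _ hm0.ne'
  have hθZ : 2 * Z ≤ θ := by rw [hθ, le_div_iff₀ hm0]; nlinarith
  have hθ0 : 0 < θ := by linarith
  have hθε : Z ≤ θ * ε := by rw [← hθm]; gcongr
  obtain ⟨J, hJ, hJl⟩ := Quartic.exists_pow_le_two_pow (θ := θ) (by linarith)
  have hl0 : 0 ≤ Real.log θ := Real.log_nonneg (by linarith)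
  have ht2 : θ⁻¹ ≤ 1 / 2 := by rw [one_div]; exact inv_anti₀ (by norm_num) (by linarith)
  have ht0 : 0 < θ⁻¹ := inv_pos.2 hθ0
  have hrho : θ⁻¹ ^ 6 ≤ θ⁻¹ ^ 2 := pow_le_pow_of_le_one ht0.le (by linarith) (by norm_num)
  have hmem : 2 * q.paramP xs x₀ * θ⁻¹ ^ 6 ≤ ε := by
    have h1 : θ⁻¹ ≤ ε := by
      rw [inv_le_iff_one_le_mul₀ hθ0, mul_comm]; linarith
    calc 2 * q.paramP xs x₀ * θ⁻¹ ^ 6 ≤ θ * θ⁻¹ ^ 2 := by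
          refine mul_le_mul (by linarith) hrho (by positivity) hθ0.le
      _ = θ⁻¹ := by rw [pow_two, ← mul_assoc, mul_inv_cancel₀ hθ0.ne', one_mul]
      _ ≤ ε := h1
  have h60 : θ⁻¹ ^ 60 < 1 / 2 := by
    have h1 : θ⁻¹ ^ 60 ≤ θ⁻¹ ^ 2 := pow_le_pow_of_le_one ht0.le (by linarith) (by norm_num)
    nlinarith
  suffices h : ∃ S, q.f (q.fastQuartic (runParams n J θ) (q.paramP xs) (q.paramG xs) S x₀).val
        - q.f xs ≤ ε ∧ ∃ W : ℕ,
      (q.fastQuartic (runParams n J θ) (q.paramP xs) (q.paramG xs) S x₀).cost.Within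
        (103 * W * q.nnz) (3 * W) (3 * W) ∧
      (W : ℝ) ≤ 21 * 800 ^ 3 * 3200 * ((n : ℝ) ^ ((1 : ℝ) / 5) * Real.log θ ^ 4) by
    obtain ⟨S, hS, W, hW, hWl⟩ := h
    have hW0 : (0 : ℝ) ≤ W := W.cast_nonneg
    have h1 : 103 * (W : ℝ) ≤ 103 * (21 * 800 ^ 3 * 3200) * (n : ℝ) ^ ((1 : ℝ) / 5)
        * Real.log θ ^ 4 := by
      linarith
    refine ⟨runParams n J θ, S, pow_pos ht0 6, ?_, hmem, pow_pos ht0 60, h60, hS, ?_, ?_, ?_⟩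
    · change θ⁻¹ ^ 6 < 1 / 2
      nlinarith
    · have h2 : ((q.fastQuartic (runParams n J θ) (q.paramP xs) (q.paramG xs) S x₀).cost.oracle : ℝ)
          ≤ 3 * W := by exact_mod_cast hW.2.1
      linarith
    · have h2 : ((q.fastQuartic (runParams n J θ) (q.paramP xs) (q.paramG xs) S x₀).cost.solves : ℝ)
          ≤ 3 * W := by exact_mod_cast hW.2.2
      linarith
    · have h2 : ((q.fastQuartic (runParams n J θ) (q.paramP xs) (q.paramG xs) S x₀).cost.ops : ℝ)
          ≤ 103 * W * q.nnz := by exact_mod_cast hW.1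
      exact h2.trans (mul_le_mul_of_nonneg_right h1 (Nat.cast_nonneg _))
  -- At the minimizer no run is made: n may be 0 there, and then the budget is 0 as well.
  rcases eq_or_ne x₀ xs with rfl | hne
  · refine ⟨0, ?_, 0, Cost.within_zero _ _ _, ?_⟩
    · change q.f x₀ - q.f x₀ ≤ ε
      linarith
    · rw [Nat.cast_zero]; positivity
  have hn : 0 < n := Quartic.n_pos_of_ne hB hne
  have hd := Quartic.dim_le_nnz hB
  have h1 : 1 ≤ q.nnz := by
    obtain ⟨i, -⟩ := Function.ne_iff.1 hne
    have := i.pos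
    omega
  -- J contractions are enough because 3^J ≥ θ², so the number of runs is logarithmic too and the
  -- total exponent of the logarithm is four.
  have hD : Z * ‖q.emb (x₀ - xs)‖ ≤ 3 ^ J * ε := by
    have hDZ : ‖q.emb (x₀ - xs)‖ ≤ Z :=
      (pow_le_pow_iff_left₀ (norm_nonneg _) (by linarith) two_ne_zero).1 (by nlinarith)
    have h3 : θ ^ 2 ≤ (3 : ℝ) ^ J :=
      ((pow_le_pow_right₀ (by linarith) (by norm_num)).trans hJ).trans
        (pow_le_pow_left₀ (by norm_num) (by norm_num) J)
    calc Z * ‖q.emb (x₀ - xs)‖ ≤ (θ * ε) * θ :=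
          mul_le_mul hθε (by linarith) (norm_nonneg _) (by positivity)
      _ = θ ^ 2 * ε := by ring
      _ ≤ 3 ^ J * ε := mul_le_mul_of_nonneg_right h3 hε.le
  obtain ⟨S, hSJ, hS⟩ := Quartic.exists_runs hB hc hmin hZ1 hθZ hθε hJ J x₀ hPZ hGZ hD
  exact ⟨S, hS, _, Quartic.fastQuartic_within hd h1 _ _ _ _ _, Quartic.work_le hn hJl hSJ⟩
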